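/- Let $\Bbbk$ be an algebraically closed field. A $\Bbbk$-linear category is \emph{finitary} if it is $\Bbbk$-linearly equivalent to the category $B$-proj of finitely generated projective left modules over a finite dimensional basic $\Bbbk$-algebra $B$. A \emph{finitary $2$-category} $\mathscr{D}$ is a strict $2$-category with finitely many objects, in which all morphism categories $\mathscr{D}(\mathtt{i},\mathtt{j})$ are finitary $\Bbbk$-linear, all compositions are $\Bbbk$-bilinear, and all identity $1$-morphisms are indecomposable. A \emph{finitary $2$-representation} $\mathbf{M}$ of $\mathscr{D}$ is a strict $\Bbbk$-linear $2$-functor from $\mathscr{D}$ to the $2$-category of finitary $\Bbbk$-linear categories, additive $\Bbbk$-linear functors and natural transformations. It is \emph{transitive} if for all indecomposable objects $X\in\mathbf{M}(\mathtt{i})$ and $Y\in\mathbf{M}(\mathtt{j})$ there is a $1$-morphism $G$ such that $Y$ is isomorphic to a direct summand of $\mathbf{M}(G)X$, and \emph{simple} if it has no non-zero proper ideals that are invariant under the action of all $1$-morphisms. For indecomposable $1$-morphisms write $F\geq_J G$ if $F$ is isomorphic to a direct summand of $H_1\circ G\circ H_2$ for some $1$-morphisms $H_1,H_2$; the equivalence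 classes of this preorder are the \emph{two-sided cells}. The \emph{apex} of a simple transitive $2$-representation $\mathbf{M}$ is the (unique) two-sided cell that is maximal with respect to $\geq_J$ among those not annihilated by $\mathbf{M}$. The \emph{abelianization} $\overline{\mathbf{M}}$ is defined as follows. The objects of $\overline{\mathbf{M}}(\mathtt{i})$ are the diagrams $X\to Y$ in $\mathbf{M}(\mathtt{i})$; its morphisms are commutative squares, where two squares from $X\to Y$ to $X'\overset{\eta'}{\to} Y'$ are identified if the difference of their components $Y\to Y'$ is of the form $\eta' h$ for some $h:Y\to X'$; the $1$-morphisms of $\mathscr{D}$ act componentwise. If $\mathbf{M}(\mathtt{i})$ is identified with $A$-proj, then taking cokernels identifies $\overline{\mathbf{M}}(\mathtt{i})$ with the category of finite dimensional left $A$-modules. \textbf{Theorem.} Let $\mathbf{M}$ be a simple transitive $2$-representation of a finitary $2$-category $\mathscr{D}$, let $\mathcal{I}$ be the apex of $\mathbf{M}$, and let $F\in\mathcal{I}$, $F:\mathtt{i}\to\mathtt{j}$. Then: (i) For every object $X$ of $\overline{\mathbf{M}}(\mathtt{i})$, the object $\overline{\mathbf{M}}(F)X$ of $\overline{\mathbf{M}}(\mathtt{j})$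 is projective. (ii) If $\overline{\mathbf{M}}(F)$ is additionally left exact, then $\overline{\mathbf{M}}(F)$ is a projective functor: for all finite dimensional $\Bbbk$-algebras $A$, $B$ and all $\Bbbk$-linear equivalences $\mathbf{M}(\mathtt{i})\simeq A$-proj and $\mathbf{M}(\mathtt{j})\simeq B$-proj, the functor $\overline{\mathbf{M}}(F)$ corresponds, under the induced identifications of $\overline{\mathbf{M}}(\mathtt{i})$ and $\overline{\mathbf{M}}(\mathtt{j})$ with categories of finite dimensional modules, to a functor isomorphic to $P\otimes_A{}_-$ for some finitely generated projective $B$-$A$-bimodule $P$. -/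

import Mathlib

open CategoryTheory CategoryTheory.Limits
open scoped TensorProduct MulOpposite Bicategory

universe u w₁ v₁ u₁ v₂ u₂ v

/-! ### Direct summands and indecomposable objects -/

section Additive

variable {C : Type*} [Category* C] [Preadditive C]

/-- `X` is isomorphic to a direct summand of `Y`, that is, `Y ≅ X ⊕ Z` for some `Z`. -/
def IsSummand (X Y : C) : Prop :=
  ∃ (Z : C) (b : BinaryBicone X Z), Nonempty b.IsBilimit ∧ Nonempty (b.pt ≅ Y)

/-- `X` is indecomposable: it is non-zero, and `X ≅ Y ⊕ Z` implies `Y = 0` or `Z = 0`. -/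
def IsIndecomposable (X : C) : Prop :=
  ¬ IsZero X ∧ ∀ (Y Z : C) (b : BinaryBicone Y Z),
    Nonempty b.IsBilimit → Nonempty (b.pt ≅ X) → IsZero Y ∨ IsZero Z

end Additive

/-! ### Finitary linear categories -/

/-- The category `B`-proj of finitely generated projective left `B`-modules. -/
abbrev FGProj (B : Type v) [Ring B] : Type (v + 1) :=
  ObjectProperty.FullSubcategory
    (fun X : ModuleCat.{v} B => Module.Finite B X ∧ Module.Projective B X)

/-- A finite dimensional algebra is basic if its quotient by the Jacobson radical is a product of
division rings; as this quotient is semisimple, this says that it has no nilpotent elements. -/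
def IsBasicRing (B : Type v) [Ring B] : Prop :=
  ∀ x : B, x * x ∈ Ring.jacobson B → x ∈ Ring.jacobson B

/-- A `k`-linear category is finitary if it is equivalent (`k`-linearly) to `B`-proj for some
finite dimensional basic `k`-algebra `B`. -/
def IsFinitary (k : Type u) [Field k] (C : Type u₂) [Category.{v₂} C] [Preadditive C]
    [Linear k C] : Prop :=
  ∃ (B : Type v₂) (_ : Ring B) (_ : Algebra k B), Module.Finite k B ∧ IsBasicRing B ∧
    ∃ e : C ≌ FGProj B, e.functor.Additive ∧ e.functor.Linear k

/-! ### The diagrammatic abelianization -/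

section Abelianization

variable {C : Type*} [Category* C] [Preadditive C]

variable (C) in
/-- Two morphisms from `X.left ⟶ X.right` to `Y.left ⟶ Y.right` (commutative squares) are
identified if the difference of their right components factors through `Y.hom`. -/
def nullRel : HomRel (Arrow C) := fun X Y f g =>
  ∃ h : X.right ⟶ Y.left, f.right - g.right = h ≫ Y.hom

instance : Congruence (nullRel C) where
  equivalence :=
    { refl := fun _ => ⟨0, by simp⟩
      symm := fun ⟨h, hh⟩ => ⟨-h, by rw [Preadditive.neg_comp, ← hh, neg_sub]⟩
      trans := fun ⟨h, hh⟩ ⟨h', hh'⟩ =>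
        ⟨h + h', by rw [Preadditive.add_comp, ← hh, ← hh', sub_add_sub_cancel]⟩ }
  comp_left := fun f _ _ ⟨h, hh⟩ => ⟨f.right ≫ h, by
    rw [Category.assoc, ← hh, Arrow.comp_right, Arrow.comp_right, Preadditive.comp_sub]⟩
  comp_right := fun {X Y Z} _ _ g ⟨h, hh⟩ => ⟨h ≫ g.left, by
    have hw : g.left ≫ Z.hom = Y.hom ≫ g.right := Arrow.w g
    rw [Category.assoc, hw, ← Category.assoc, ← hh, Arrow.comp_right, Arrow.comp_right,
      Preadditive.sub_comp]⟩

variable (C) in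
/-- The abelianization of `C`: objects are the diagrams `X ⟶ Y` in `C` (standing for the cokernel),
morphisms are commutative squares modulo `nullRel`. -/
abbrev DiagAb := CategoryTheory.Quotient (nullRel C)

/-- The functor between abelianizations which is given by applying an additive functor `F`
componentwise to diagrams. -/
def abMap {D : Type*} [Category* D] [Preadditive D] (F : C ⥤ D) [F.Additive] :
    DiagAb C ⥤ DiagAb D :=
  CategoryTheory.Quotient.lift (nullRel C) (F.mapArrow ⋙ CategoryTheory.Quotient.functor (nullRel D)) (by
    rintro X Y f g ⟨h, hh⟩
    refine CategoryTheory.Quotient.sound _ ⟨F.map h, ?_⟩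
    have := congrArg F.map hh
    rw [F.map_sub, F.map_comp] at this
    exact this)

end Abelianization

/-- The functor from the abelianization of `B`-proj to `B`-modules which sends a diagram `X ⟶ Y`
to its cokernel (it identifies this abelianization with `B`-mod if `B` is finite dimensional). -/
noncomputable def cokerModule (B : Type v) [Ring B] :
    DiagAb (FGProj B) ⥤ ModuleCat.{v} B :=
  CategoryTheory.Quotient.lift (nullRel (FGProj B)) ((ObjectProperty.ι _).mapArrow ⋙ coker (ModuleCat.{v} B)) (by
    rintro X Y f g ⟨h, hh⟩
    have h1 := congrArg (ObjectProperty.ι _).map hh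
    rw [Functor.map_sub, Functor.map_comp, sub_eq_iff_eq_add] at h1
    apply (cancel_epi (cokernel.π _)).1
    refine (cokernel.π_desc _ _ _).trans (Eq.trans ?_ (cokernel.π_desc _ _ _).symm)
    refine (congrArg (· ≫ cokernel.π _) h1).trans ?_
    refine (Preadditive.add_comp _ _ _ _ _ _).trans ?_
    refine (add_eq_right).2 ?_
    refine (Category.assoc _ _ _).trans ?_
    exact (congrArg (_ ≫ ·) (cokernel.condition _)).trans comp_zero)

/-- The functor from the abelianization of `C` to `A`-modules induced by an identification of
`C` with `A`-proj. -/
noncomputable def abToModule {C : Type*} [Category* C] [Preadditive C] {A : Type v} [Ring A]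
    (e : C ≌ FGProj A) [e.functor.Additive] : DiagAb C ⥤ ModuleCat.{v} A :=
  abMap e.functor ⋙ cokerModule A

/-! ### Tensoring with bimodules -/

/-- A `B`-`A`-bimodule over `k` (the two induced actions of `k` agree). -/
structure AlgBimodule (k : Type u) [Field k] (B A : Type v) [Ring B] [Algebra k B] [Ring A]
    [Algebra k A] where
  carrier : Type v
  [addCommGroup : AddCommGroup carrier]
  [moduleBase : Module k carrier]
  [moduleLeft : Module B carrier]
  [moduleRight : Module Aᵐᵒᵖ carrier]
  [towerLeft : IsScalarTower k B carrier]
  [towerRight : IsScalarTower k Aᵐᵒᵖ carrier]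
  [comm : SMulCommClass B Aᵐᵒᵖ carrier]

namespace AlgBimodule

attribute [instance] addCommGroup moduleBase moduleLeft moduleRight towerLeft towerRight comm

variable {k : Type u} [Field k] {B A : Type v} [Ring B] [Algebra k B] [Ring A] [Algebra k A]

/-- A bimodule is (finitely generated) projective if it is so as a module over `B ⊗ Aᵒᵖ`. -/
def IsFGProjective (P : AlgBimodule k B A) : Prop :=
  letI : Module (B ⊗[k] Aᵐᵒᵖ) P.carrier := TensorProduct.Algebra.module
  Module.Finite (B ⊗[k] Aᵐᵒᵖ) P.carrier ∧ Module.Projective (B ⊗[k] Aᵐᵒᵖ) P.carrier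

/-- The relations `(p · a) ⊗ x = p ⊗ (a · x)` that define `P ⊗_A X` as a quotient of `P ⊗_ℤ X`. -/
def balancing (P : AlgBimodule k B A) (X : Type v) [AddCommGroup X] [Module A X] :
    Submodule B (P.carrier ⊗[ℤ] X) :=
  Submodule.span B {t | ∃ (p : P.carrier) (a : A) (x : X),
    t = (MulOpposite.op a • p) ⊗ₜ[ℤ] x - p ⊗ₜ[ℤ] (a • x)}

/-- The functor `P ⊗_A -` from left `A`-modules to left `B`-modules. -/
noncomputable def tensorFunctor (P : AlgBimodule k B A) : ModuleCat.{v} A ⥤ ModuleCat.{v} B where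
  obj X := ModuleCat.of B ((P.carrier ⊗[ℤ] X) ⧸ P.balancing X)
  map {X Y} f := ModuleCat.ofHom (Submodule.mapQ (P.balancing X) (P.balancing Y)
    (TensorProduct.AlgebraTensorModule.map (LinearMap.id : P.carrier →ₗ[B] P.carrier)
      (f.hom.toAddMonoidHom.toIntLinearMap)) (by
        rw [balancing, Submodule.span_le]
        rintro _ ⟨p, a, x, rfl⟩
        refine Submodule.subset_span ⟨p, a, f.hom x, ?_⟩
        simp))
  map_id X := by
    refine ModuleCat.hom_ext (LinearMap.ext fun t => ?_)
    obtain ⟨t, rfl⟩ := Submodule.Quotient.mk_surjective _ t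
    induction t using TensorProduct.induction_on with
    | zero => simp
    | tmul p x => simp
    | add s t hs ht => rw [Submodule.Quotient.mk_add, map_add, map_add, hs, ht]
  map_comp f g := by
    refine ModuleCat.hom_ext (LinearMap.ext fun t => ?_)
    obtain ⟨t, rfl⟩ := Submodule.Quotient.mk_surjective _ t
    induction t using TensorProduct.induction_on with
    | zero => simp
    | tmul p x => simp
    | add s t hs ht => rw [Submodule.Quotient.mk_add, map_add, map_add, hs, ht]

end AlgBimodule

/-- A functor `G` between abelianizations of finitary `k`-linear categories `C` and `D` is a
projective functor if, whenever `C` and `D` are identified with `A`-proj and `B`-proj for finite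
dimensional `k`-algebras `A` and `B`, the functor `G` becomes isomorphic to `P ⊗_A -` for some
finitely generated projective `B`-`A`-bimodule `P`. -/
def IsProjectiveFunctor (k : Type u) [Field k] {C D : Type u₂} [Category.{v₂} C] [Category.{v₂} D]
    [Preadditive C] [Preadditive D] [Linear k C] [Linear k D]
    (G : DiagAb C ⥤ DiagAb D) : Prop :=
  ∀ (A B : Type v₂) [Ring A] [Ring B] [Algebra k A] [Algebra k B]
    [Module.Finite k A] [Module.Finite k B]
    (eC : C ≌ FGProj A) (eD : D ≌ FGProj B) [eC.functor.Additive] [eD.functor.Additive]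
    [eC.functor.Linear k] [eD.functor.Linear k],
    ∃ P : AlgBimodule k B A, P.IsFGProjective ∧
      Nonempty (G ⋙ abToModule eD ≅ abToModule eC ⋙ P.tensorFunctor)

/-! ### Finitary 2-categories and their two-sided cells -/

/-- A `k`-linear (strict) 2-category is finitary: it has finitely many objects, the morphism
categories are finitary, composition is `k`-bilinear and identity 1-morphisms are indecomposable. -/
structure IsFinitaryTwoCategory (k : Type u) [Field k] (𝒟 : Type u₁) [Bicategory.{w₁, v₁} 𝒟]
    [∀ a b : 𝒟, Preadditive (a ⟶ b)] [∀ a b : 𝒟, Linear k (a ⟶ b)] : Prop where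
  strict : Bicategory.Strict 𝒟
  finite_objects : Finite 𝒟
  finitary_hom : ∀ a b : 𝒟, IsFinitary k (a ⟶ b)
  whiskerLeft_add : ∀ {a b c : 𝒟} (F : a ⟶ b) {G H : b ⟶ c} (α β : G ⟶ H),
    F ◁ (α + β) = F ◁ α + F ◁ β
  whiskerLeft_smul : ∀ {a b c : 𝒟} (F : a ⟶ b) {G H : b ⟶ c} (r : k) (α : G ⟶ H),
    F ◁ (r • α) = r • (F ◁ α)
  add_whiskerRight : ∀ {a b c : 𝒟} {F G : a ⟶ b} (α β : F ⟶ G) (H : b ⟶ c),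
    (α + β) ▷ H = α ▷ H + β ▷ H
  smul_whiskerRight : ∀ {a b c : 𝒟} {F G : a ⟶ b} (r : k) (α : F ⟶ G) (H : b ⟶ c),
    (r • α) ▷ H = r • (α ▷ H)
  indecomposable_id : ∀ a : 𝒟, IsIndecomposable (𝟙 a)

section Cells

variable (𝒟 : Type u₁) [Bicategory.{w₁, v₁} 𝒟] [∀ a b : 𝒟, Preadditive (a ⟶ b)]

/-- The indecomposable 1-morphisms of a 2-category. -/
structure IndecOneMor where
  src : 𝒟
  tgt : 𝒟
  hom : src ⟶ tgt
  indecomposable : IsIndecomposable hom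

variable {𝒟}

namespace IndecOneMor

/-- The two-sided preorder `F ≥_J G`: there are 1-morphisms `H₁`, `H₂` such that `F` is isomorphic
to a direct summand of `H₁ ∘ G ∘ H₂`. -/
def GeJ (F G : IndecOneMor 𝒟) : Prop :=
  ∃ (H₂ : F.src ⟶ G.src) (H₁ : G.tgt ⟶ F.tgt), IsSummand F.hom (H₂ ≫ G.hom ≫ H₁)

/-- The two-sided cell of `F`. -/
def cell (F : IndecOneMor 𝒟) : Set (IndecOneMor 𝒟) := {G | GeJ F G ∧ GeJ G F}

end IndecOneMor

/-- `J` is a two-sided cell. -/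
def IsTwoSidedCell (J : Set (IndecOneMor 𝒟)) : Prop := ∃ F : IndecOneMor 𝒟, J = F.cell

/-- The order on two-sided cells induced by `≥_J`. -/
def CellGe (J K : Set (IndecOneMor 𝒟)) : Prop := ∃ F ∈ J, ∃ G ∈ K, F.GeJ G

end Cells

/-! ### Finitary 2-representations -/

/-- A finitary 2-representation of a `k`-linear 2-category `𝒟`: a strict 2-functor from `𝒟` to
the 2-category of finitary `k`-linear categories, `k`-linear functors and natural
transformations, which is `k`-linear on 2-morphisms. -/
structure FinitaryTwoRep (k : Type u) [Field k] (𝒟 : Type u₁) [Bicategory.{w₁, v₁} 𝒟]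
    [∀ a b : 𝒟, Preadditive (a ⟶ b)] [∀ a b : 𝒟, Linear k (a ⟶ b)]
    extends StrictPseudofunctor 𝒟 Cat.{v₂, u₂} where
  [preadditive : ∀ i : 𝒟, Preadditive (obj i)]
  [linear : ∀ i : 𝒟, Linear k (obj i)]
  finitary : ∀ i : 𝒟, IsFinitary k (obj i)
  additive_map : ∀ {i j : 𝒟} (F : i ⟶ j), (map F).toFunctor.Additive
  linear_map : ∀ {i j : 𝒟} (F : i ⟶ j), (map F).toFunctor.Linear k
  map₂_add : ∀ {i j : 𝒟} {F G : i ⟶ j} (α β : F ⟶ G) (X : obj i),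
    (map₂ (α + β)).toNatTrans.app X = (map₂ α).toNatTrans.app X + (map₂ β).toNatTrans.app X
  map₂_smul : ∀ {i j : 𝒟} {F G : i ⟶ j} (r : k) (α : F ⟶ G) (X : obj i),
    (map₂ (r • α)).toNatTrans.app X = r • (map₂ α).toNatTrans.app X

namespace FinitaryTwoRep

variable {k : Type u} [Field k] {𝒟 : Type u₁} [Bicategory.{w₁, v₁} 𝒟]
  [∀ a b : 𝒟, Preadditive (a ⟶ b)] [∀ a b : 𝒟, Linear k (a ⟶ b)]

attribute [instance] preadditive linear additive_map linear_map

variable (M : FinitaryTwoRep.{u, w₁, v₁, u₁, v₂, u₂} k 𝒟)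

/-- The action of the 1-morphism `F` on `M`. -/
abbrev act {i j : 𝒟} (F : i ⟶ j) : M.obj i ⥤ M.obj j := (M.map F).toFunctor

/-- The action of the 1-morphism `F` on the abelianization of `M`. -/
abbrev abAct {i j : 𝒟} (F : i ⟶ j) : DiagAb (M.obj i) ⥤ DiagAb (M.obj j) :=
  abMap (M.act F)

/-- `M` is transitive: for all indecomposable objects `X` of `M(i)` and `Y` of `M(j)` there is a
1-morphism `F` such that `Y` is isomorphic to a direct summand of `M(F) X`. -/
def IsTransitive : Prop :=
  ∀ (i j : 𝒟) (X : M.obj i) (Y : M.obj j), IsIndecomposable X → IsIndecomposable Y →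
    ∃ F : i ⟶ j, IsSummand Y ((M.act F).obj X)

/-- An ideal of `M` which is invariant under the action of the 1-morphisms. -/
structure InvariantIdeal where
  hom : ∀ (i : 𝒟) (X Y : M.obj i), Submodule k (X ⟶ Y)
  comp_mem_left : ∀ {i : 𝒟} {X Y Z : M.obj i} (f : X ⟶ Y) (g : Y ⟶ Z),
    g ∈ hom i Y Z → f ≫ g ∈ hom i X Z
  comp_mem_right : ∀ {i : 𝒟} {X Y Z : M.obj i} (f : X ⟶ Y) (g : Y ⟶ Z),
    f ∈ hom i X Y → f ≫ g ∈ hom i X Z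
  map_mem : ∀ {i j : 𝒟} (F : i ⟶ j) {X Y : M.obj i} (f : X ⟶ Y),
    f ∈ hom i X Y → (M.act F).map f ∈ hom j ((M.act F).obj X) ((M.act F).obj Y)

/-- `M` is simple: it has no non-zero proper invariant ideals. -/
def IsSimple : Prop :=
  ∀ I : M.InvariantIdeal, (∀ (i : 𝒟) (X Y : M.obj i), I.hom i X Y = ⊥) ∨
    (∀ (i : 𝒟) (X Y : M.obj i), I.hom i X Y = ⊤)

/-- `M` annihilates the set `J` of 1-morphisms: `M(F) = 0` for all `F` in `J`. -/
def Annihilates (J : Set (IndecOneMor 𝒟)) : Prop :=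
  ∀ F ∈ J, ∀ X : M.obj F.src, IsZero ((M.act F.hom).obj X)

/-- `I` is the apex of `M`: a two-sided cell which is maximal, with respect to `≥_J`, among those
not annihilated by `M`. (For simple transitive `M` such a cell exists and is unique.) -/
def IsApex (I : Set (IndecOneMor 𝒟)) : Prop :=
  IsTwoSidedCell I ∧ ¬ M.Annihilates I ∧
    ∀ J : Set (IndecOneMor 𝒟), IsTwoSidedCell J → ¬ M.Annihilates J → CellGe J I → J = I

end FinitaryTwoRep

/-! ### Perron–Frobenius eigenvectors -/

section Perron

variable {ι : Type*} [Fintype ι]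

/-! The heart of the matter is that `M(F)` sends every morphism `f` to a von Neumann regular one:
`M(F)f = M(F)f ∘ g ∘ M(F)f` for some `g` (`IsApex.isRegularHom_act`). The cokernel of a regular
morphism is represented by a direct summand of its target, so every diagram becomes projective after
applying `F`; this is (i).

Regularity comes from a growth argument. The rank of a morphism at an indecomposable `P` counts the
copies of `P` that split off from it. By transitivity the action of the sum `S` of all
indecomposable 1-morphisms on indecomposable objects has a positive matrix, and a Perron–Frobenius
eigenvector weights the ranks so that `S` multiplies the weight of every object by the same `ν`. A
morphism `f` is a split part, with the rank of some object `R`, plus a radical remainder `r`. Hence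
`S` multiplies the weight of `f` by at least `ν`, and by strictly more if `r ≠ 0`: by simplicity
some 1-morphism makes `r` non-radical (`weight_growth`). If `r = 0`, then `f` is regular.

On the other side, composition with `S` acts on nonnegative combinations of 1-morphisms of the apex
with a fixed source, modulo what `M` annihilates, and it has a nonzero nonnegative eigenvector
(`exists_eigenvector_oneMor`). Evaluated at an identity morphism, its eigenvalue must be `ν`.
Evaluated at an arbitrary `f`, it shows that on weighted average the morphisms `M(G)f` grow exactly
by `ν`, so each `G` with a positive coefficient makes `f` regular. Any other member of the cell is a
retract of some `H₁ ∘ G ∘ H₂`, and regularity passes to it.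

For (ii), `F` corresponds to tensoring with the bimodule `P` that is the value of the associated
functor at the regular module `A`. It is projective as a left `B`-module. Let `N` be the radical of
`A` and `f : A^m ⟶ A` a map with image `N`. Regularity of the value of `f` says that `PN` is a left
direct summand of `P`; left exactness says that relations in `P` over generators of `N` come from
relations in `A`, which is the vanishing of `Tor₁(P, A/N)`. Since `A/N` is separable, averaging
turns left linear sections into bimodule sections modulo `N`. So `P/PN` lifts to a projective
bimodule `L` covering `P` with kernel `K ⊆ LN`; the `Tor` condition gives `K = KN`, and nilpotency
of `N` gives `K = 0` (`projective_of_radical_conditions`). -/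

theorem Matrix.mulVec_pos_of_pos {T : Matrix ι ι ℝ} (hT : ∀ i j, 0 < T i j) {w : ι → ℝ}
    (hw : 0 ≤ w) (hw' : w ≠ 0) (i : ι) : 0 < (T.mulVec w) i := by
  obtain ⟨j, hj⟩ := Function.ne_iff.1 hw'
  have hj' : 0 < w j := lt_of_le_of_ne (hw j) (Ne.symm hj)
  exact Finset.sum_pos' (fun l _ => mul_nonneg (hT i l).le (hw l))
    ⟨j, Finset.mem_univ _, mul_pos (hT i j) hj'⟩

/-- A matrix with positive entries has an eigenvector with positive entries. -/
theorem Matrix.exists_pos_eigenvector [Nonempty ι] (T : Matrix ι ι ℝ) (hT : ∀ i j, 0 < T i j) :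
    ∃ (u : ι → ℝ) (μ : ℝ), (∀ i, 0 < u i) ∧ T.mulVec u = μ • u := by
  classical
  have hbound : ∀ (t : ℝ) (u : ι → ℝ), u ∈ stdSimplex ℝ ι → (∀ i, t * u i ≤ (T.mulVec u) i) →
      t ≤ ∑ i, ∑ j, T i j := by
    intro t u hu h
    calc t = ∑ i, t * u i := by rw [← Finset.mul_sum, hu.2, mul_one]
      _ ≤ ∑ i, (T.mulVec u) i := Finset.sum_le_sum fun i _ => h i
      _ ≤ _ := by
        refine Finset.sum_le_sum fun i _ => Finset.sum_le_sum fun j _ => ?_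
        have : u j ≤ 1 := by
          rw [← hu.2]; exact Finset.single_le_sum (fun l _ => hu.1 l) (Finset.mem_univ j)
        exact mul_le_of_le_one_right (hT i j).le this
  -- Collatz–Wielandt: the eigenvalue is the largest `t` with `t u ≤ T u` for some `u` in the
  -- simplex. By `hbound` the upper end of the interval cuts nothing off; it only makes the set
  -- compact.
  set K : Set (ℝ × (ι → ℝ)) :=
    (Set.Icc 0 (∑ i, ∑ j, T i j) ×ˢ stdSimplex ℝ ι) ∩ {p | ∀ i, p.1 * p.2 i ≤ (T.mulVec p.2) i}
    with hK
  have hcont : Continuous fun p : ℝ × (ι → ℝ) => T.mulVec p.2 :=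
    Continuous.matrix_mulVec continuous_const continuous_snd
  have hKc : IsCompact K := by
    refine (isCompact_Icc.prod (isCompact_stdSimplex ℝ ι)).inter_right ?_
    simp only [Set.ofPred_forall]
    refine isClosed_iInter fun i => isClosed_le ?_ ?_
    · fun_prop
    · exact (continuous_apply i).comp hcont
  have hKne : K.Nonempty := by
    obtain ⟨i⟩ := ‹Nonempty ι›
    refine ⟨(0, Pi.single i 1), ⟨⟨le_rfl, Finset.sum_nonneg fun _ _ => Finset.sum_nonneg
      fun _ _ => (hT _ _).le⟩, single_mem_stdSimplex ℝ i⟩, fun j => ?_⟩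
    simpa using (hT j i).le
  obtain ⟨⟨t, u⟩, ⟨⟨ht, hu⟩, hle⟩, hmax⟩ := hKc.exists_isMaxOn hKne continuous_fst.continuousOn
  simp only [Set.mem_ofPred_eq] at hle ht hu
  have hu0 : u ≠ 0 := by
    rintro rfl; simpa using hu.2
  have hTu : ∀ i, 0 < (T.mulVec u) i := Matrix.mulVec_pos_of_pos hT hu.1 hu0
  have heig : T.mulVec u = t • u := by
    by_contra hne
    have hw : 0 ≤ T.mulVec u - t • u := fun i => by simpa using hle i
    -- If `T u ≠ t u`, applying `T` to the nonzero nonnegative difference gives `T u' > t u'` in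
    -- every coordinate for `u' = T u`, so the smallest ratio `t'` beats the maximal `t`.
    have hTw := Matrix.mulVec_pos_of_pos hT hw (sub_ne_zero.2 hne)
    rw [Matrix.mulVec_sub, Matrix.mulVec_smul] at hTw
    set u' := T.mulVec u with hu'
    set s := ∑ i, u' i
    have hs : 0 < s := Finset.sum_pos (fun i _ => hTu i) Finset.univ_nonempty
    obtain ⟨i₀, hi₀⟩ := Finite.exists_min fun i => (T.mulVec u') i / u' i
    set t' := (T.mulVec u') i₀ / u' i₀
    have ht' : t < t' := by
      rw [lt_div_iff₀ (hTu i₀)]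
      simpa using hTw i₀
    have hle' : ∀ i, t' * (s⁻¹ • u') i ≤ (T.mulVec (s⁻¹ • u')) i := fun i => by
      have := (le_div_iff₀ (hTu i)).1 (hi₀ i)
      rw [Matrix.mulVec_smul, Pi.smul_apply, Pi.smul_apply, smul_eq_mul, smul_eq_mul]
      calc t' * (s⁻¹ * u' i) = s⁻¹ * (t' * u' i) := by ring
        _ ≤ _ := mul_le_mul_of_nonneg_left this (inv_nonneg.2 hs.le)
    have hmem : s⁻¹ • u' ∈ stdSimplex ℝ ι := by
      refine ⟨fun i => mul_nonneg (inv_nonneg.2 hs.le) (hTu i).le, ?_⟩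
      simp only [Pi.smul_apply, smul_eq_mul]
      rw [← Finset.mul_sum]
      exact inv_mul_cancel₀ hs.ne'
    have := hmax (show (t', s⁻¹ • u') ∈ K from
      ⟨⟨⟨ht.1.trans ht'.le, hbound _ _ hmem hle'⟩, hmem⟩, hle'⟩)
    exact absurd this (not_le.2 ht')
  refine ⟨u, t, fun i => lt_of_le_of_ne (hu.1 i) fun h => ?_, heig⟩
  have := hTu i
  rw [heig] at this
  simp [← h] at this

/-- A matrix with nonnegative entries has a nonzero eigenvector with nonnegative entries. -/
theorem Matrix.exists_nonneg_eigenvector [Nonempty ι] (T : Matrix ι ι ℝ) (hT : ∀ i j, 0 ≤ T i j) :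
    ∃ (u : ι → ℝ) (μ : ℝ), (∀ i, 0 ≤ u i) ∧ (∃ i, 0 < u i) ∧ T.mulVec u = μ • u := by
  classical
  -- Adding `e` to all entries of `T` adds the constant `e` to `T u`, because `u` has coordinate sum
  -- 1. The eigenvalue is eliminated by the same normalization: it is the coordinate sum of the
  -- image. The condition is thus closed in `(e, u)`, and the case `e = 0` is reached as a limit of
  -- `e > 0`.
  set K : Set (ℝ × (ι → ℝ)) := (Set.Icc 0 1 ×ˢ stdSimplex ℝ ι) ∩
    {p | ∀ i, (T.mulVec p.2) i + p.1 = (∑ j, ((T.mulVec p.2) j + p.1)) * p.2 i} with hK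
  have hcont : ∀ i, Continuous fun p : ℝ × (ι → ℝ) => (T.mulVec p.2) i := fun i =>
    (continuous_apply i).comp (Continuous.matrix_mulVec continuous_const continuous_snd)
  have hKc : IsCompact K := by
    refine (isCompact_Icc.prod (isCompact_stdSimplex ℝ ι)).inter_right ?_
    simp only [Set.ofPred_forall]
    refine isClosed_iInter fun i => isClosed_eq ?_ ?_
    · exact (hcont i).add continuous_fst
    · exact (continuous_finsetSum _ fun j _ => (hcont j).add continuous_fst).mul (by fun_prop)
  have hsub : Set.Ioc (0 : ℝ) 1 ⊆ Prod.fst '' K := by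
    rintro e ⟨he, he1⟩
    obtain ⟨u, μ, hu, h⟩ := Matrix.exists_pos_eigenvector (T + Matrix.of fun _ _ => e)
      (fun i j => by simpa using add_pos_of_nonneg_of_pos (hT i j) he)
    have hs : 0 < ∑ i, u i := Finset.sum_pos (fun i _ => hu i) Finset.univ_nonempty
    have hsum : ∑ i, ((∑ i, u i)⁻¹ • u) i = 1 := by
      simp only [Pi.smul_apply, smul_eq_mul]
      rw [← Finset.mul_sum, inv_mul_cancel₀ hs.ne']
    have key : ∀ i, (T.mulVec ((∑ i, u i)⁻¹ • u)) i + e = μ * ((∑ i, u i)⁻¹ • u) i := fun i => by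
      have := congrFun h i
      rw [Matrix.add_mulVec] at this
      simp only [Pi.add_apply, Matrix.mulVec, dotProduct, Matrix.of_apply, ← Finset.mul_sum,
        Pi.smul_apply, smul_eq_mul] at this
      rw [Matrix.mulVec_smul]
      simp only [Pi.smul_apply, smul_eq_mul, Matrix.mulVec, dotProduct]
      have h2 : e = (∑ i, u i)⁻¹ * (e * ∑ i, u i) := by field_simp
      conv_lhs => rw [h2]
      rw [← mul_add, this]; ring
    refine ⟨(e, (∑ i, u i)⁻¹ • u), ⟨⟨⟨he.le, he1⟩, fun i => ?_, hsum⟩, fun i => ?_⟩, rfl⟩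
    · exact mul_nonneg (inv_nonneg.2 hs.le) (hu i).le
    · simp only [key, ← Finset.mul_sum, hsum, mul_one]
  have h0 : (0 : ℝ) ∈ Prod.fst '' K := by
    have hcl : IsClosed (Prod.fst '' K) := (hKc.image continuous_fst).isClosed
    refine (hcl.closure_subset_iff.2 hsub) ?_
    rw [closure_Ioc (by norm_num)]
    simp
  obtain ⟨⟨_, u⟩, ⟨⟨-, hu⟩, h⟩, rfl⟩ := h0
  refine ⟨u, ∑ j, (T.mulVec u) j, hu.1, ?_, ?_⟩
  · by_contra! hcon
    have : ∑ i, u i ≤ 0 := Finset.sum_nonpos fun i _ => hcon i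
    have h1 : ∑ i, u i = 1 := hu.2
    linarith
  · ext i
    simpa using h i

end Perron

/-! ### Finite dimensional algebras without nontrivial idempotents -/

section LocalAlgebra

variable {S : Type*} [Ring S]

/-- Fitting's lemma inside the commutative Artinian algebra `k[y]`: powers of `y` generate a
stabilizing chain of ideals, whose limit is generated by an idempotent. -/
theorem isNilpotent_or_isUnit_of_idempotents_trivial (k : Type*) [Field k] [Algebra k S]
    [Module.Finite k S] (hS : ∀ e : S, e * e = e → e = 0 ∨ e = 1) (y : S) : IsNilpotent y ∨ IsUnit y := by
  let A := Algebra.adjoin k {y}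
  have : IsMulCommutative A := Algebra.isMulCommutative_adjoin k (by simp)
  have : IsArtinian A A := isArtinian_of_tower k inferInstance
  let y' : A := ⟨y, Algebra.self_mem_adjoin_singleton k y⟩
  obtain ⟨n, w, hw⟩ := IsArtinian.exists_pow_succ_smul_dvd (M := A) y' 1
  simp only [smul_eq_mul, mul_one] at hw
  -- Stabilization gives `y' ^ (n + 1) * w = y' ^ n`, so `y' ^ n` absorbs all powers of `y' * w`.
  -- The exponent `n` makes `(y' * w) ^ n` a multiple of `y' ^ n`, hence idempotent.
  have h2 : ∀ m, y' ^ n * (y' * w) ^ m = y' ^ n := fun m => by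
    induction m with
    | zero => simp
    | succ m ih => rw [pow_succ, ← mul_assoc, ih, ← mul_assoc, ← pow_succ, hw]
  set e' := (y' * w) ^ n
  have he' : e' * e' = e' := by
    have : e' = y' ^ n * w ^ n := mul_pow _ _ _
    calc e' * e' = (y' ^ n * e') * w ^ n := by rw [this]; ring
      _ = e' := by rw [h2, this]
  rcases hS e' (congrArg Subtype.val he') with h | h
  · left
    refine ⟨n, ?_⟩
    have h0 : e' = 0 := Subtype.ext h
    have := h2 n
    change y' ^ n * e' = _ at this
    rw [h0, mul_zero] at this
    exact (congrArg Subtype.val this).symm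
  · rcases Nat.eq_zero_or_pos n with rfl | hn
    · rcases subsingleton_or_nontrivial S with hs | hs
      · exact Or.inl ⟨0, Subsingleton.elim _ _⟩
      · right
        have h1 : y' * w = 1 := by simpa using hw
        have h3 : w * y' = 1 := by rw [mul_comm, h1]
        exact ⟨⟨y, w, congrArg Subtype.val h1, congrArg Subtype.val h3⟩, rfl⟩
    · right
      have h0 : e' = 1 := Subtype.ext h
      obtain ⟨m, rfl⟩ := Nat.exists_eq_add_of_lt hn
      have h1 : y' * (w * (y' * w) ^ (0 + m)) = 1 := by
        rw [← h0]; change _ = (y' * w) ^ (0 + m + 1); rw [pow_succ]; ring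
      have h3 : (w * (y' * w) ^ (0 + m)) * y' = 1 := by rw [mul_comm, h1]
      exact ⟨⟨y, _, congrArg Subtype.val h1, congrArg Subtype.val h3⟩, rfl⟩

/-- A unit `z * y` would give `y` a left inverse, which is impossible for nilpotent `y` unless `1 =
0`. So every `z * y` is nilpotent and `1 + z * y` is invertible. -/
theorem mem_jacobson_of_isNilpotent_of_idempotents_trivial (k : Type*) [Field k] [Algebra k S]
    [Module.Finite k S] (hS : ∀ e : S, e * e = e → e = 0 ∨ e = 1) {y : S} (hy : IsNilpotent y) :
    y ∈ Ring.jacobson S := by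
  rw [← Ideal.jacobson_bot, Ideal.mem_jacobson_iff]
  intro z
  have hz : IsNilpotent (z * y) := by
    rcases isNilpotent_or_isUnit_of_idempotents_trivial k hS (z * y) with h | ⟨c, h⟩
    · exact h
    · obtain ⟨n, hn⟩ := hy
      have key : ∀ m, y ^ m = 0 → (1 : S) = 0 := fun m => by
        induction m with
        | zero => intro h; simpa using h
        | succ m ih =>
          intro hm
          apply ih
          have h1 : (↑c⁻¹ * z) * y = 1 := by rw [mul_assoc, ← h, Units.inv_mul]
          calc y ^ m = ((↑c⁻¹ * z) * y) * y ^ m := by rw [h1, one_mul]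
            _ = (↑c⁻¹ * z) * y ^ (m + 1) := by rw [mul_assoc, ← pow_succ']
            _ = 0 := by rw [hm, mul_zero]
      have h1 := key n hn
      exact ⟨1, by rw [pow_one, ← mul_one (z * y), h1, mul_zero]⟩
  obtain ⟨c, hc⟩ := hz.isUnit_one_add
  refine ⟨↑c⁻¹, ?_⟩
  have : ↑c⁻¹ * (1 + z * y) = 1 := by rw [← hc, Units.inv_mul]
  rw [Submodule.mem_bot, mul_assoc, sub_eq_zero, ← this, mul_add, mul_one, add_comm]

/-- Subtracting an element `a` of the spectrum leaves a non-unit, hence a nilpotent element. For `S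
= End P` this says that the residue field is `k`, so that dimensions over `k` count copies of `P`.
-/
theorem exists_sub_smul_one_mem_jacobson {k : Type*} [Field k] [IsAlgClosed k] [Algebra k S]
    [Module.Finite k S] [Nontrivial S]
    (hS : ∀ e : S, e * e = e → e = 0 ∨ e = 1) (x : S) :
    ∃ a : k, x - a • 1 ∈ Ring.jacobson S := by
  obtain ⟨a, ha⟩ := spectrum.nonempty_of_isAlgClosed_of_finiteDimensional k x
  refine ⟨a, mem_jacobson_of_isNilpotent_of_idempotents_trivial k hS ?_⟩
  rcases isNilpotent_or_isUnit_of_idempotents_trivial k hS (x - a • 1) with h | h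
  · exact h
  · exfalso
    rw [spectrum.mem_iff, Algebra.algebraMap_eq_smul_one] at ha
    exact ha (by rw [← neg_sub]; exact h.neg)

end LocalAlgebra

/-! ### Direct summands -/

section Summands

variable {C : Type*} [Category* C] [Preadditive C]

/-- The complement is the image of the idempotent `𝟙 X - q ≫ i`. -/
theorem exists_complement_of_retract [IsIdempotentComplete C] {P X : C} (i : P ⟶ X) (q : X ⟶ P)
    (h : i ≫ q = 𝟙 P) : ∃ (Z : C) (i' : Z ⟶ X) (q' : X ⟶ Z),
      i ≫ q' = 0 ∧ i' ≫ q = 0 ∧ i' ≫ q' = 𝟙 Z ∧ q ≫ i + q' ≫ i' = 𝟙 X := by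
  have h3 : q ≫ i ≫ q ≫ i = q ≫ i := by rw [← Category.assoc i, h, Category.id_comp]
  obtain ⟨Z, i', e', h1, h2⟩ := IsIdempotentComplete.idempotents_split X (𝟙 X - q ≫ i) (by
    simp [h3])
  have h4 : i ≫ e' = 0 := by
    have : (i ≫ e') ≫ i' ≫ e' = 0 := by
      rw [Category.assoc, ← Category.assoc e', h2, Preadditive.sub_comp, Preadditive.comp_sub]
      simp [← Category.assoc i, h]
    rwa [h1, Category.comp_id] at this
  have h5 : i' ≫ q = 0 := by
    have : (i' ≫ e') ≫ i' ≫ q = 0 := by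
      rw [Category.assoc, ← Category.assoc e', h2, Preadditive.sub_comp, Preadditive.comp_sub]
      simp [h]
    rwa [h1, Category.id_comp] at this
  exact ⟨Z, i', e', h4, h5, h1, by simp [h2]⟩

theorem isSummand_of_retract [IsIdempotentComplete C] {P X : C} (i : P ⟶ X) (q : X ⟶ P)
    (h : i ≫ q = 𝟙 P) : IsSummand P X := by
  obtain ⟨Z, i', q', h1, h2, h3, h4⟩ := exists_complement_of_retract i q h
  exact ⟨Z, ⟨X, q, q', i, i', h, h1, h2, h3⟩, ⟨isBinaryBilimitOfTotal _ h4⟩, ⟨Iso.refl _⟩⟩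

theorem IsSummand.exists_retract {P X : C} (h : IsSummand P X) :
    ∃ (i : P ⟶ X) (q : X ⟶ P), i ≫ q = 𝟙 P := by
  obtain ⟨Z, b, -, ⟨e⟩⟩ := h
  exact ⟨b.inl ≫ e.hom, e.inv ≫ b.fst, by simp⟩

theorem IsIndecomposable.idempotent_trivial [IsIdempotentComplete C] {P : C}
    (hP : IsIndecomposable P) (e : End P) (he : e * e = e) : e = 0 ∨ e = 1 := by
  obtain ⟨Y, i, q, h1, h2⟩ := IsIdempotentComplete.idempotents_split P e he
  obtain ⟨Z, i', q', h3, h4, h5, h6⟩ := exists_complement_of_retract i q h1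
  rcases hP.2 Y Z ⟨P, q, q', i, i', h1, h3, h4, h5⟩ ⟨isBinaryBilimitOfTotal _ h6⟩ ⟨Iso.refl _⟩
    with h | h
  · left
    rw [← h2, h.eq_of_tgt q 0, zero_comp]
  · right
    change e = 𝟙 P
    rw [← h2, ← h6, h.eq_of_tgt q' 0, zero_comp, add_zero]

theorem IsIndecomposable.of_iso {P Q : C} (hP : IsIndecomposable P) (e : P ≅ Q) :
    IsIndecomposable Q :=
  ⟨fun h => hP.1 (h.of_iso e), fun Y Z b hb ⟨φ⟩ => hP.2 Y Z b hb ⟨φ ≪≫ e.symm⟩⟩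

theorem IsIndecomposable.isIso_of_retract [IsIdempotentComplete C] {P X : C}
    (hX : IsIndecomposable X) (hP : ¬ IsZero P) (i : P ⟶ X) (q : X ⟶ P) (h : i ≫ q = 𝟙 P) :
    q ≫ i = 𝟙 X := by
  rcases hX.idempotent_trivial (q ≫ i) (by
    change (q ≫ i) ≫ q ≫ i = q ≫ i
    simp [reassoc_of% h]) with h0 | h0
  · exfalso
    apply hP
    rw [IsZero.iff_id_eq_zero, ← h]
    calc i ≫ q = i ≫ (q ≫ i) ≫ q := by simp [h]
      _ = 0 := by rw [show q ≫ i = 0 from h0]; simp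
  · exact h0

theorem IsIndecomposable.nontrivial_end {P : C} (hP : IsIndecomposable P) :
    Nontrivial (End P) :=
  ⟨0, 1, fun h => hP.1 ((IsZero.iff_id_eq_zero P).2 h.symm)⟩

theorem IsIndecomposable.isUnit_of_not_mem_jacobson (k : Type*) [Field k] [Linear k C]
    [∀ X Y : C, Module.Finite k (X ⟶ Y)] [IsIdempotentComplete C] {P : C}
    (hP : IsIndecomposable P) {x : End P}
    (hx : x ∉ Ring.jacobson (End P)) : IsUnit x := by
  have : Module.Finite k (End P) := inferInstanceAs (Module.Finite k (P ⟶ P))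
  rcases isNilpotent_or_isUnit_of_idempotents_trivial k hP.idempotent_trivial x with h | h
  · exact absurd (mem_jacobson_of_isNilpotent_of_idempotents_trivial k hP.idempotent_trivial h) hx
  · exact h

end Summands

/-! ### Multiplicities of indecomposable objects -/

section Rank

variable {C : Type*} [Category* C] [Preadditive C] (k : Type*) [Field k] [Linear k C]

/-- The radical morphisms `P ⟶ Y`. -/
def radicalHom (P Y : C) : Submodule k (P ⟶ Y) where
  carrier := {f | ∀ g : Y ⟶ P, (show End P from f ≫ g) ∈ Ring.jacobson (End P)}
  zero_mem' g := by
    change (0 ≫ g : P ⟶ P) ∈ _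
    rw [zero_comp]; exact Submodule.zero_mem _
  add_mem' {f f'} hf hf' g := by
    change ((f + f') ≫ g : P ⟶ P) ∈ _
    rw [Preadditive.add_comp]; exact Submodule.add_mem _ (hf g) (hf' g)
  smul_mem' a f hf g := by
    change ((a • f) ≫ g : P ⟶ P) ∈ _
    rw [Linear.smul_comp, ← Linear.comp_smul]; exact hf _

variable {k}

theorem comp_mem_radicalHom {P Y Z : C} {f : P ⟶ Y} (hf : f ∈ radicalHom k P Y) (g : Y ⟶ Z) :
    f ≫ g ∈ radicalHom k P Z := fun h => by
  change ((f ≫ g) ≫ h : P ⟶ P) ∈ _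
  rw [Category.assoc]; exact hf _

theorem IsIndecomposable.not_mem_radicalHom {P Y : C} (hP : IsIndecomposable P) {f : P ⟶ Y}
    {g : Y ⟶ P} (h : f ≫ g = 𝟙 P) : f ∉ radicalHom k P Y := by
  intro hf
  have h1 := hf g
  rw [h] at h1
  have := hP.nontrivial_end
  have h2 : Ring.jacobson (End P) = ⊤ := (Ideal.eq_top_iff_one _).2 h1
  exact absurd h2 (Ring.jacobson_lt_top (End P)).ne

variable (k)

/-- Composition with `f : X ⟶ Y` as a map from `Hom(P, X)` to `Hom(P, Y)` modulo the radical. -/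
def topMap (P : C) {X Y : C} (f : X ⟶ Y) : (P ⟶ X) →ₗ[k] (P ⟶ Y) ⧸ radicalHom k P Y :=
  (radicalHom k P Y).mkQ ∘ₗ Linear.rightComp k P f

/-- The map induced by `g : Y ⟶ Z` modulo the radical. -/
def topPush (P : C) {Y Z : C} (g : Y ⟶ Z) :
    ((P ⟶ Y) ⧸ radicalHom k P Y) →ₗ[k] (P ⟶ Z) ⧸ radicalHom k P Z :=
  Submodule.mapQ _ _ (Linear.rightComp k P g) fun _ hf => comp_mem_radicalHom hf g

/-- The rank at `P` of a morphism; for indecomposable `P` this is the largest number of copies of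
`P` that split off from it. -/
noncomputable def rankAt (P : C) {X Y : C} (f : X ⟶ Y) : ℕ :=
  Module.finrank k (LinearMap.range (topMap k P f))

theorem topMap_apply (P : C) {X Y : C} (f : X ⟶ Y) (x : P ⟶ X) :
    topMap k P f x = (radicalHom k P Y).mkQ (x ≫ f) := rfl

theorem topPush_topMap (P : C) {X Y Z : C} (f : X ⟶ Y) (g : Y ⟶ Z) (x : P ⟶ X) :
    topPush k P g (topMap k P f x) = topMap k P (f ≫ g) x := by
  refine (Submodule.mapQ_apply _ _ _ _).trans ?_
  simp only [topMap_apply, Submodule.mkQ_apply, Linear.rightComp_apply, Category.assoc]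

variable [∀ X Y : C, Module.Finite k (X ⟶ Y)]

theorem rankAt_comp_le_left (P : C) {X Y Z : C} (f : X ⟶ Y) (g : Y ⟶ Z) :
    rankAt k P (f ≫ g) ≤ rankAt k P f := by
  have : LinearMap.range (topMap k P (f ≫ g)) =
      (LinearMap.range (topMap k P f)).map (topPush k P g) := by
    rw [← LinearMap.range_comp]
    congr 1
    ext x
    exact (topPush_topMap k P f g x).symm
  rw [rankAt, this]
  exact Submodule.finrank_map_le _ _

theorem rankAt_comp_le_right (P : C) {X Y Z : C} (f : X ⟶ Y) (g : Y ⟶ Z) :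
    rankAt k P (f ≫ g) ≤ rankAt k P g := by
  refine Submodule.finrank_mono ?_
  rintro _ ⟨x, rfl⟩
  exact ⟨x ≫ f, by simp [topMap]⟩

theorem rankAt_eq_of_retracts (P : C) {X Y X' Y' : C} {f : X ⟶ Y} {g : X' ⟶ Y'}
    {a : X ⟶ X'} {b : Y' ⟶ Y} {a' : X' ⟶ X} {b' : Y ⟶ Y'} (h : f = a ≫ g ≫ b)
    (h' : g = a' ≫ f ≫ b') : rankAt k P f = rankAt k P g := by
  apply le_antisymm
  · rw [h]
    exact (rankAt_comp_le_right ..).trans (rankAt_comp_le_left ..)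
  · rw [h']
    exact (rankAt_comp_le_right ..).trans (rankAt_comp_le_left ..)

/-- Precomposition with `a` and `𝟙 X - a` isolates `f` and `g`, so the range for `f + g` contains
both ranges. Postcomposition with `b` fixes the range for `f` and kills the range for `g`, so the
two meet trivially. -/
theorem rankAt_add (P : C) {X Y : C} (f g : X ⟶ Y) (a : X ⟶ X) (b : Y ⟶ Y) (hf : a ≫ f = f)
    (hg : a ≫ g = 0) (hf' : f ≫ b = f) (hg' : g ≫ b = 0) :
    rankAt k P (f + g) = rankAt k P f + rankAt k P g := by
  have hsup : LinearMap.range (topMap k P (f + g)) =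
      LinearMap.range (topMap k P f) ⊔ LinearMap.range (topMap k P g) := by
    apply le_antisymm
    · rintro _ ⟨x, rfl⟩
      have : topMap k P (f + g) x = topMap k P f x + topMap k P g x := by simp [topMap]
      rw [this]
      exact Submodule.add_mem_sup ⟨x, rfl⟩ ⟨x, rfl⟩
    · refine sup_le ?_ ?_
      · rintro _ ⟨x, rfl⟩
        exact ⟨x ≫ a, by simp [topMap, hf, hg]⟩
      · rintro _ ⟨x, rfl⟩
        exact ⟨x ≫ (𝟙 X - a), by simp [topMap, hf, hg]⟩
  have hinf : LinearMap.range (topMap k P f) ⊓ LinearMap.range (topMap k P g) = ⊥ := by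
    rw [eq_bot_iff]
    rintro y ⟨⟨x, rfl⟩, ⟨x', hx'⟩⟩
    have h1 := congrArg (topPush k P b) hx'
    rw [topPush_topMap, topPush_topMap, hf', hg'] at h1
    rw [Submodule.mem_bot, ← h1]
    simp [topMap]
  have := Submodule.finrank_sup_add_finrank_inf_eq (LinearMap.range (topMap k P f))
    (LinearMap.range (topMap k P g))
  rw [hinf, finrank_bot, add_zero] at this
  rw [rankAt, hsup, this]; rfl

theorem rankAt_eq_zero_iff (P : C) {X Y : C} (f : X ⟶ Y) :
    rankAt k P f = 0 ↔ ∀ x : P ⟶ X, x ≫ f ∈ radicalHom k P Y := by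
  rw [rankAt, Submodule.finrank_eq_zero, LinearMap.range_eq_bot]
  constructor
  · intro h x
    have := LinearMap.congr_fun h x
    rwa [topMap_apply, LinearMap.zero_apply, Submodule.mkQ_apply,
      Submodule.Quotient.mk_eq_zero] at this
  · intro h
    ext x
    rw [topMap_apply, LinearMap.zero_apply, Submodule.mkQ_apply, Submodule.Quotient.mk_eq_zero]
    exact h x

theorem rankAt_eq_zero_of_isZero_left (P : C) {X Y : C} (f : X ⟶ Y) (h : IsZero X) :
    rankAt k P f = 0 := by
  rw [rankAt_eq_zero_iff]
  intro x
  rw [h.eq_of_tgt x 0, zero_comp]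
  exact Submodule.zero_mem _

variable {k} in
theorem IsIndecomposable.rankAt_ne_zero {P X Y : C} (hP : IsIndecomposable P) {f : X ⟶ Y}
    {a : P ⟶ X} {b : Y ⟶ P} (h : a ≫ f ≫ b = 𝟙 P) : rankAt k P f ≠ 0 := by
  rw [Ne, rankAt_eq_zero_iff]
  intro h'
  exact hP.not_mem_radicalHom (by rw [Category.assoc, h]) (h' a)

variable [IsIdempotentComplete C]

variable {k}

theorem IsIndecomposable.exists_retract_of_not_mem_radicalHom {P Y : C} (hP : IsIndecomposable P)
    {f : P ⟶ Y} (hf : f ∉ radicalHom k P Y) : ∃ g : Y ⟶ P, f ≫ g = 𝟙 P := by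
  have : ∃ g : Y ⟶ P, (show End P from f ≫ g) ∉ Ring.jacobson (End P) := by
    by_contra! h
    exact hf h
  obtain ⟨g, hg⟩ := this
  obtain ⟨c, hc⟩ := hP.isUnit_of_not_mem_jacobson k hg
  refine ⟨g ≫ (↑c⁻¹ : End P), ?_⟩
  have : (↑c⁻¹ : End P) * c = 1 := Units.inv_mul c
  rw [hc] at this
  rw [← Category.assoc]
  exact this

theorem IsIndecomposable.exists_retract_of_rankAt_ne_zero {P X Y : C} (hP : IsIndecomposable P)
    {f : X ⟶ Y} (hf : rankAt k P f ≠ 0) : ∃ (a : P ⟶ X) (b : Y ⟶ P), a ≫ f ≫ b = 𝟙 P := by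
  rw [Ne, rankAt_eq_zero_iff] at hf
  push Not at hf
  obtain ⟨x, hx⟩ := hf
  obtain ⟨g, hg⟩ := hP.exists_retract_of_not_mem_radicalHom hx
  exact ⟨x, g, by rw [← hg, Category.assoc]⟩

/-- Every endomorphism of `P` is a scalar modulo the radical, so the class of the identity spans;
this is where algebraic closedness makes the rank an honest multiplicity. -/
theorem IsIndecomposable.rankAt_id_self [IsAlgClosed k] {P : C} (hP : IsIndecomposable P) :
    rankAt k P (𝟙 P) = 1 := by
  have hfin : Module.Finite k (End P) := inferInstanceAs (Module.Finite k (P ⟶ P))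
  have := hP.nontrivial_end
  have hne := hP.rankAt_ne_zero (k := k) (f := 𝟙 P) (a := 𝟙 P) (b := 𝟙 P) (by simp)
  refine le_antisymm ?_ (Nat.one_le_iff_ne_zero.2 hne)
  have hle : LinearMap.range (topMap k P (𝟙 P)) ≤
      Submodule.span k {(radicalHom k P P).mkQ (𝟙 P)} := by
    rintro _ ⟨x, rfl⟩
    obtain ⟨a, ha⟩ := exists_sub_smul_one_mem_jacobson (k := k) hP.idempotent_trivial
      (show End P from x)
    rw [Submodule.mem_span_singleton]
    refine ⟨a, ?_⟩
    rw [topMap_apply, Category.comp_id, ← map_smul, eq_comm, ← sub_eq_zero, ← map_sub,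
      Submodule.mkQ_apply, Submodule.Quotient.mk_eq_zero]
    intro g
    exact Ideal.mul_mem_left _ (show End P from g) ha
  exact (Submodule.finrank_mono hle).trans ((finrank_span_le_card _).trans (by rw [Set.toFinset_card, Fintype.card_unique]))

theorem IsIndecomposable.rankAt_id_eq_zero {P Q : C} (hP : IsIndecomposable P)
    (hQ : IsIndecomposable Q) (h : ¬ Nonempty (P ≅ Q)) : rankAt k P (𝟙 Q) = 0 := by
  by_contra h'
  obtain ⟨a, b, hab⟩ := hP.exists_retract_of_rankAt_ne_zero h'
  rw [Category.id_comp] at hab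
  exact h ⟨⟨a, b, hab, hQ.isIso_of_retract hP.1 a b hab⟩⟩

end Rank

/-! ### Additive functions on objects -/

section AdditiveFunctions

variable {C : Type*} [Category* C] [Preadditive C]

/-- A real valued function on objects which is invariant under isomorphisms and additive on direct
sums. -/
structure IsAdditiveFunction (φ : C → ℝ) : Prop where
  iso : ∀ {X Y : C}, (X ≅ Y) → φ X = φ Y
  bicone : ∀ {Y Z : C} (b : BinaryBicone Y Z), b.IsBilimit → φ b.pt = φ Y + φ Z

theorem IsAdditiveFunction.of_isZero {φ : C → ℝ} (hφ : IsAdditiveFunction φ) {X : C}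
    (hX : IsZero X) : φ X = 0 := by
  have := hφ.bicone ⟨X, 𝟙 X, 𝟙 X, 𝟙 X, 𝟙 X, by simp, hX.eq_of_src _ _, hX.eq_of_src _ _, by simp⟩
    (isBinaryBilimitOfTotal _ (hX.eq_of_src _ _))
  simpa using this

theorem IsAdditiveFunction.sum {ι : Type*} [Fintype ι] {φ : ι → C → ℝ}
    (hφ : ∀ i, IsAdditiveFunction (φ i)) (a : ι → ℝ) :
    IsAdditiveFunction fun X => ∑ i, a i * φ i X where
  iso e := Finset.sum_congr rfl fun i _ => by rw [(hφ i).iso e]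
  bicone b hb := by
    rw [← Finset.sum_add_distrib]
    exact Finset.sum_congr rfl fun i _ => by rw [(hφ i).bicone b hb, mul_add]

/-- The rank of the components of a natural transformation between additive functors is an additive
function. -/
theorem isAdditiveFunction_rankAt {k : Type*} [Field k] {D : Type*} [Category* D] [Preadditive D]
    [Linear k D] [∀ X Y : D, Module.Finite k (X ⟶ Y)] {A B : C ⥤ D} [A.Additive] [B.Additive]
    (g : A ⟶ B) (P : D) : IsAdditiveFunction fun X : C => (rankAt k P (g.app X) : ℝ) where
  iso {X Y} e := by
    congr 1
    exact rankAt_eq_of_retracts k P (a := A.map e.hom) (b := B.map e.inv) (a' := A.map e.inv)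
      (b' := B.map e.hom) (by simp [← Functor.map_comp])
      (by simp [← Functor.map_comp])
  bicone {Y Z} b hb := by
    rw [← Nat.cast_add]
    congr 1
    -- Naturality makes the component at a biproduct block diagonal; the idempotents of the
    -- biproduct separate the two blocks as `rankAt_add` requires, and each block factors through,
    -- and recovers, the component at its summand.
    have h1 : g.app b.pt = A.map (b.fst ≫ b.inl) ≫ g.app b.pt +
        A.map (b.snd ≫ b.inr) ≫ g.app b.pt := by
      rw [← Preadditive.add_comp, ← A.map_add, IsBilimit.binary_total hb, A.map_id,
        Category.id_comp]
    rw [h1, rankAt_add k P _ _ (A.map (b.fst ≫ b.inl)) (B.map (b.fst ≫ b.inl))]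
    · congr 1
      · refine rankAt_eq_of_retracts k P (a := A.map b.fst) (b := B.map b.inl) (a' := A.map b.inl)
          (b' := B.map b.fst) ?_ ?_
        · rw [← g.naturality, ← A.map_comp_assoc]
        · rw [Category.assoc, ← A.map_comp_assoc, ← g.naturality, ← A.map_comp_assoc]
          simp
      · refine rankAt_eq_of_retracts k P (a := A.map b.snd) (b := B.map b.inr) (a' := A.map b.inr)
          (b' := B.map b.snd) ?_ ?_
        · rw [← g.naturality, ← A.map_comp_assoc]
        · rw [Category.assoc, ← A.map_comp_assoc, ← g.naturality, ← A.map_comp_assoc]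
          simp
    · rw [← A.map_comp_assoc]; simp
    · rw [← A.map_comp_assoc]; simp
    · rw [Category.assoc, ← g.naturality, ← A.map_comp_assoc]; simp
    · rw [Category.assoc, ← g.naturality, ← A.map_comp_assoc]; simp

theorem isAdditiveFunction_rankAt_id (k : Type*) [Field k] [Linear k C]
    [∀ X Y : C, Module.Finite k (X ⟶ Y)] (P : C) :
    IsAdditiveFunction fun X : C => (rankAt k P (𝟙 X) : ℝ) :=
  isAdditiveFunction_rankAt (k := k) (𝟙 (𝟭 C)) P

/-- The isomorphism classes of indecomposable objects. -/
def IndecClass (C : Type*) [Category* C] [Preadditive C] : Type _ :=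
  {c : Quotient (isIsomorphicSetoid C) // IsIndecomposable c.out}

/-- A representative of a class of indecomposable objects. -/
noncomputable def IndecClass.obj (c : IndecClass C) : C := c.1.out

theorem IndecClass.indecomposable (c : IndecClass C) : IsIndecomposable c.obj := c.2

theorem IndecClass.eq_of_iso {c d : IndecClass C} (h : Nonempty (c.obj ≅ d.obj)) : c = d :=
  Subtype.ext (by
    rw [← Quotient.out_eq c.1, ← Quotient.out_eq d.1]
    exact Quotient.sound h)

theorem IsIndecomposable.exists_indecClass {P : C} (hP : IsIndecomposable P) :
    ∃ c : IndecClass C, Nonempty (P ≅ c.obj) := by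
  have h : Nonempty ((Quotient.mk (isIsomorphicSetoid C) P).out ≅ P) :=
    Quotient.exact (Quotient.out_eq (Quotient.mk (isIsomorphicSetoid C) P))
  obtain ⟨e⟩ := h
  exact ⟨⟨Quotient.mk (isIsomorphicSetoid C) P, hP.of_iso e.symm⟩, ⟨e.symm⟩⟩

theorem IndecClass.rankAt_id {k : Type*} [Field k] [IsAlgClosed k] [Linear k C]
    [∀ X Y : C, Module.Finite k (X ⟶ Y)] [IsIdempotentComplete C] [DecidableEq (IndecClass C)]
    (c d : IndecClass C) : rankAt k c.obj (𝟙 d.obj) = if c = d then 1 else 0 := by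
  split_ifs with h
  · subst h
    exact c.indecomposable.rankAt_id_self
  · exact c.indecomposable.rankAt_id_eq_zero d.indecomposable fun h' => h (IndecClass.eq_of_iso h')

theorem finrank_end_pos (k : Type*) [Field k] [Linear k C] [∀ X Y : C, Module.Finite k (X ⟶ Y)]
    {X : C} (hX : ¬ IsZero X) : 0 < Module.finrank k (X ⟶ X) := by
  have : Nontrivial (X ⟶ X) := ⟨𝟙 X, 0, fun h => hX ((IsZero.iff_id_eq_zero X).2 h)⟩
  exact Module.finrank_pos

/-- Block diagonal endomorphisms embed. This makes the dimension of the endomorphism algebra a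
measure that drops strictly under proper decomposition. -/
theorem finrank_end_add_le (k : Type*) [Field k] [Linear k C] [∀ X Y : C, Module.Finite k (X ⟶ Y)]
    {X Y Z : C} (b : BinaryBicone Y Z) (e : b.pt ≅ X) :
    Module.finrank k (Y ⟶ Y) + Module.finrank k (Z ⟶ Z) ≤ Module.finrank k (X ⟶ X) := by
  let F : (Y ⟶ Y) × (Z ⟶ Z) →ₗ[k] (X ⟶ X) :=
    { toFun := fun p => e.inv ≫ (b.fst ≫ p.1 ≫ b.inl + b.snd ≫ p.2 ≫ b.inr) ≫ e.hom
      map_add' := fun p q => by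
        simp only [Prod.fst_add, Prod.snd_add, Preadditive.add_comp, Preadditive.comp_add,
          Category.assoc]
        abel
      map_smul' := fun r p => by simp }
  have hF : Function.Injective F := by
    rw [← LinearMap.ker_eq_bot, LinearMap.ker_eq_bot']
    rintro ⟨f, g⟩ h
    have h' : e.inv ≫ (b.fst ≫ f ≫ b.inl + b.snd ≫ g ≫ b.inr) ≫ e.hom = 0 := h
    have h1 := congrArg (fun x => b.inl ≫ e.hom ≫ x ≫ e.inv ≫ b.fst) h'
    have h2 := congrArg (fun x => b.inr ≫ e.hom ≫ x ≫ e.inv ≫ b.snd) h'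
    simp at h1 h2
    rw [h1, h2]; rfl
  rw [← Module.finrank_prod]
  exact LinearMap.finrank_le_finrank_of_injective hF

/-- Every object of a Hom-finite category is a finite direct sum of indecomposable objects; here as
an induction principle. -/
theorem induction_indecomposable (k : Type*) [Field k] [Linear k C]
    [∀ X Y : C, Module.Finite k (X ⟶ Y)] {p : C → Prop} (zero : ∀ X, IsZero X → p X)
    (indec : ∀ X, IsIndecomposable X → p X) (iso : ∀ {X Y : C}, (X ≅ Y) → p X → p Y)
    (sum : ∀ (Y Z : C) (b : BinaryBicone Y Z), b.IsBilimit → p Y → p Z → p b.pt) (X : C) : p X := by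
  induction hn : Module.finrank k (X ⟶ X) using Nat.strong_induction_on generalizing X with
  | _ n ih =>
    by_cases hz : IsZero X
    · exact zero X hz
    by_cases hi : IsIndecomposable X
    · exact indec X hi
    have : ∃ (Y Z : C) (b : BinaryBicone Y Z), Nonempty b.IsBilimit ∧ Nonempty (b.pt ≅ X) ∧
        ¬ IsZero Y ∧ ¬ IsZero Z := by
      simp only [IsIndecomposable, hz, not_false_eq_true, true_and] at hi
      push Not at hi
      exact hi
    obtain ⟨Y, Z, b, ⟨hb⟩, ⟨e⟩, hY, hZ⟩ := this
    have hle := finrank_end_add_le k b e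
    rw [hn] at hle
    have := finrank_end_pos k hY
    have := finrank_end_pos k hZ
    exact iso e (sum Y Z b hb (ih _ (by omega) Y rfl) (ih _ (by omega) Z rfl))

/-- An additive function is determined by its values at indecomposable objects. -/
theorem IsAdditiveFunction.eq_sum (k : Type*) [Field k] [IsAlgClosed k] [Linear k C]
    [∀ X Y : C, Module.Finite k (X ⟶ Y)] [IsIdempotentComplete C] [Fintype (IndecClass C)]
    {φ : C → ℝ} (hφ : IsAdditiveFunction φ) (X : C) :
    φ X = ∑ c : IndecClass C, (rankAt k c.obj (𝟙 X) : ℝ) * φ c.obj := by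
  classical
  have hψ : IsAdditiveFunction fun X : C =>
      ∑ c : IndecClass C, φ c.obj * (rankAt k c.obj (𝟙 X) : ℝ) :=
    IsAdditiveFunction.sum (fun c : IndecClass C => isAdditiveFunction_rankAt_id k c.obj) _
  simp only [mul_comm _ (φ _)]
  refine induction_indecomposable k
    (p := fun X => φ X = ∑ c : IndecClass C, φ c.obj * (rankAt k c.obj (𝟙 X) : ℝ)) ?_ ?_ ?_ ?_ X
  · intro X hX
    rw [hφ.of_isZero hX, hψ.of_isZero hX]
  · intro X hX
    obtain ⟨d, ⟨e⟩⟩ := hX.exists_indecClass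
    rw [hφ.iso e, hψ.iso e]
    simp [IndecClass.rankAt_id]
  · intro X Y e h
    rw [← hφ.iso e, ← hψ.iso e, h]
  · intro Y Z b hb hY hZ
    rw [hφ.bicone b hb, hψ.bicone b hb, hY, hZ]

theorem exists_indecClass_rankAt_ne_zero (k : Type*) [Field k] [Linear k C]
    [∀ X Y : C, Module.Finite k (X ⟶ Y)] {X : C} (hX : ¬ IsZero X) :
    ∃ c : IndecClass C, rankAt k c.obj (𝟙 X) ≠ 0 := by
  revert hX
  refine induction_indecomposable k
    (p := fun X => ¬ IsZero X → ∃ c : IndecClass C, rankAt k c.obj (𝟙 X) ≠ 0) ?_ ?_ ?_ ?_ X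
  · exact fun X hX h => absurd hX h
  · intro X hX _
    obtain ⟨d, ⟨e⟩⟩ := hX.exists_indecClass
    exact ⟨d, d.indecomposable.rankAt_ne_zero (a := e.inv) (b := e.hom) (by simp)⟩
  · intro X Y e h hY
    obtain ⟨c, hc⟩ := h fun h' => hY (h'.of_iso e.symm)
    refine ⟨c, fun h0 => hc ?_⟩
    rw [← h0]
    exact rankAt_eq_of_retracts k _ (a := e.hom) (b := e.inv) (a' := e.inv) (b' := e.hom)
      (by simp) (by simp)
  · intro Y Z b hb hY hZ hpt
    have key : ∀ c : IndecClass C, rankAt k c.obj (𝟙 b.pt) =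
        rankAt k c.obj (𝟙 Y) + rankAt k c.obj (𝟙 Z) := fun c => by
      have := (isAdditiveFunction_rankAt (k := k) (𝟙 (𝟭 C)) c.obj).bicone b hb
      exact_mod_cast this
    by_cases h : IsZero Y
    · have h' : ¬ IsZero Z := fun h' => hpt (by
        rw [IsZero.iff_id_eq_zero, ← IsBilimit.binary_total hb, h.eq_of_src b.inl 0,
          h'.eq_of_src b.inr 0]
        simp)
      obtain ⟨c, hc⟩ := hZ h'
      exact ⟨c, by rw [key]; omega⟩
    · obtain ⟨c, hc⟩ := hY h
      exact ⟨c, by rw [key]; omega⟩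

/-- If every identity is a sum of morphisms that factor through one object, then there are only
finitely many indecomposable objects. -/
theorem finite_indecClass_of_generator (k : Type*) [Field k] [Linear k C]
    [∀ X Y : C, Module.Finite k (X ⟶ Y)] [IsIdempotentComplete C] (G : C)
    (hG : ∀ X : C, 𝟙 X ∈ AddSubgroup.closure {f : X ⟶ X | ∃ (a : X ⟶ G) (b : G ⟶ X), f = a ≫ b}) :
    Finite (IndecClass C) := by
  have hret : ∀ c : IndecClass C, ∃ (a : c.obj ⟶ G) (b : G ⟶ c.obj), a ≫ b = 𝟙 _ := by
    intro c
    by_contra! hcon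
    have hP := c.indecomposable
    -- If the indecomposable object were not a retract of `G`, every map through `G` would be
    -- radical. Radical maps are closed under sums, so the identity would be radical as well.
    have : 𝟙 c.obj ∈ (radicalHom k c.obj c.obj).toAddSubgroup := by
      refine (AddSubgroup.closure_le _).2 ?_ (hG c.obj)
      rintro _ ⟨a, b, rfl⟩
      by_contra h
      obtain ⟨g, hg⟩ := hP.exists_retract_of_not_mem_radicalHom (k := k) h
      exact hcon a (b ≫ g) (by rw [← hg, Category.assoc])
    exact hP.not_mem_radicalHom (k := k) (Category.id_comp (𝟙 c.obj)) this
  have hfin : ∀ X : C, {c : IndecClass C |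
      ∃ (a : c.obj ⟶ X) (b : X ⟶ c.obj), a ≫ b = 𝟙 _}.Finite := by
    intro X
    refine induction_indecomposable k (p := fun X => {c : IndecClass C |
      ∃ (a : c.obj ⟶ X) (b : X ⟶ c.obj), a ≫ b = 𝟙 _}.Finite) ?_ ?_ ?_ ?_ X
    · intro X hX
      refine Set.Finite.subset Set.finite_empty ?_
      rintro c ⟨a, b, h⟩
      refine absurd ((IsZero.iff_id_eq_zero _).2 ?_) c.indecomposable.1
      rw [← h, hX.eq_of_tgt a 0, zero_comp]
    · intro X hX
      obtain ⟨d, ⟨e⟩⟩ := hX.exists_indecClass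
      refine Set.Finite.subset (Set.finite_singleton d) ?_
      rintro c ⟨a, b, h⟩
      have := hX.isIso_of_retract c.indecomposable.1 a b h
      exact IndecClass.eq_of_iso ⟨(⟨a, b, h, this⟩ : c.obj ≅ X) ≪≫ e⟩
    · intro X Y e h
      refine h.subset ?_
      rintro c ⟨a, b, hab⟩
      exact ⟨a ≫ e.inv, e.hom ≫ b, by simpa using hab⟩
    · intro Y Z b hb hY hZ
      refine (hY.union hZ).subset ?_
      rintro c ⟨i, q, h⟩
      by_contra hcon
      simp only [Set.mem_union, Set.mem_ofPred_eq, not_or, not_exists] at hcon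
      have hP := c.indecomposable
      have : 𝟙 c.obj ∈ radicalHom k c.obj c.obj := by
        have h1 : 𝟙 c.obj = i ≫ b.fst ≫ b.inl ≫ q + i ≫ b.snd ≫ b.inr ≫ q := by
          rw [← h]
          calc i ≫ q = i ≫ (b.fst ≫ b.inl + b.snd ≫ b.inr) ≫ q := by
                rw [IsBilimit.binary_total hb, Category.id_comp]
            _ = _ := by simp
        rw [h1]
        refine Submodule.add_mem _ ?_ ?_
        · by_contra h2
          obtain ⟨g, hg⟩ := hP.exists_retract_of_not_mem_radicalHom h2
          exact hcon.1 (i ≫ b.fst) (b.inl ≫ q ≫ g) (by rw [← hg]; simp)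
        · by_contra h2
          obtain ⟨g, hg⟩ := hP.exists_retract_of_not_mem_radicalHom h2
          exact hcon.2 (i ≫ b.snd) (b.inr ≫ q ≫ g) (by rw [← hg]; simp)
      exact hP.not_mem_radicalHom (k := k) (Category.id_comp (𝟙 c.obj)) this
  exact Set.finite_univ_iff.1 ((hfin G).subset fun c _ => hret c)

end AdditiveFunctions

/-! ### Finitary categories -/

section FGProj

variable (B : Type v) [Ring B]

/-- The regular module as an object of `B`-proj. -/
abbrev FGProj.self : FGProj B := ⟨ModuleCat.of B B, ⟨Module.Finite.self B, inferInstance⟩⟩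

variable {B}

/-- Morphisms of `B`-proj from linear maps. -/
abbrev FGProj.homMk {X Y : FGProj B} (f : X.obj →ₗ[B] Y.obj) : X ⟶ Y := ⟨ModuleCat.ofHom f⟩

/-- The linear map underlying a morphism of `B`-proj. -/
abbrev FGProj.toLin {X Y : FGProj B} (f : X ⟶ Y) : X.obj →ₗ[B] Y.obj := f.hom.hom

theorem FGProj.hom_ext {X Y : FGProj B} {f g : X ⟶ Y} (h : FGProj.toLin f = FGProj.toLin g) :
    f = g := by
  ext x
  exact LinearMap.congr_fun h x

theorem FGProj.toLin_sum {X Y : FGProj B} {ι : Type*} (s : Finset ι) (f : ι → (X ⟶ Y)) :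
    FGProj.toLin (∑ i ∈ s, f i) = ∑ i ∈ s, FGProj.toLin (f i) :=
  map_sum (AddMonoidHom.mk' (fun f : X ⟶ Y => FGProj.toLin f) fun _ _ => rfl) f s

instance (X : FGProj B) : Module.Finite B X.obj := X.property.1

instance (X : FGProj B) : Module.Projective B X.obj := X.property.2

instance : IsIdempotentComplete (FGProj B) where
  idempotents_split X p hp := by
    let q := FGProj.toLin p
    have hq : ∀ x, q (q x) = q x := fun x => congrArg (fun f => FGProj.toLin f x) hp
    have hs : q.rangeRestrict ∘ₗ (LinearMap.range q).subtype = LinearMap.id := by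
      ext ⟨_, x, rfl⟩
      exact hq x
    have h2 : Module.Projective B (LinearMap.range q) := Module.Projective.of_split _ _ hs
    refine ⟨⟨ModuleCat.of B (LinearMap.range q), inferInstance, h2⟩,
      FGProj.homMk (LinearMap.range q).subtype, FGProj.homMk q.rangeRestrict, ?_, ?_⟩
    · ext x
      exact congrArg Subtype.val (LinearMap.congr_fun hs x)
    · rfl

instance : HasBinaryProducts (FGProj B) := by
  have : HasBinaryBiproducts (FGProj B) := ⟨fun X Y => by
    refine hasBinaryBiproduct_of_total (X := X) (Y := Y)
      ⟨⟨ModuleCat.of B (X.obj × Y.obj), inferInstance, inferInstance⟩,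
        FGProj.homMk (LinearMap.fst B X.obj Y.obj), FGProj.homMk (LinearMap.snd B X.obj Y.obj),
        FGProj.homMk (LinearMap.inl B X.obj Y.obj), FGProj.homMk (LinearMap.inr B X.obj Y.obj),
        ?_, ?_, ?_, ?_⟩ ?_
    · rfl
    · rfl
    · rfl
    · rfl
    · apply FGProj.hom_ext
      change LinearMap.inl B X.obj Y.obj ∘ₗ LinearMap.fst B X.obj Y.obj +
        LinearMap.inr B X.obj Y.obj ∘ₗ LinearMap.snd B X.obj Y.obj = LinearMap.id
      ext x <;> simp⟩
  infer_instance

instance : HasZeroObject (FGProj B) :=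
  ⟨⟨ModuleCat.of B PUnit, inferInstance, inferInstance⟩, by
    rw [IsZero.iff_id_eq_zero]
    rfl⟩

end FGProj

section Finitary

variable {k : Type u} [Field k] {C : Type u₂} [Category.{v₂} C] [Preadditive C] [Linear k C]

theorem IsFinitary.isIdempotentComplete (hC : IsFinitary k C) : IsIdempotentComplete C := by
  obtain ⟨B, _, _, -, -, e, -, -⟩ := hC
  exact (Idempotents.isIdempotentComplete_iff_of_equivalence e).2 inferInstance

theorem IsFinitary.hasBinaryBiproducts (hC : IsFinitary k C) : HasBinaryBiproducts C := by
  obtain ⟨B, _, _, -, -, e, -, -⟩ := hC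
  have : HasBinaryProducts C := Adjunction.hasLimitsOfShape_of_equivalence e.functor
  exact HasBinaryBiproducts.of_hasBinaryProducts

theorem IsFinitary.hasZeroObject (hC : IsFinitary k C) : HasZeroObject C := by
  obtain ⟨B, _, _, -, -, e, -, -⟩ := hC
  obtain ⟨Z, hZ⟩ := HasZeroObject.zero (C := FGProj B)
  exact ⟨e.inverse.obj Z, e.inverse.map_isZero hZ⟩

open ModuleCat.Algebra in
theorem FGProj.finite_hom {B : Type v} [Ring B] [Algebra k B] [Module.Finite k B] (X Y : FGProj B) :
    Module.Finite k (X ⟶ Y) := by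
  have h1 : Module.Finite k X.obj := Module.Finite.trans B _
  have h2 : Module.Finite k Y.obj := Module.Finite.trans B _
  let F : (X ⟶ Y) →ₗ[k] (X.obj →ₗ[k] Y.obj) :=
    { toFun := fun f => (FGProj.toLin f).restrictScalars k
      map_add' := fun f g => rfl
      map_smul' := fun r f => rfl }
  refine Module.Finite.of_injective F fun f g h => ?_
  ext x
  exact LinearMap.congr_fun h x

theorem IsFinitary.finite_hom (hC : IsFinitary k C) (X Y : C) : Module.Finite k (X ⟶ Y) := by
  obtain ⟨B, _, _, hB, -, e, _, _⟩ := hC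
  have := FGProj.finite_hom (k := k) (e.functor.obj X) (e.functor.obj Y)
  exact Module.Finite.of_injective (e.functor.mapLinearMap k) fun f g h =>
    e.functor.map_injective h

/-- `X` is a direct summand of some `B^n`; its identity is the sum of the maps through the `n`
coordinates. Thus the regular module is a generator in the sense of
`finite_indecClass_of_generator`. -/
theorem FGProj.id_mem_closure {B : Type v} [Ring B] (X : FGProj B) :
    𝟙 X ∈ AddSubgroup.closure {f : X ⟶ X |
      ∃ (a : X ⟶ FGProj.self B) (b : FGProj.self B ⟶ X), f = a ≫ b} := by
  obtain ⟨n, f, g, -, -, h⟩ := Module.Finite.exists_comp_eq_id_of_projective B X.obj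
  have key : 𝟙 X = ∑ i : Fin n,
      FGProj.homMk (Y := FGProj.self B) (LinearMap.proj i ∘ₗ g) ≫
        FGProj.homMk (X := FGProj.self B) (f ∘ₗ LinearMap.single B (fun _ => B) i) := by
    apply FGProj.hom_ext
    rw [FGProj.toLin_sum]
    change LinearMap.id = ∑ i : Fin n,
      (f ∘ₗ LinearMap.single B (fun _ => B) i) ∘ₗ LinearMap.proj i ∘ₗ g
    rw [← h]
    ext x
    simp only [LinearMap.comp_apply, LinearMap.sum_apply, ← map_sum]
    congr 1
    exact (Finset.univ_sum_single (g x)).symm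
  rw [key]
  exact AddSubgroup.sum_mem _ fun i _ => AddSubgroup.subset_closure ⟨_, _, rfl⟩

theorem IsFinitary.finite_indecClass (hC : IsFinitary k C) : Finite (IndecClass C) := by
  have := hC.finite_hom
  have := hC.isIdempotentComplete
  obtain ⟨B, _, _, hB, -, e, _, _⟩ := hC
  refine finite_indecClass_of_generator k (e.inverse.obj (FGProj.self B)) fun X => ?_
  have h := FGProj.id_mem_closure (e.functor.obj X)
  let F : (e.functor.obj X ⟶ e.functor.obj X) →+ (X ⟶ X) :=
    { toFun := fun f => e.unit.app X ≫ e.inverse.map f ≫ e.unitInv.app X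
      map_zero' := by simp
      map_add' := fun f g => by simp }
  have h1 : F (𝟙 _) = 𝟙 X := by
    change e.unit.app X ≫ e.inverse.map (𝟙 _) ≫ e.unitInv.app X = _
    simp
  rw [← h1]
  have h2 := AddSubgroup.mem_map_of_mem F h
  rw [AddMonoidHom.map_closure] at h2
  refine AddSubgroup.closure_mono ?_ h2
  rintro _ ⟨_, ⟨a, b, rfl⟩, rfl⟩
  exact ⟨e.unit.app X ≫ e.inverse.map a, e.inverse.map b ≫ e.unitInv.app X, by
    change e.unit.app X ≫ e.inverse.map (a ≫ b) ≫ e.unitInv.app X = _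
    simp⟩

end Finitary

/-! ### Von Neumann regular morphisms -/

section Regular

variable {C : Type*} [Category* C]

/-- A morphism `f` is (von Neumann) regular if `f g f = f` for some `g`. -/
def IsRegularHom {X Y : C} (f : X ⟶ Y) : Prop := ∃ g : Y ⟶ X, f ≫ g ≫ f = f

theorem IsRegularHom.map {D : Type*} [Category* D] {X Y : C} {f : X ⟶ Y} (hf : IsRegularHom f)
    (F : C ⥤ D) : IsRegularHom (F.map f) := by
  obtain ⟨g, hg⟩ := hf
  exact ⟨F.map g, by rw [← F.map_comp, ← F.map_comp, hg]⟩

theorem IsRegularHom.of_retract {X Y X' Y' : C} {f : X ⟶ Y} (hf : IsRegularHom f) {r : X' ⟶ Y'}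
    (i : X' ⟶ X) (p : X ⟶ X') (j : Y' ⟶ Y) (q : Y ⟶ Y') (hp : i ≫ p = 𝟙 X')
    (h : i ≫ f = r ≫ j) (h' : f ≫ q = p ≫ r) : IsRegularHom r := by
  obtain ⟨g, hg⟩ := hf
  refine ⟨j ≫ g ≫ p, ?_⟩
  calc r ≫ (j ≫ g ≫ p) ≫ r = (r ≫ j) ≫ g ≫ p ≫ r := by simp
    _ = i ≫ (f ≫ g ≫ f) ≫ q := by rw [← h, ← h']; simp
    _ = r := by rw [hg, h', reassoc_of% hp]

variable [Preadditive C] (k : Type*) [Field k] [Linear k C] [∀ X Y : C, Module.Finite k (X ⟶ Y)]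

/-- `f ≫ b ≫ a ≫ f` is the part of `f` that splits off through `R`; the maps `f ≫ b ≫ a` and `b ≫ a
≫ f` are idempotents that fix it and kill the rest. -/
theorem rankAt_eq_add_of_retract (P : C) {X Y R : C} {f : X ⟶ Y} {a : R ⟶ X} {b : Y ⟶ R}
    (h : a ≫ f ≫ b = 𝟙 R) :
    rankAt k P f = rankAt k P (𝟙 R) + rankAt k P (f - f ≫ b ≫ a ≫ f) := by
  have h1 : rankAt k P (f ≫ b ≫ a ≫ f) = rankAt k P (𝟙 R) :=
    rankAt_eq_of_retracts k P (a := f ≫ b) (b := a ≫ f) (a' := a) (b' := b) (by simp)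
      (by simp [h])
  rw [← h1, ← rankAt_add k P _ _ (f ≫ b ≫ a) (b ≫ a ≫ f)]
  · congr 1; abel
  all_goals simp [reassoc_of% h]

variable {k}

/-- Every morphism `f` has a largest split part `f ≫ b ≫ a ≫ f`: the rest is radical. -/
theorem exists_maximal_split [HasZeroObject C] [HasBinaryBiproducts C] [IsIdempotentComplete C]
    {X Y : C} (f : X ⟶ Y) : ∃ (R : C) (a : R ⟶ X) (b : Y ⟶ R), a ≫ f ≫ b = 𝟙 R ∧
      ∀ c : IndecClass C, rankAt k c.obj (f - f ≫ b ≫ a ≫ f) = 0 := by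
  -- Maximality is measured by the dimension of `End R`, which is bounded by that of `End X` because
  -- `R` is a retract of `X`.
  let S : Set ℕ := {n | ∃ (R : C) (a : R ⟶ X) (b : Y ⟶ R), a ≫ f ≫ b = 𝟙 R ∧
    Module.finrank k (R ⟶ R) = n}
  have hne : S.Nonempty := by
    obtain ⟨Z, hZ⟩ := HasZeroObject.zero (C := C)
    exact ⟨_, Z, 0, 0, hZ.eq_of_src _ _, rfl⟩
  have hbdd : BddAbove S := by
    refine ⟨Module.finrank k (X ⟶ X), ?_⟩
    rintro _ ⟨R, a, b, h, rfl⟩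
    refine LinearMap.finrank_le_finrank_of_injective
      (f := (Linear.rightComp k X a) ∘ₗ (Linear.leftComp k R (f ≫ b))) fun g g' hg => ?_
    have := congrArg (fun x => a ≫ x ≫ f ≫ b) hg
    simpa [reassoc_of% h, h] using this
  obtain ⟨R, a, b, h, hn⟩ := Nat.sSup_mem hne hbdd
  refine ⟨R, a, b, h, fun c => ?_⟩
  by_contra hc
  obtain ⟨a', b', h'⟩ := c.indecomposable.exists_retract_of_rankAt_ne_zero hc
  -- A copy of `c.obj` split off from the remainder can be corrected by the complementary
  -- idempotents so that it is orthogonal to `R`; then `R ⊞ c.obj` splits off from `f`,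
  -- contradicting maximality.
  have h1 : biprod.desc a (a' ≫ (𝟙 X - f ≫ b ≫ a)) ≫ f ≫
      biprod.lift b ((𝟙 Y - b ≫ a ≫ f) ≫ b') = 𝟙 (R ⊞ c.obj) := by
    ext
    · simp [h]
    · simp [reassoc_of% h]
    · simp [h]
    · have h2 := h'
      simp only [Preadditive.sub_comp, Preadditive.comp_sub, Category.assoc] at h2
      simp [reassoc_of% h]
      exact h2
  have h2 : Module.finrank k (R ⊞ c.obj ⟶ R ⊞ c.obj) ∈ S := ⟨_, _, _, h1, rfl⟩
  have h3 := le_csSup hbdd h2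
  have h4 := finrank_end_add_le k (BinaryBiproduct.bicone R c.obj) (Iso.refl _)
  have h5 := finrank_end_pos k c.indecomposable.1
  rw [← hn] at h3
  change _ ≤ Module.finrank k (R ⊞ c.obj ⟶ R ⊞ c.obj) at h4
  omega

end Regular

/-! ### Projective objects and monomorphisms in the abelianization -/

section DiagAb

variable {C : Type*} [Category* C] [Preadditive C]

/-- A diagram as an object of the abelianization. -/
abbrev DiagAb.mk (X : Arrow C) : DiagAb C := (CategoryTheory.Quotient.functor (nullRel C)).obj X

theorem DiagAb.map_eq_iff {X Y : Arrow C} (f g : X ⟶ Y) :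
    (CategoryTheory.Quotient.functor (nullRel C)).map f =
      (CategoryTheory.Quotient.functor (nullRel C)).map g ↔
    ∃ h : X.right ⟶ Y.left, f.right - g.right = h ≫ Y.hom :=
  CategoryTheory.Quotient.functor_map_eq_iff (nullRel C) f g

/-- The cokernel of `f` is represented by the diagram `Y.left ⊞ X.right ⟶ Y.right`. If `f` is epi,
the projection `Y ⟶ Z` is zero, which means that the identity of `Y.right` factors through this
diagram. -/
theorem DiagAb.exists_section_of_epi [HasBinaryBiproducts C] {X Y : Arrow C} (f : X ⟶ Y)
    [hf : Epi ((CategoryTheory.Quotient.functor (nullRel C)).map f)] :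
    ∃ (s : Y.right ⟶ Y.left) (t : Y.right ⟶ X.right), s ≫ Y.hom + t ≫ f.right = 𝟙 Y.right := by
  let Z : Arrow C := Arrow.mk (biprod.desc Y.hom f.right)
  let p : Y ⟶ Z := Arrow.homMk (u := biprod.inl) (v := 𝟙 _) (by simp [Z])
  let z : Y ⟶ Z := Arrow.homMk (u := 0) (v := 0) (by simp)
  have h1 : (CategoryTheory.Quotient.functor (nullRel C)).map (f ≫ p) =
      (CategoryTheory.Quotient.functor (nullRel C)).map (f ≫ z) :=
    (DiagAb.map_eq_iff _ _).2 ⟨biprod.inr, by simp [Z, p, z]⟩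
  rw [Functor.map_comp, Functor.map_comp, cancel_epi, DiagAb.map_eq_iff] at h1
  obtain ⟨h, hh⟩ := h1
  refine ⟨h ≫ biprod.fst, h ≫ biprod.snd, ?_⟩
  have hh' : 𝟙 Y.right - 0 = h ≫ biprod.desc Y.hom f.right := hh
  rw [sub_zero, biprod.desc_eq] at hh'
  simp [hh']

/-- If `X.hom ≫ g ≫ X.hom = X.hom`, the idempotent `𝟙 - g ≫ X.hom` cuts out of `X.right` a summand
representing the cokernel, and maps out of it lift along the partial section `t` of the epimorphism.
-/
theorem DiagAb.projective_of_isRegularHom [HasBinaryBiproducts C] (X : Arrow C)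
    (hX : IsRegularHom X.hom) : Projective (DiagAb.mk X) where
  factors {E Y} φ e he := by
    obtain ⟨g, hg⟩ := hX
    obtain ⟨E, rfl⟩ : ∃ E', E = DiagAb.mk E' := ⟨E.as, rfl⟩
    obtain ⟨Y, rfl⟩ : ∃ Y', Y = DiagAb.mk Y' := ⟨Y.as, rfl⟩
    obtain ⟨φ, rfl⟩ := (CategoryTheory.Quotient.functor (nullRel C)).map_surjective φ
    obtain ⟨e, rfl⟩ := (CategoryTheory.Quotient.functor (nullRel C)).map_surjective e
    obtain ⟨s, t, hst⟩ := DiagAb.exists_section_of_epi e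
    have hw : φ.left ≫ Y.hom = X.hom ≫ φ.right := Arrow.w φ
    let ψ : X ⟶ E := Arrow.homMk (u := 0) (v := (𝟙 _ - g ≫ X.hom) ≫ φ.right ≫ t)
      (by simp [reassoc_of% hg])
    refine ⟨(CategoryTheory.Quotient.functor (nullRel C)).map ψ, ?_⟩
    rw [← Functor.map_comp, DiagAb.map_eq_iff]
    refine ⟨- ((𝟙 _ - g ≫ X.hom) ≫ φ.right ≫ s) - g ≫ φ.left, ?_⟩
    have h1 : φ.right ≫ t ≫ e.right = φ.right - φ.right ≫ s ≫ Y.hom := by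
      rw [eq_sub_iff_add_eq, add_comm, ← Preadditive.comp_add, hst, Category.comp_id]
    have h2 : (ψ ≫ e).right = (𝟙 _ - g ≫ X.hom) ≫ φ.right ≫ t ≫ e.right := by simp [ψ]
    rw [h2, h1]
    simp only [Preadditive.sub_comp, Preadditive.comp_sub, Preadditive.neg_comp, Category.assoc, hw,
      Category.id_comp]
    abel

/-- A left exact functor between abelianizations is exact at weak kernels. -/
theorem abMap_exact_of_preservesFiniteLimits {D : Type*} [Category* D] [Preadditive D]
    [HasZeroObject C] (F : C ⥤ D) [F.Additive] [PreservesFiniteLimits (abMap F)] {X' X Y : C}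
    (g : X' ⟶ X) (f : X ⟶ Y) (hgf : g ≫ f = 0)
    (hf : ∀ (W : C) (w : W ⟶ X), w ≫ f = 0 → ∃ l : W ⟶ X', l ≫ g = w)
    [HasZeroObject D] (W : D) (w : W ⟶ F.obj X) (hw : w ≫ F.map f = 0) :
    ∃ l : W ⟶ F.obj X', l ≫ F.map g = w := by
  obtain ⟨Z, hZ⟩ := HasZeroObject.zero (C := C)
  obtain ⟨Z', hZ'⟩ := HasZeroObject.zero (C := D)
  -- For a weak kernel `g` of `f` the diagram `g` stands for the image of `f`, and `i` for its
  -- inclusion into `Y`. A left exact functor keeps `i` mono, which says that `F.map g` is a weak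
  -- kernel of `F.map f`.
  let K : Arrow C := Arrow.mk g
  let T : Arrow C := Arrow.mk (0 : Z ⟶ Y)
  let i : K ⟶ T := Arrow.homMk (u := 0) (v := f) (by simp [K, T, hgf])
  have hi : Mono ((CategoryTheory.Quotient.functor (nullRel C)).map i) := by
    constructor
    intro E φ ψ h
    obtain ⟨E, rfl⟩ : ∃ E', E = DiagAb.mk E' := ⟨E.as, rfl⟩
    obtain ⟨φ, rfl⟩ := (CategoryTheory.Quotient.functor (nullRel C)).map_surjective φ
    obtain ⟨ψ, rfl⟩ := (CategoryTheory.Quotient.functor (nullRel C)).map_surjective ψ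
    rw [← Functor.map_comp, ← Functor.map_comp, DiagAb.map_eq_iff] at h
    obtain ⟨l, hl⟩ := h
    rw [DiagAb.map_eq_iff]
    have hl' : φ.right ≫ f - ψ.right ≫ f = l ≫ (0 : Z ⟶ Y) := hl
    rw [comp_zero, ← Preadditive.sub_comp] at hl'
    obtain ⟨m, hm⟩ := hf _ _ hl'
    exact ⟨m, hm.symm⟩
  have hFi : Mono ((abMap F).map ((CategoryTheory.Quotient.functor (nullRel C)).map i)) :=
    preserves_mono_of_preservesLimit _ _
  let E : Arrow D := Arrow.mk (0 : Z' ⟶ W)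
  let FK : Arrow D := F.mapArrow.obj K
  let φ : E ⟶ FK := Arrow.homMk (u := 0) (v := w) (hZ'.eq_of_src _ _)
  let ψ : E ⟶ FK := Arrow.homMk (u := 0) (v := 0) (by simp)
  have h1 : (CategoryTheory.Quotient.functor (nullRel D)).map (φ ≫ F.mapArrow.map i) =
      (CategoryTheory.Quotient.functor (nullRel D)).map (ψ ≫ F.mapArrow.map i) := by
    rw [DiagAb.map_eq_iff]
    refine ⟨0, ?_⟩
    rw [zero_comp]
    have : w ≫ F.map f - (0 : W ⟶ F.obj X) ≫ F.map f = 0 := by rw [hw, zero_comp, sub_zero]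
    exact this
  rw [Functor.map_comp, Functor.map_comp] at h1
  have h2 := hFi.right_cancellation _ _ h1
  obtain ⟨l, hl⟩ := (DiagAb.map_eq_iff φ ψ).1 h2
  have hl' : w - 0 = l ≫ F.map g := hl
  exact ⟨l, hl'.symm.trans (sub_zero w)⟩

end DiagAb

/-! ### Growth of 2-representations -/

namespace FinitaryTwoRep

variable {k : Type u} [Field k] {𝒟 : Type u₁} [Bicategory.{w₁, v₁} 𝒟]
  [∀ a b : 𝒟, Preadditive (a ⟶ b)] [∀ a b : 𝒟, Linear k (a ⟶ b)]
  (M : FinitaryTwoRep.{u, w₁, v₁, u₁, v₂, u₂} k 𝒟)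

instance (i : 𝒟) (X Y : M.obj i) : Module.Finite k (X ⟶ Y) := (M.finitary i).finite_hom X Y

instance (i : 𝒟) : IsIdempotentComplete (M.obj i) := (M.finitary i).isIdempotentComplete

instance (i : 𝒟) : HasZeroObject (M.obj i) := (M.finitary i).hasZeroObject

instance (i : 𝒟) : HasBinaryBiproducts (M.obj i) := (M.finitary i).hasBinaryBiproducts

instance (i : 𝒟) : Finite (IndecClass (M.obj i)) := (M.finitary i).finite_indecClass

/-- The action of a composition. -/
def actComp {i j l : 𝒟} (F : i ⟶ j) (G : j ⟶ l) : M.act (F ≫ G) ≅ M.act F ⋙ M.act G :=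
  Cat.Hom.toNatIso (M.mapComp F G)

/-- The action of an identity. -/
def actId (i : 𝒟) : M.act (𝟙 i) ≅ 𝟭 (M.obj i) := Cat.Hom.toNatIso (M.mapId i)

/-- Evaluation of 1-morphisms at an object. -/
@[simps]
def eval {i : 𝒟} (X : M.obj i) (j : 𝒟) : (i ⟶ j) ⥤ M.obj j where
  obj H := (M.act H).obj X
  map α := (M.map₂ α).toNatTrans.app X
  map_id H := by rw [M.map₂_id]; rfl
  map_comp α β := by rw [M.map₂_comp]; rfl

instance {i : 𝒟} (X : M.obj i) (j : 𝒟) : (M.eval X j).Additive where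
  map_add := M.map₂_add _ _ _

/-- The natural transformation between evaluations induced by a morphism. -/
@[simps]
def evalMap {i : 𝒟} {X Y : M.obj i} (f : X ⟶ Y) (j : 𝒟) : M.eval X j ⟶ M.eval Y j where
  app H := (M.act H).map f
  naturality _ _ α := ((M.map₂ α).toNatTrans.naturality f).symm

theorem rankAt_act_comp {i j l : 𝒟} (F : i ⟶ j) (G : j ⟶ l) {X Y : M.obj i} (f : X ⟶ Y)
    (P : M.obj l) :
    rankAt k P ((M.act (F ≫ G)).map f) = rankAt k P ((M.act G).map ((M.act F).map f)) := by
  refine rankAt_eq_of_retracts k P (a := (M.actComp F G).hom.app X)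
    (b := (M.actComp F G).inv.app Y) (a' := (M.actComp F G).inv.app X)
    (b' := (M.actComp F G).hom.app Y) ?_ ?_
  · have := (M.actComp F G).hom.naturality_assoc f ((M.actComp F G).inv.app Y)
    rw [Iso.hom_inv_id_app, Category.comp_id] at this
    exact this
  · rw [(M.actComp F G).hom.naturality f, Iso.inv_hom_id_app_assoc]
    rfl

theorem rankAt_act_id {i : 𝒟} {X Y : M.obj i} (f : X ⟶ Y) (P : M.obj i) :
    rankAt k P ((M.act (𝟙 i)).map f) = rankAt k P f := by
  refine rankAt_eq_of_retracts k P (a := (M.actId i).hom.app X)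
    (b := (M.actId i).inv.app Y) (a' := (M.actId i).inv.app X)
    (b' := (M.actId i).hom.app Y) ?_ ?_
  · have := (M.actId i).hom.naturality_assoc f ((M.actId i).inv.app Y)
    rw [Iso.hom_inv_id_app, Category.comp_id] at this
    exact this
  · rw [(M.actId i).hom.naturality f, Iso.inv_hom_id_app_assoc]
    rfl

theorem isAdditiveFunction_rankAt_act {i j : 𝒟} {X Y : M.obj i} (f : X ⟶ Y) (P : M.obj j) :
    IsAdditiveFunction fun H : i ⟶ j => (rankAt k P ((M.act H).map f) : ℝ) :=
  isAdditiveFunction_rankAt (k := k) (M.evalMap f j) P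

/-- Simplicity: a nonzero morphism has nonzero rank after applying an indecomposable 1-morphism. -/
theorem exists_rankAt_act_ne_zero [∀ a b : 𝒟, Fintype (IndecClass (a ⟶ b))]
    [∀ (a b : 𝒟) (X Y : a ⟶ b), Module.Finite k (X ⟶ Y)]
    [∀ a b : 𝒟, IsIdempotentComplete (a ⟶ b)] [IsAlgClosed k] (hM : M.IsSimple) {i : 𝒟} {X Y : M.obj i} {f : X ⟶ Y}
    (hf : f ≠ 0) : ∃ (j : 𝒟) (h : IndecClass (i ⟶ j)) (c : IndecClass (M.obj j)),
      rankAt k c.obj ((M.act h.obj).map f) ≠ 0 := by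
  have key : ∃ (j : 𝒟) (H : i ⟶ j) (c : IndecClass (M.obj j)),
      rankAt k c.obj ((M.act H).map f) ≠ 0 := by
    by_contra! hcon
    -- The morphisms all of whose images under 1-morphisms have rank zero everywhere, that is, stay
    -- radical. By simplicity this ideal is zero, or contains the identity of `Y`; the latter is
    -- excluded by acting with `𝟙 i`.
    let I : M.InvariantIdeal :=
      { hom := fun i X Y =>
          { carrier := {f | ∀ (j : 𝒟) (H : i ⟶ j) (c : IndecClass (M.obj j)),
              rankAt k c.obj ((M.act H).map f) = 0}
            zero_mem' := fun j H c => by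
              rw [Functor.map_zero, rankAt_eq_zero_iff]
              intro x
              rw [comp_zero]
              exact Submodule.zero_mem _
            add_mem' := fun {f g} hf hg j H c => by
              rw [Functor.map_add, rankAt_eq_zero_iff]
              intro x
              rw [Preadditive.comp_add]
              exact Submodule.add_mem _ ((rankAt_eq_zero_iff k _ _).1 (hf j H c) x)
                ((rankAt_eq_zero_iff k _ _).1 (hg j H c) x)
            smul_mem' := fun r f hf j H c => by
              rw [Functor.map_smul, rankAt_eq_zero_iff]
              intro x
              rw [Linear.comp_smul]
              exact Submodule.smul_mem _ _ ((rankAt_eq_zero_iff k _ _).1 (hf j H c) x) }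
        comp_mem_left := fun f g hg j H c => by
          rw [Functor.map_comp]
          exact Nat.eq_zero_of_le_zero ((rankAt_comp_le_right k _ _ _).trans (hg j H c).le)
        comp_mem_right := fun f g hf j H c => by
          rw [Functor.map_comp]
          exact Nat.eq_zero_of_le_zero ((rankAt_comp_le_left k _ _ _).trans (hf j H c).le)
        map_mem := fun F X Y f hf j H c => by
          rw [← rankAt_act_comp]
          exact hf j (F ≫ H) c }
    have hfI : f ∈ I.hom i X Y := hcon
    rcases hM I with h | h
    · rw [h] at hfI
      exact hf hfI
    · have hY : ¬ IsZero Y := fun hY => hf (hY.eq_of_tgt _ _)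
      obtain ⟨c, hc⟩ := exists_indecClass_rankAt_ne_zero k hY
      have h1 : 𝟙 Y ∈ I.hom i Y Y := by rw [h]; trivial
      have h2 := h1 i (𝟙 i) c
      rw [rankAt_act_id] at h2
      exact hc h2
  obtain ⟨j, H, c, hc⟩ := key
  -- For a fixed `f` the rank is additive in the 1-morphism, so some indecomposable summand of `H`
  -- already has nonzero rank at `f`.
  have h2 := (M.isAdditiveFunction_rankAt_act f c.obj).eq_sum k H
  by_contra! hcon
  apply hc
  have : (rankAt k c.obj ((M.act H).map f) : ℝ) = 0 := by
    refine h2.trans (Finset.sum_eq_zero fun h _ => ?_)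
    rw [hcon j h c, Nat.cast_zero, mul_zero]
  exact_mod_cast this

/-! ### Perron–Frobenius weights and growth of ranks -/

section Weight

variable [∀ i, Fintype (IndecClass (M.obj i))] (w : (Σ i, IndecClass (M.obj i)) → ℝ)

/-- The weighted sum of the ranks of a morphism. -/
noncomputable def weight {i : 𝒟} {X Y : M.obj i} (f : X ⟶ Y) : ℝ :=
  ∑ c : IndecClass (M.obj i), w ⟨i, c⟩ * (rankAt k c.obj f : ℝ)

theorem isAdditiveFunction_weight_act {i j : 𝒟} {X Y : M.obj i} (f : X ⟶ Y) :
    IsAdditiveFunction fun H : i ⟶ j => M.weight w ((M.act H).map f) :=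
  IsAdditiveFunction.sum (fun c : IndecClass (M.obj j) =>
    M.isAdditiveFunction_rankAt_act f c.obj) _

theorem isAdditiveFunction_weight_act_id {i j : 𝒟} (H : i ⟶ j) :
    IsAdditiveFunction fun X : M.obj i => M.weight w (𝟙 ((M.act H).obj X)) :=
  IsAdditiveFunction.sum (fun c : IndecClass (M.obj j) =>
    isAdditiveFunction_rankAt (k := k) (𝟙 (M.act H)) c.obj) _

theorem weight_act_comp {i j l : 𝒟} (F : i ⟶ j) (G : j ⟶ l) {X Y : M.obj i} (f : X ⟶ Y) :
    M.weight w ((M.act (F ≫ G)).map f) = M.weight w ((M.act G).map ((M.act F).map f)) := by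
  simp only [weight, rankAt_act_comp]

theorem weight_add_of_retract {i : 𝒟} {X Y R : M.obj i} {f : X ⟶ Y} {a : R ⟶ X} {b : Y ⟶ R}
    (h : a ≫ f ≫ b = 𝟙 R) :
    M.weight w f = M.weight w (𝟙 R) + M.weight w (f - f ≫ b ≫ a ≫ f) := by
  simp only [weight, rankAt_eq_add_of_retract k _ h, Nat.cast_add, mul_add,
    Finset.sum_add_distrib]

variable {w}

theorem weight_nonneg (hw : ∀ c, 0 < w c) {i : 𝒟} {X Y : M.obj i} (f : X ⟶ Y) :
    0 ≤ M.weight w f :=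
  Finset.sum_nonneg fun _ _ => mul_nonneg (hw _).le (Nat.cast_nonneg _)

theorem weight_pos (hw : ∀ c, 0 < w c) {i : 𝒟} {X Y : M.obj i} {f : X ⟶ Y}
    {c : IndecClass (M.obj i)} (hc : rankAt k c.obj f ≠ 0) : 0 < M.weight w f :=
  Finset.sum_pos' (fun _ _ => mul_nonneg (hw _).le (Nat.cast_nonneg _))
    ⟨c, Finset.mem_univ _, mul_pos (hw _) (Nat.cast_pos.2 (Nat.pos_of_ne_zero hc))⟩

variable [Fintype 𝒟] [∀ a b : 𝒟, Fintype (IndecClass (a ⟶ b))]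
  [∀ (a b : 𝒟) (X Y : a ⟶ b), Module.Finite k (X ⟶ Y)]
  [∀ a b : 𝒟, IsIdempotentComplete (a ⟶ b)] [IsAlgClosed k]

/-- Positive weights for which the sum of all indecomposable 1-morphisms multiplies the weight of
each object by the same factor. -/
theorem exists_weight (hM : M.IsTransitive) [Nonempty (Σ i, IndecClass (M.obj i))] :
    ∃ (w : (Σ i, IndecClass (M.obj i)) → ℝ) (μ : ℝ), (∀ c, 0 < w c) ∧
      ∀ (i : 𝒟) (X : M.obj i), ∑ j, ∑ h : IndecClass (i ⟶ j),
        M.weight w (𝟙 ((M.act h.obj).obj X)) = μ * M.weight w (𝟙 X) := by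
  -- The entry counts the copies of `d` in the sum of all indecomposable 1-morphisms applied to `c`;
  -- transitivity makes it positive.
  let T : Matrix (Σ i, IndecClass (M.obj i)) (Σ i, IndecClass (M.obj i)) ℝ := fun c d =>
    ∑ h : IndecClass (c.1 ⟶ d.1), (rankAt k d.2.obj (𝟙 ((M.act h.obj).obj c.2.obj)) : ℝ)
  have hT : ∀ c d, 0 < T c d := by
    rintro ⟨i, c⟩ ⟨j, d⟩
    obtain ⟨F, hF⟩ := hM i j c.obj d.obj c.indecomposable d.indecomposable
    obtain ⟨a, b, hab⟩ := hF.exists_retract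
    have h1 : rankAt k d.obj ((M.act F).map (𝟙 c.obj)) ≠ 0 :=
      d.indecomposable.rankAt_ne_zero (a := a) (b := b) (by simpa using hab)
    have h2 := (M.isAdditiveFunction_rankAt_act (𝟙 c.obj) d.obj).eq_sum k F
    have h3 : (0 : ℝ) < rankAt k d.obj ((M.act F).map (𝟙 c.obj)) :=
      Nat.cast_pos.2 (Nat.pos_of_ne_zero h1)
    rw [h2] at h3
    obtain ⟨h, -, hh⟩ := Finset.exists_lt_of_sum_lt (s := Finset.univ)
      (f := fun _ : IndecClass (i ⟶ j) => (0 : ℝ)) (by simpa using h3)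
    refine Finset.sum_pos' (fun _ _ => Nat.cast_nonneg _) ⟨h, Finset.mem_univ _, ?_⟩
    exact pos_of_mul_pos_right hh (Nat.cast_nonneg _)
  obtain ⟨w, μ, hw, h⟩ := Matrix.exists_pos_eigenvector T hT
  refine ⟨w, μ, hw, fun i X => ?_⟩
  have key : ∀ c : IndecClass (M.obj i), ∑ j, ∑ h : IndecClass (i ⟶ j),
      M.weight w (𝟙 ((M.act h.obj).obj c.obj)) = μ * w ⟨i, c⟩ := fun c => by
    have h1 := congrFun h ⟨i, c⟩
    rw [Pi.smul_apply, smul_eq_mul] at h1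
    rw [← h1, Matrix.mulVec, dotProduct, Fintype.sum_sigma]
    refine Finset.sum_congr rfl fun j _ => ?_
    simp only [weight, T, Finset.sum_mul]
    rw [Finset.sum_comm]
    exact Finset.sum_congr rfl fun d _ => Finset.sum_congr rfl fun h _ => mul_comm _ _
  calc ∑ j, ∑ h : IndecClass (i ⟶ j), M.weight w (𝟙 ((M.act h.obj).obj X))
      = ∑ j, ∑ h : IndecClass (i ⟶ j), ∑ c : IndecClass (M.obj i),
          (rankAt k c.obj (𝟙 X) : ℝ) * M.weight w (𝟙 ((M.act h.obj).obj c.obj)) :=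
        Finset.sum_congr rfl fun j _ => Finset.sum_congr rfl fun h _ =>
          (M.isAdditiveFunction_weight_act_id w h.obj).eq_sum k X
    _ = ∑ c : IndecClass (M.obj i), (rankAt k c.obj (𝟙 X) : ℝ) *
          ∑ j, ∑ h : IndecClass (i ⟶ j), M.weight w (𝟙 ((M.act h.obj).obj c.obj)) := by
        simp only [Finset.mul_sum]
        rw [Finset.sum_comm']
        · exact Finset.sum_congr rfl fun j _ => Finset.sum_comm
        · simp
    _ = μ * M.weight w (𝟙 X) := by
        simp only [key]
        rw [weight, Finset.mul_sum]
        exact Finset.sum_congr rfl fun c _ => by ring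

/-- The weight of a morphism grows at least as fast as that of an object, with equality only for
regular morphisms. -/
theorem weight_growth (hM : M.IsSimple) {μ : ℝ} (hw : ∀ c, 0 < w c)
    (h : ∀ (i : 𝒟) (X : M.obj i), ∑ j, ∑ h : IndecClass (i ⟶ j),
        M.weight w (𝟙 ((M.act h.obj).obj X)) = μ * M.weight w (𝟙 X))
    {i : 𝒟} {X Y : M.obj i} (f : X ⟶ Y) :
    μ * M.weight w f ≤ ∑ j, ∑ h : IndecClass (i ⟶ j), M.weight w ((M.act h.obj).map f) ∧
      (¬ IsRegularHom f →
        μ * M.weight w f < ∑ j, ∑ h : IndecClass (i ⟶ j), M.weight w ((M.act h.obj).map f)) := by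
  -- Functors preserve the splitting of `f` into the part through `R` and the remainder `r`. The
  -- first grows by exactly `μ`, so any excess growth is the weight of the images of `r`, whose own
  -- weight is zero.
  obtain ⟨R, a, b, hab, hr⟩ := exists_maximal_split (k := k) f
  set r := f - f ≫ b ≫ a ≫ f with hr_def
  have hf : M.weight w f = M.weight w (𝟙 R) := by
    rw [M.weight_add_of_retract w hab, ← hr_def]
    simp [weight, hr]
  have hact : ∀ (j : 𝒟) (H : i ⟶ j), M.weight w ((M.act H).map f) =
      M.weight w (𝟙 ((M.act H).obj R)) + M.weight w ((M.act H).map r) := fun j H => by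
    have h1 : (M.act H).map a ≫ (M.act H).map f ≫ (M.act H).map b = 𝟙 ((M.act H).obj R) := by
      rw [← Functor.map_comp, ← Functor.map_comp, hab,
        CategoryTheory.Functor.map_id]
    rw [M.weight_add_of_retract w h1]
    simp [hr_def]
  have hsum : ∑ j, ∑ h : IndecClass (i ⟶ j), M.weight w ((M.act h.obj).map f) =
      μ * M.weight w f + ∑ j, ∑ h : IndecClass (i ⟶ j), M.weight w ((M.act h.obj).map r) := by
    simp only [hact, Finset.sum_add_distrib]
    rw [h, hf]
  have hnn : ∀ j, 0 ≤ ∑ h : IndecClass (i ⟶ j), M.weight w ((M.act h.obj).map r) := fun j =>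
    Finset.sum_nonneg fun h _ => M.weight_nonneg hw _
  rw [hsum]
  refine ⟨le_add_of_nonneg_right (Finset.sum_nonneg fun j _ => hnn j), fun hreg => ?_⟩
  apply lt_add_of_pos_right
  have hr0 : r ≠ 0 := fun h0 => hreg ⟨b ≫ a, by
    rw [hr_def, sub_eq_zero] at h0
    simpa using h0.symm⟩
  obtain ⟨j, h, c, hc⟩ := M.exists_rankAt_act_ne_zero hM hr0
  exact Finset.sum_pos' (fun j _ => hnn j) ⟨j, Finset.mem_univ _,
    Finset.sum_pos' (fun h _ => M.weight_nonneg hw _) ⟨h, Finset.mem_univ _, M.weight_pos hw hc⟩⟩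

end Weight

end FinitaryTwoRep

/-! ### The apex -/

section GeJ

variable {𝒟 : Type u₁} [Bicategory.{w₁, v₁} 𝒟] [∀ a b : 𝒟, Preadditive (a ⟶ b)]

theorem IndecOneMor.geJ_of_retract [∀ a b : 𝒟, IsIdempotentComplete (a ⟶ b)]
    {F G : IndecOneMor 𝒟} (H₂ : F.src ⟶ G.src) (H₁ : G.tgt ⟶ F.tgt)
    (i : F.hom ⟶ H₂ ≫ G.hom ≫ H₁) (q : H₂ ≫ G.hom ≫ H₁ ⟶ F.hom) (h : i ≫ q = 𝟙 _) : F.GeJ G :=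
  ⟨H₂, H₁, isSummand_of_retract i q h⟩

theorem IndecOneMor.geJ_refl [∀ a b : 𝒟, IsIdempotentComplete (a ⟶ b)] (F : IndecOneMor 𝒟) :
    F.GeJ F :=
  IndecOneMor.geJ_of_retract (𝟙 _) (𝟙 _) ((λ_ _).inv ≫ 𝟙 _ ◁ (ρ_ _).inv)
    (𝟙 _ ◁ (ρ_ _).hom ≫ (λ_ _).hom) (by
      rw [Category.assoc, ← Bicategory.whiskerLeft_comp_assoc, Iso.inv_hom_id]
      simp)

theorem IndecOneMor.GeJ.trans [∀ a b : 𝒟, IsIdempotentComplete (a ⟶ b)] {F G H : IndecOneMor 𝒟}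
    (h : F.GeJ G) (h' : G.GeJ H) : F.GeJ H := by
  obtain ⟨A₂, A₁, hA⟩ := h
  obtain ⟨B₂, B₁, hB⟩ := h'
  obtain ⟨i, q, hiq⟩ := hA.exists_retract
  obtain ⟨i', q', hiq'⟩ := hB.exists_retract
  let e : A₂ ≫ (B₂ ≫ H.hom ≫ B₁) ≫ A₁ ≅ (A₂ ≫ B₂) ≫ H.hom ≫ B₁ ≫ A₁ :=
    Bicategory.whiskerLeftIso A₂ (α_ _ _ _) ≪≫
      Bicategory.whiskerLeftIso A₂ (Bicategory.whiskerLeftIso B₂ (α_ _ _ _)) ≪≫ (α_ _ _ _).symm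
  refine IndecOneMor.geJ_of_retract (A₂ ≫ B₂) (B₁ ≫ A₁) (i ≫ A₂ ◁ (i' ▷ A₁) ≫ e.hom)
    (e.inv ≫ A₂ ◁ (q' ▷ A₁) ≫ q) ?_
  simp only [Category.assoc, Iso.hom_inv_id_assoc]
  rw [← Bicategory.whiskerLeft_comp_assoc, ← Bicategory.comp_whiskerRight, hiq']
  simpa using hiq

theorem IsTwoSidedCell.geJ [∀ a b : 𝒟, IsIdempotentComplete (a ⟶ b)] {J : Set (IndecOneMor 𝒟)}
    (hJ : IsTwoSidedCell J) {F G : IndecOneMor 𝒟} (hF : F ∈ J) (hG : G ∈ J) : F.GeJ G := by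
  obtain ⟨H, rfl⟩ := hJ
  exact hF.2.trans hG.1

/-- Nonnegative coefficients on the indecomposable 1-morphisms with source `i` in a set `I` which
the sum of all indecomposable 1-morphisms multiplies by a scalar. -/
theorem exists_eigenvector_oneMor (k : Type u) [Field k] [∀ a b : 𝒟, Linear k (a ⟶ b)]
    [∀ a b : 𝒟, IsIdempotentComplete (a ⟶ b)] [Fintype 𝒟]
    [∀ a b : 𝒟, Fintype (IndecClass (a ⟶ b))]
    [∀ (a b : 𝒟) (X Y : a ⟶ b), Module.Finite k (X ⟶ Y)] [IsAlgClosed k]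
    (I : Set (IndecOneMor 𝒟)) (i : 𝒟)
    (hne : ∃ (j : 𝒟) (G : IndecClass (i ⟶ j)), ⟨i, j, G.obj, G.indecomposable⟩ ∈ I) :
    ∃ (s : ∀ j, IndecClass (i ⟶ j) → ℝ) (μ : ℝ), (∀ j G, 0 ≤ s j G) ∧
      (∃ j G, 0 < s j G) ∧
      (∀ j (G : IndecClass (i ⟶ j)), ⟨i, j, G.obj, G.indecomposable⟩ ∉ I → s j G = 0) ∧
      ∀ φ : ∀ j, (i ⟶ j) → ℝ, (∀ j, IsAdditiveFunction (φ j)) →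
        (∀ j (F : IndecClass (i ⟶ j)), ⟨i, j, F.obj, F.indecomposable⟩ ∉ I →
          (∃ G ∈ I, IndecOneMor.GeJ ⟨i, j, F.obj, F.indecomposable⟩ G) → φ j F.obj = 0) →
        ∑ j, ∑ G : IndecClass (i ⟶ j), s j G *
            ∑ l, ∑ h : IndecClass (j ⟶ l), φ l (G.obj ≫ h.obj) =
          μ * ∑ j, ∑ G : IndecClass (i ⟶ j), s j G * φ j G.obj := by
  classical
  let mk : (Σ j, IndecClass (i ⟶ j)) → IndecOneMor 𝒟 := fun p =>
    ⟨i, p.1, p.2.obj, p.2.indecomposable⟩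
  -- Multiplicity of `p` in `q` followed by the sum of all indecomposable 1-morphisms. Only the
  -- block with both indices in `I` enters the eigenvector; a summand `p` outside `I` of such a
  -- composite with `q ∈ I` satisfies `p ≥_J q`, so `φ` vanishes on it.
  let N : (Σ j, IndecClass (i ⟶ j)) → (Σ j, IndecClass (i ⟶ j)) → ℝ := fun p q =>
    ∑ h : IndecClass (q.1 ⟶ p.1), (rankAt k p.2.obj (𝟙 (q.2.obj ≫ h.obj)) : ℝ)
  have : Nonempty {p // mk p ∈ I} := by
    obtain ⟨j, G, h⟩ := hne
    exact ⟨⟨⟨j, G⟩, h⟩⟩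
  obtain ⟨s, μ, hs, ⟨p₀, hp₀⟩, h⟩ := Matrix.exists_nonneg_eigenvector
    (Matrix.of fun p q : {p // mk p ∈ I} => N p q)
    (fun p q => Finset.sum_nonneg fun _ _ => Nat.cast_nonneg _)
  let s' : (Σ j, IndecClass (i ⟶ j)) → ℝ := fun p => if hp : mk p ∈ I then s ⟨p, hp⟩ else 0
  have hs' : ∀ p : {p // mk p ∈ I}, s' p = s p := fun p => dif_pos p.2
  have hs0 : ∀ p, mk p ∉ I → s' p = 0 := fun p hp => dif_neg hp
  have hsum : ∀ g : (Σ j, IndecClass (i ⟶ j)) → ℝ, (∀ p, mk p ∉ I → g p = 0) →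
      ∑ p, g p = ∑ p : {p // mk p ∈ I}, g p := fun g hg => by
    rw [← Finset.sum_filter_of_ne (p := fun p => mk p ∈ I) fun p _ hp => by
      by_contra h0
      exact hp (hg p h0)]
    exact Finset.sum_subtype _ (by simp) g
  refine ⟨fun j G => s' ⟨j, G⟩, μ, ?_, ?_, ?_, ?_⟩
  · intro j G
    by_cases hp : mk ⟨j, G⟩ ∈ I
    · exact (hs _).trans_eq (hs' ⟨_, hp⟩).symm
    · exact (hs0 _ hp).ge
  · exact ⟨p₀.1.1, p₀.1.2, hp₀.trans_eq (hs' p₀).symm⟩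
  · exact fun j G hp => hs0 _ hp
  · intro φ hφ hvan
    let ψ : (Σ j, IndecClass (i ⟶ j)) → ℝ := fun p => φ p.1 p.2.obj
    have h1 : ∀ q : {p // mk p ∈ I}, ∑ l, ∑ h : IndecClass (q.1.1 ⟶ l),
        φ l (q.1.2.obj ≫ h.obj) = ∑ p : {p // mk p ∈ I}, N p q * ψ p := fun q => by
      rw [← hsum (fun p => N p q * ψ p), Fintype.sum_sigma]
      · refine Finset.sum_congr rfl fun l _ => ?_
        simp only [N, Finset.sum_mul]
        exact (Finset.sum_congr rfl fun h _ => (hφ l).eq_sum k _).trans Finset.sum_comm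
      · intro p hp
        by_cases hN : N p q = 0
        · rw [hN, zero_mul]
        · obtain ⟨h, -, hh⟩ := Finset.exists_ne_zero_of_sum_ne_zero hN
          obtain ⟨a, b, hab⟩ := p.2.indecomposable.exists_retract_of_rankAt_ne_zero
            (k := k) (fun h0 => hh (by rw [h0, Nat.cast_zero]))
          rw [Category.id_comp] at hab
          have : ψ p = 0 := hvan p.1 p.2 hp ⟨mk q, q.2,
            IndecOneMor.geJ_of_retract (F := mk p) (G := mk q) (𝟙 _) h.obj
              (a ≫ (λ_ _).inv) ((λ_ _).hom ≫ b) (by simpa using hab)⟩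
          rw [this, mul_zero]
    have h2 : ∀ g : (Σ j, IndecClass (i ⟶ j)) → ℝ,
        ∑ j, ∑ G : IndecClass (i ⟶ j), s' ⟨j, G⟩ * g ⟨j, G⟩ =
          ∑ p : {p // mk p ∈ I}, s p * g p := fun g => by
      rw [← Fintype.sum_sigma' (f := fun j G => s' ⟨j, G⟩ * g ⟨j, G⟩)]
      rw [hsum _ fun p hp => by rw [hs0 _ hp, zero_mul]]
      exact Finset.sum_congr rfl fun p _ => by rw [hs' p]
    rw [h2 ψ, h2 fun q => ∑ l, ∑ h : IndecClass (q.1 ⟶ l), φ l (q.2.obj ≫ h.obj)]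
    simp only [h1, Finset.mul_sum]
    rw [Finset.sum_comm]
    refine Finset.sum_congr rfl fun p _ => ?_
    have h3 := congrFun h p
    rw [Pi.smul_apply, smul_eq_mul] at h3
    rw [← mul_assoc, ← h3, Matrix.mulVec, dotProduct, Finset.sum_mul]
    exact Finset.sum_congr rfl fun q _ => by rw [Matrix.of_apply]; ring

end GeJ

/-! ### 1-morphisms of the apex produce regular morphisms -/

namespace FinitaryTwoRep

variable {k : Type u} [Field k] {𝒟 : Type u₁} [Bicategory.{w₁, v₁} 𝒟]
  [∀ a b : 𝒟, Preadditive (a ⟶ b)] [∀ a b : 𝒟, Linear k (a ⟶ b)]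
  (M : FinitaryTwoRep.{u, w₁, v₁, u₁, v₂, u₂} k 𝒟)

theorem isRegularHom_act_of_retract {i j : 𝒟} {F H : i ⟶ j} (a : F ⟶ H) (b : H ⟶ F)
    (hab : a ≫ b = 𝟙 F) {X Y : M.obj i} {f : X ⟶ Y} (h : IsRegularHom ((M.act H).map f)) :
    IsRegularHom ((M.act F).map f) := by
  refine h.of_retract ((M.eval X j).map a) ((M.eval X j).map b) ((M.eval Y j).map a)
    ((M.eval Y j).map b) ?_ ?_ ?_
  · exact ((M.eval X j).map_comp a b).symm.trans
      ((congrArg _ hab).trans ((M.eval X j).map_id F))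
  · exact (M.evalMap f j).naturality a
  · exact ((M.evalMap f j).naturality b).symm

theorem isRegularHom_act_comp {i j l : 𝒟} (F : i ⟶ j) (G : j ⟶ l) {X Y : M.obj i} {f : X ⟶ Y}
    (h : IsRegularHom ((M.act G).map ((M.act F).map f))) :
    IsRegularHom ((M.act (F ≫ G)).map f) :=
  h.of_retract ((M.actComp F G).hom.app X) ((M.actComp F G).inv.app X)
    ((M.actComp F G).hom.app Y) ((M.actComp F G).inv.app Y) (Iso.hom_inv_id_app _ _)
    ((M.actComp F G).hom.naturality f).symm ((M.actComp F G).inv.naturality f)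

theorem isZero_act_comp {i j l : 𝒟} (F : i ⟶ j) (G : j ⟶ l) {X : M.obj i}
    (h : IsZero ((M.act G).obj ((M.act F).obj X))) : IsZero ((M.act (F ≫ G)).obj X) :=
  h.of_iso ((M.actComp F G).app X)

theorem isZero_act_of_retract {i j : 𝒟} {F H : i ⟶ j} (a : F ⟶ H) (b : H ⟶ F)
    (hab : a ≫ b = 𝟙 F) {X : M.obj i} (h : IsZero ((M.act H).obj X)) :
    IsZero ((M.act F).obj X) := by
  have h' : IsZero ((M.eval X j).obj H) := h
  change IsZero ((M.eval X j).obj F)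
  rw [IsZero.iff_id_eq_zero, ← CategoryTheory.Functor.map_id, ← hab, Functor.map_comp,
    h'.eq_of_tgt ((M.eval X j).map a) 0, zero_comp]

variable {M} [∀ a b : 𝒟, IsIdempotentComplete (a ⟶ b)]

/-- Every member of the cell is a retract of a composite through `G`; if `G` acted as zero, so would
the whole cell. -/
theorem IsApex.exists_not_isZero {I : Set (IndecOneMor 𝒟)} (hI : M.IsApex I) {G : IndecOneMor 𝒟}
    (hG : G ∈ I) : ∃ X : M.obj G.src, ¬ IsZero ((M.act G.hom).obj X) := by
  by_contra! hcon
  obtain ⟨hcell, hann, -⟩ := hI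
  apply hann
  intro F hF X
  obtain ⟨H₂, H₁, h⟩ := hcell.geJ hF hG
  obtain ⟨a, b, hab⟩ := h.exists_retract
  refine M.isZero_act_of_retract a b hab (M.isZero_act_comp _ _ (M.isZero_act_comp _ _ ?_))
  exact Functor.map_isZero _ (hcon _)

/-- Otherwise the cell of `F` would not be annihilated and would lie above the apex, so it would
equal the apex by maximality. This is the vanishing demanded by `exists_eigenvector_oneMor`. -/
theorem IsApex.isZero_of_geJ {I : Set (IndecOneMor 𝒟)} (hI : M.IsApex I) {F G : IndecOneMor 𝒟}
    (hG : G ∈ I) (h : F.GeJ G) (hF : F ∉ I) (X : M.obj F.src) : IsZero ((M.act F.hom).obj X) := by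
  by_contra hX
  have hFF : F ∈ F.cell := ⟨F.geJ_refl, F.geJ_refl⟩
  have := hI.2.2 F.cell ⟨F, rfl⟩ (fun hann => hX (hann F hFF X)) ⟨F, hFF, G, hG, h⟩
  exact hF (this ▸ hFF)

variable [Fintype 𝒟] [∀ i, Fintype (IndecClass (M.obj i))]
  [∀ a b : 𝒟, Fintype (IndecClass (a ⟶ b))]
  [∀ (a b : 𝒟) (X Y : a ⟶ b), Module.Finite k (X ⟶ Y)] [IsAlgClosed k]

/-- Two eigenvalues are compared: the one of the weights on objects and the one of the coefficients
on the apex. Their equality leaves no room for strict growth of `M(G)f` when `G` has a positive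
coefficient. -/
theorem IsApex.isRegularHom_act {I : Set (IndecOneMor 𝒟)} (hI : M.IsApex I)
    (htransitive : M.IsTransitive) (hsimple : M.IsSimple) {F : IndecOneMor 𝒟} (hF : F ∈ I)
    {X Y : M.obj F.src} (f : X ⟶ Y) : IsRegularHom ((M.act F.hom).map f) := by
  obtain ⟨c, ⟨e⟩⟩ := F.indecomposable.exists_indecClass
  have hcI : ⟨F.src, F.tgt, c.obj, c.indecomposable⟩ ∈ I := by
    by_contra hc
    obtain ⟨X, hX⟩ := hI.exists_not_isZero hF
    refine hX (M.isZero_act_of_retract e.hom e.inv e.hom_inv_id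
      (hI.isZero_of_geJ hF ?_ hc X))
    exact IndecOneMor.geJ_of_retract (𝟙 _) (𝟙 _) (e.inv ≫ (λ_ _).inv ≫ 𝟙 _ ◁ (ρ_ _).inv)
      (𝟙 _ ◁ (ρ_ _).hom ≫ (λ_ _).hom ≫ e.hom) (by
        simp only [Category.assoc]
        rw [← Bicategory.whiskerLeft_comp_assoc, Iso.inv_hom_id]
        simp)
  obtain ⟨s, μ, hs, ⟨j₀, G₀, hG₀⟩, hsI, hsum⟩ := exists_eigenvector_oneMor k I F.src ⟨_, c, hcI⟩
  have hG₀I : ⟨F.src, j₀, G₀.obj, G₀.indecomposable⟩ ∈ I := by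
    by_contra h
    exact hG₀.ne' (hsI _ _ h)
  obtain ⟨Q, hQ⟩ := hI.exists_not_isZero hG₀I
  obtain ⟨d, hd⟩ := exists_indecClass_rankAt_ne_zero k hQ
  have : Nonempty (Σ i, IndecClass (M.obj i)) := ⟨⟨_, d⟩⟩
  obtain ⟨w, ν, hw, hν⟩ := M.exists_weight htransitive
  have key : ∀ {X Y : M.obj F.src} (f : X ⟶ Y),
      ∑ j, ∑ G : IndecClass (F.src ⟶ j), s j G * ∑ l, ∑ h : IndecClass (j ⟶ l),
          M.weight w ((M.act h.obj).map ((M.act G.obj).map f)) =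
        μ * ∑ j, ∑ G : IndecClass (F.src ⟶ j), s j G * M.weight w ((M.act G.obj).map f) := by
    intro X Y f
    have := hsum (fun j H => M.weight w ((M.act H).map f))
      (fun j => M.isAdditiveFunction_weight_act w f) ?_
    · simp only [weight_act_comp] at this
      exact this
    · rintro j H hH ⟨G, hG, hHG⟩
      have hz := hI.isZero_of_geJ hG hHG hH X
      exact Finset.sum_eq_zero fun c _ => by
        rw [rankAt_eq_zero_of_isZero_left k _ _ hz, Nat.cast_zero, mul_zero]
  -- Objects grow by exactly `ν`, and the weighted total at `Q` is positive because `G₀` has a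
  -- positive coefficient and does not kill `Q`.
  have hμν : μ = ν := by
    have h1 := key (𝟙 Q)
    simp only [CategoryTheory.Functor.map_id, hν] at h1
    have hpos : 0 < ∑ j, ∑ G : IndecClass (F.src ⟶ j),
        s j G * M.weight w (𝟙 ((M.act G.obj).obj Q)) :=
      Finset.sum_pos' (fun j _ => Finset.sum_nonneg fun G _ =>
          mul_nonneg (hs j G) (M.weight_nonneg hw _))
        ⟨j₀, Finset.mem_univ _, Finset.sum_pos' (fun G _ =>
          mul_nonneg (hs _ G) (M.weight_nonneg hw _))
          ⟨G₀, Finset.mem_univ _, mul_pos hG₀ (M.weight_pos hw hd)⟩⟩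
    refine mul_right_cancel₀ hpos.ne' (h1.symm.trans ?_)
    simp only [Finset.mul_sum]
    exact Finset.sum_congr rfl fun j _ => Finset.sum_congr rfl fun G _ => by ring
  subst hμν
  have hreg : ∀ {X Y : M.obj F.src} (f : X ⟶ Y), IsRegularHom ((M.act G₀.obj).map f) := by
    intro X Y f
    by_contra hcon
    have hle : ∀ j (G : IndecClass (F.src ⟶ j)),
        s j G * (μ * M.weight w ((M.act G.obj).map f)) ≤
          s j G * ∑ l, ∑ h : IndecClass (j ⟶ l),
            M.weight w ((M.act h.obj).map ((M.act G.obj).map f)) := fun j G =>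
      mul_le_mul_of_nonneg_left (M.weight_growth hsimple hw hν _).1 (hs j G)
    -- Each term grows by at least the factor `μ`; a non-regular value of `G₀` would make one term,
    -- and hence the total, grow strictly faster than `key` allows.
    refine absurd (key f) (ne_of_gt ?_)
    rw [Finset.mul_sum]
    simp only [Finset.mul_sum, mul_left_comm μ]
    simp only [← Finset.mul_sum]
    exact Finset.sum_lt_sum (fun j _ => Finset.sum_le_sum fun G _ => hle j G)
      ⟨j₀, Finset.mem_univ _, Finset.sum_lt_sum (fun G _ => hle _ G)
        ⟨G₀, Finset.mem_univ _,
          mul_lt_mul_of_pos_left ((M.weight_growth hsimple hw hν _).2 hcon) hG₀⟩⟩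
  obtain ⟨H₂, H₁, h⟩ := hI.1.geJ hF hG₀I
  obtain ⟨a, b, hab⟩ := h.exists_retract
  exact M.isRegularHom_act_of_retract a b hab (M.isRegularHom_act_comp _ _
    (M.isRegularHom_act_comp _ _ ((hreg _).map _)))

end FinitaryTwoRep

/-! ### Separability of semisimple algebras over algebraically closed fields -/

section Separable

variable (k : Type*) [Field k]

/-- A separability idempotent of `S`, in coordinates. -/
def IsSeparabilityPair {S : Type*} [Ring S] [Algebra k S] {τ : Type} [Fintype τ] (x y : τ → S) :
    Prop :=
  ∑ t, x t * y t = 1 ∧ ∀ a : S, ∑ t, (a * x t) ⊗ₜ[k] y t = ∑ t, x t ⊗ₜ[k] (y t * a)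

variable {k} in
theorem sum_mul_tmul_eq_sum_tmul_mul {S : Type*} [Ring S] [Algebra k S] {σ : Type} [Fintype σ]
    {κ : σ → Type} [∀ i, Fintype (κ i)] (x y : ∀ i, κ i → S) (a : S) (c : ∀ i, κ i → κ i → k)
    (hx : ∀ i j, a * x i j = ∑ p, c i p j • x i p)
    (hy : ∀ i j, y i j * a = ∑ q, c i j q • y i q) :
    ∑ t : Σ i, κ i, (a * x t.1 t.2) ⊗ₜ[k] y t.1 t.2 =
      ∑ t : Σ i, κ i, x t.1 t.2 ⊗ₜ[k] (y t.1 t.2 * a) := by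
  rw [Fintype.sum_sigma, Fintype.sum_sigma]
  refine Finset.sum_congr rfl fun i _ => ?_
  simp only [hx, hy]
  calc ∑ j, (∑ p, c i p j • x i p) ⊗ₜ[k] y i j
      = ∑ j, ∑ p, c i p j • (x i p ⊗ₜ[k] y i j) := by
        simp only [TensorProduct.sum_tmul, TensorProduct.smul_tmul']
    _ = ∑ p, ∑ j, c i p j • (x i p ⊗ₜ[k] y i j) := Finset.sum_comm
    _ = ∑ p, x i p ⊗ₜ[k] ∑ j, c i p j • y i j := by
        simp only [TensorProduct.tmul_sum, TensorProduct.tmul_smul]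

/-- In each factor the pairs are `E_{j0}` and `E_{0j}`. Left multiplication on the first column and
right multiplication on the first row have the same matrix coefficients, so they can be moved across
the tensor sign. -/
theorem exists_isSeparabilityPair_pi_matrix {n : ℕ} (d : Fin n → ℕ) [∀ i, NeZero (d i)] :
    ∃ (τ : Type) (_ : Fintype τ) (x y : τ → ∀ i, Matrix (Fin (d i)) (Fin (d i)) k),
      IsSeparabilityPair k x y := by
  refine ⟨Σ i, Fin (d i), inferInstance, fun t => Pi.single t.1 (Matrix.single t.2 0 1),
    fun t => Pi.single t.1 (Matrix.single 0 t.2 1), ?_, fun a => ?_⟩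
  · rw [Fintype.sum_sigma]
    simp only [← Pi.single_mul, Matrix.single_mul_single_same, mul_one]
    ext i p q
    simp only [Finset.sum_apply, Pi.one_apply]
    rw [Finset.sum_eq_single i]
    · simp only [Pi.single_eq_same, Matrix.sum_apply, Matrix.single_apply,
        Matrix.one_apply]
      by_cases h : p = q
      · subst h
        simp
      · rw [if_neg h]
        exact Finset.sum_eq_zero fun x _ => if_neg fun h' => h (h'.1.symm.trans h'.2)
    · intro j _ hj
      simp [Pi.single_eq_of_ne (Ne.symm hj)]
    · simp
  · let ι := LinearMap.single k fun i => Matrix (Fin (d i)) (Fin (d i)) k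
    have hx : ∀ i (j : Fin (d i)), a * ι i (Matrix.single j 0 1) =
        ∑ p, a i p j • ι i (Matrix.single p 0 1) := fun i j => by
      have h : a i * Matrix.single j 0 1 = ∑ p, a i p j • Matrix.single p 0 1 := by
        ext p q
        rw [Matrix.sum_apply, Finset.sum_eq_single p]
        · by_cases hq : q = 0 <;> simp [hq, Matrix.single_apply, Matrix.mul_apply, Ne.symm]
        · intro p' _ hp
          simp [hp]
        · simp
      rw [LinearMap.single_apply, ← Pi.single_mul_right, h]
      simp only [← map_smul, ← map_sum]
      rfl
    have hy : ∀ i (j : Fin (d i)), ι i (Matrix.single 0 j 1) * a =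
        ∑ q, a i j q • ι i (Matrix.single 0 q 1) := fun i j => by
      have h : Matrix.single 0 j 1 * a i = ∑ q, a i j q • Matrix.single 0 q 1 := by
        ext p q
        rw [Matrix.sum_apply, Finset.sum_eq_single q]
        · by_cases hp : p = 0 <;> simp [hp, Matrix.single_apply, Matrix.mul_apply]
          simp [Ne.symm hp]
        · intro p' _ hp
          simp [hp]
        · simp
      rw [LinearMap.single_apply, ← Pi.single_mul_left, h]
      simp only [← map_smul, ← map_sum]
      rfl
    exact sum_mul_tmul_eq_sum_tmul_mul (fun i j => ι i (Matrix.single j 0 1))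
      (fun i j => ι i (Matrix.single 0 j 1)) a (fun i => a i) hx hy

theorem exists_isSeparabilityPair [IsAlgClosed k] (S : Type*) [Ring S] [Algebra k S]
    [Module.Finite k S] [IsSemisimpleRing S] :
    ∃ (τ : Type) (_ : Fintype τ) (x y : τ → S), IsSeparabilityPair k x y := by
  obtain ⟨n, d, hd, ⟨e⟩⟩ := IsSemisimpleRing.exists_algEquiv_pi_matrix_of_isAlgClosed k S
  obtain ⟨τ, hτ, x, y, h1, h2⟩ := exists_isSeparabilityPair_pi_matrix k d
  refine ⟨τ, hτ, fun t => e.symm (x t), fun t => e.symm (y t), ?_, fun a => ?_⟩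
  · simp only [← map_mul, ← map_sum, h1, map_one]
  · have := congrArg (TensorProduct.map e.symm.toLinearMap e.symm.toLinearMap) (h2 (e a))
    simpa [map_sum] using this

end Separable

/-! ### Lifting projective modules along nilpotent ideals -/

section Lifting

variable {R : Type*} [Ring R] {J : Ideal R}

theorem Submodule.eq_bot_of_le_smul_of_isNilpotent {M : Type*} [AddCommGroup M] [Module R M]
    (hJ : IsNilpotent J) {K : Submodule R M} (h : K ≤ J • K) : K = ⊥ := by
  obtain ⟨n, hn⟩ := hJ
  have : ∀ m : ℕ, K ≤ J ^ m • K := fun m => by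
    induction m with
    | zero => rw [Submodule.pow_zero, Ideal.one_eq_top, Submodule.top_smul]
    | succ m ih =>
      calc K ≤ J ^ m • K := ih
        _ ≤ J ^ m • (J • K) := Submodule.smul_mono le_rfl h
        _ = _ := by rw [← Submodule.mul_smul, Submodule.pow_succ]
  have h1 := this n
  rw [hn, Ideal.zero_eq_bot, Submodule.bot_smul] at h1
  exact le_bot_iff.1 h1

theorem Submodule.eq_top_of_sup_smul_eq_top_of_isNilpotent {M : Type*} [AddCommGroup M]
    [Module R M] (hJ : IsNilpotent J) {L : Submodule R M}
    (h : L ⊔ J • (⊤ : Submodule R M) = ⊤) : L = ⊤ := by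
  obtain ⟨n, hn⟩ := hJ
  have : ∀ m : ℕ, L ⊔ J ^ m • (⊤ : Submodule R M) = ⊤ := fun m => by
    induction m with
    | zero => rw [Submodule.pow_zero, Ideal.one_eq_top, Submodule.top_smul, sup_top_eq]
    | succ m ih =>
      refine eq_top_iff.2 (ih.ge.trans (sup_le le_sup_left ?_))
      calc J ^ m • (⊤ : Submodule R M) = J ^ m • (L ⊔ J • ⊤) := by rw [h]
        _ = J ^ m • L ⊔ J ^ (m + 1) • ⊤ := by
          rw [Submodule.smul_sup, ← Submodule.mul_smul, Submodule.pow_succ]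
        _ ≤ _ := sup_le_sup_right Submodule.smul_le_right _
  have h1 := this n
  rwa [hn, Ideal.zero_eq_bot, Submodule.bot_smul, sup_bot_eq] at h1

variable (J) in
/-- The reduction modulo `J` of a linear map. -/
def LinearMap.redMod {M M' : Type*} [AddCommGroup M] [Module R M] [AddCommGroup M'] [Module R M']
    (f : M →ₗ[R] M') :
    (M ⧸ J • (⊤ : Submodule R M)) →ₗ[R] M' ⧸ J • (⊤ : Submodule R M') :=
  Submodule.mapQ _ _ f (by
    rw [← Submodule.map_le_iff_le_comap, Submodule.map_smul'']
    exact Submodule.smul_mono le_rfl le_top)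

variable (J) in
/-- The reduction modulo `J` of endomorphisms. -/
def endRedMod (M : Type*) [AddCommGroup M] [Module R M] :
    Module.End R M →+* Module.End R (M ⧸ J • (⊤ : Submodule R M)) where
  toFun f := LinearMap.redMod J f
  map_one' := by ext; rfl
  map_mul' f g := by ext; rfl
  map_zero' := by ext; rfl
  map_add' f g := by ext; rfl

/-- If `P / J P` is a summand of `F / J F` with `F` projective and `J` nilpotent, then there is a
projective module that covers `P` with kernel contained in the multiples of `J`. -/
theorem exists_projective_cover_mod_nilpotent [J.IsTwoSided] (hJ : IsNilpotent J) {F P : Type*}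
    [AddCommGroup F] [Module R F] [Module.Projective R F] [AddCommGroup P] [Module R P]
    (π : F →ₗ[R] P) (hπ : Function.Surjective π)
    (s : (P ⧸ J • (⊤ : Submodule R P)) →ₗ[R] F ⧸ J • (⊤ : Submodule R F))
    (hs : LinearMap.redMod J π ∘ₗ s = LinearMap.id) :
    ∃ (L : Submodule R F), Module.Projective R L ∧ Function.Surjective (π ∘ₗ L.subtype) ∧
      LinearMap.ker (π ∘ₗ L.subtype) ≤ J • ⊤ := by
  -- An endomorphism that vanishes modulo `J` maps `F` into `J F`, so its `m`-th power maps `F` into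
  -- `J ^ m F`. This is what permits lifting idempotents.
  have hker : ∀ f ∈ RingHom.ker (endRedMod J F), IsNilpotent f := by
    intro f hf
    obtain ⟨n, hn⟩ := hJ
    have h1 : LinearMap.range f ≤ J • ⊤ := by
      rintro _ ⟨x, rfl⟩
      have := LinearMap.congr_fun hf (Submodule.Quotient.mk x)
      exact (Submodule.Quotient.mk_eq_zero _).1 this
    have h2 : ∀ m : ℕ, LinearMap.range (f ^ m) ≤ J ^ m • (⊤ : Submodule R F) := fun m => by
      induction m with
      | zero => rw [pow_zero, Submodule.pow_zero, Ideal.one_eq_top, Submodule.top_smul]; exact le_top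
      | succ m ih =>
        have : LinearMap.range (f ^ (m + 1)) = (LinearMap.range f).map (f ^ m) := by
          rw [← LinearMap.range_comp]; rfl
        rw [this]
        calc (LinearMap.range f).map (f ^ m) ≤ (J • ⊤ : Submodule R F).map (f ^ m) :=
              Submodule.map_mono h1
          _ = J • LinearMap.range (f ^ m) := by rw [Submodule.map_smul'', LinearMap.range_eq_map]
          _ ≤ J • J ^ m • ⊤ := Submodule.smul_mono le_rfl ih
          _ = _ := by rw [← Submodule.mul_smul, Ideal.IsTwoSided.pow_succ]
    refine ⟨n, LinearMap.range_eq_bot.1 ?_⟩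
    have := h2 n
    rw [hn, Ideal.zero_eq_bot, Submodule.bot_smul] at this
    exact le_bot_iff.1 this
  -- The section exhibits `P / J P` as the image of this idempotent of `F / J F`; the image of a
  -- lift to `End F` is the required projective module.
  have hidem : IsIdempotentElem (s ∘ₗ LinearMap.redMod J π : Module.End R _) := by
    refine LinearMap.ext fun x => ?_
    exact congrArg s (LinearMap.congr_fun hs (LinearMap.redMod J π x))
  obtain ⟨f₀, hf₀⟩ := Module.projective_lifting_property
    (Submodule.mkQ (J • (⊤ : Submodule R F)))
    ((s ∘ₗ LinearMap.redMod J π) ∘ₗ Submodule.mkQ (J • (⊤ : Submodule R F)))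
    (Submodule.mkQ_surjective _)
  obtain ⟨e, he, hes⟩ := exists_isIdempotentElem_eq_of_ker_isNilpotent (endRedMod J F) hker
    (s ∘ₗ LinearMap.redMod J π) ⟨f₀, by
      ext x
      exact LinearMap.congr_fun hf₀ x⟩ hidem
  have hee : ∀ x, e (e x) = e x := fun x => LinearMap.congr_fun he x
  have hes' : ∀ x : F, (Submodule.Quotient.mk (e x) : F ⧸ J • (⊤ : Submodule R F)) =
      s (Submodule.Quotient.mk (π x)) := fun x =>
    LinearMap.congr_fun hes (Submodule.Quotient.mk x)
  have hs' : ∀ x : F, LinearMap.redMod J π (s (Submodule.Quotient.mk (π x))) =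
      Submodule.Quotient.mk (π x) := fun x => LinearMap.congr_fun hs _
  have hsplit : e.rangeRestrict ∘ₗ (LinearMap.range e).subtype = LinearMap.id := by
    ext ⟨_, x, rfl⟩
    exact hee x
  refine ⟨LinearMap.range e, Module.Projective.of_split _ _ hsplit, ?_, ?_⟩
  · rw [← LinearMap.range_eq_top]
    refine Submodule.eq_top_of_sup_smul_eq_top_of_isNilpotent hJ (eq_top_iff.2 fun p _ => ?_)
    obtain ⟨x, rfl⟩ := hπ p
    have h1 : π x - π (e x) ∈ J • (⊤ : Submodule R P) := by
      rw [← Submodule.Quotient.eq, ← hs', ← hes']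
      rfl
    exact Submodule.mem_sup.2 ⟨π (e x), ⟨⟨e x, x, rfl⟩, rfl⟩, _, h1, add_sub_cancel _ _⟩
  · rintro ⟨_, x, rfl⟩ hy
    have hy' : π (e x) = 0 := hy
    have h1 : (Submodule.Quotient.mk (e x) : F ⧸ J • (⊤ : Submodule R F)) = 0 := by
      rw [← hee x, hes', hy', Submodule.Quotient.mk_zero, map_zero]
    have h2 : e x ∈ J • (⊤ : Submodule R F) := (Submodule.Quotient.mk_eq_zero _).1 h1
    have h3 := Submodule.mem_map_of_mem (f := e.rangeRestrict) h2
    rw [Submodule.map_smul''] at h3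
    have h4 : e.rangeRestrict (e x) = ⟨e x, x, rfl⟩ := Subtype.ext (hee x)
    rw [h4] at h3
    exact Submodule.smul_mono le_rfl le_top h3

end Lifting

/-! ### Projectivity of bimodules -/

section Enveloping

variable {k : Type u} [Field k] {A B : Type v} [Ring A] [Ring B] [Algebra k A] [Algebra k B]

variable (k A) in
/-- Left multiplication by `b`, as an element of `B ⊗ Aᵒᵖ`. -/
def envL (b : B) : B ⊗[k] Aᵐᵒᵖ := b ⊗ₜ 1

variable (k B) in
/-- Right multiplication by `a`, as an element of `B ⊗ Aᵒᵖ`. -/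
def envR (a : A) : B ⊗[k] Aᵐᵒᵖ := 1 ⊗ₜ MulOpposite.op a

theorem envL_mul_envR (b : B) (a : A) :
    envL k A b * envR k B a = b ⊗ₜ MulOpposite.op a := by
  simp [envL, envR]

theorem envR_mul_envL (b : B) (a : A) :
    envR k B a * envL k A b = b ⊗ₜ MulOpposite.op a := by
  simp [envL, envR]

theorem envR_mul (a a' : A) : envR k B (a * a') = envR k B a' * envR k B a := by
  simp [envR]

theorem envR_add (a a' : A) : envR k B (a + a') = envR k B a + envR k B a' := by
  simp [envR, TensorProduct.tmul_add]

theorem envR_zero : envR k B (0 : A) = 0 := by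
  simp [envR]

theorem envR_one : envR k B (1 : A) = 1 := rfl

theorem envR_sub (a a' : A) : envR k B (a - a') = envR k B a - envR k B a' := by
  simp [envR, TensorProduct.tmul_sub]

theorem envR_sum {τ : Type*} (s : Finset τ) (a : τ → A) :
    envR k B (∑ t ∈ s, a t) = ∑ t ∈ s, envR k B (a t) := by
  simp [envR, TensorProduct.tmul_sum]

theorem envR_smul (r : k) (a : A) :
    envR k B (r • a) = envL k A (algebraMap k B r) * envR k B a := by
  rw [envL_mul_envR, envR, Algebra.algebraMap_eq_smul_one, TensorProduct.smul_tmul,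
    MulOpposite.op_smul]

variable (k B) in
/-- The ideal of `B ⊗ Aᵒᵖ` that is generated by right multiplications with elements of `N`. -/
def envIdeal (N : Ideal A) : Ideal (B ⊗[k] Aᵐᵒᵖ) := Ideal.span (envR k B '' N)

theorem envR_mem_envIdeal {N : Ideal A} {n : A} (hn : n ∈ N) : envR k B n ∈ envIdeal k B N :=
  Ideal.subset_span ⟨n, hn, rfl⟩

/-- Being a left ideal of `A` suffices: right multiplications compose in the opposite order, and
left multiplications by `B` commute with them. -/
instance (N : Ideal A) : (envIdeal k B N).IsTwoSided where
  mul_mem_of_left {x} y hx := by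
    induction hx using Submodule.span_induction with
    | mem x hx =>
      obtain ⟨n, hn, rfl⟩ := hx
      induction y using TensorProduct.induction_on with
      | zero => simp
      | tmul b a =>
        obtain ⟨a, rfl⟩ := MulOpposite.op_surjective a
        rw [← envR_mul_envL, ← mul_assoc, ← envR_mul, envR_mul_envL, ← envL_mul_envR]
        exact Ideal.mul_mem_left _ _ (envR_mem_envIdeal (N.mul_mem_left _ hn))
      | add y z hy hz => rw [mul_add]; exact add_mem hy hz
    | zero => simp
    | add x z _ _ hx hz => rw [add_mul]; exact add_mem hx hz
    | smul c x _ hx => rw [smul_eq_mul, mul_assoc]; exact Ideal.mul_mem_left _ _ hx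

theorem envIdeal_pow_le (N : Ideal A) (m : ℕ) : envIdeal k B N ^ m ≤ envIdeal k B (N ^ m) := by
  induction m with
  | zero =>
    rw [Submodule.pow_zero, Submodule.pow_zero, Ideal.one_eq_top, Ideal.one_eq_top]
    have h : envIdeal k B (⊤ : Ideal A) = ⊤ :=
      (Ideal.eq_top_iff_one _).2 (envR_mem_envIdeal (n := (1 : A)) Submodule.mem_top)
    rw [h]
  | succ m ih =>
    rw [Ideal.IsTwoSided.pow_succ]
    refine (Ideal.mul_mono_right ih).trans (Ideal.mul_le.2 fun r hr s hs => ?_)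
    induction hs using Submodule.span_induction generalizing r with
    | mem s hs =>
      obtain ⟨n', hn', rfl⟩ := hs
      induction hr using Submodule.span_induction with
      | mem r hr =>
        obtain ⟨n, hn, rfl⟩ := hr
        rw [← envR_mul, Submodule.pow_succ]
        exact envR_mem_envIdeal (Ideal.mul_mem_mul hn' hn)
      | zero => simp
      | add x z _ _ hx hz => rw [add_mul]; exact add_mem hx hz
      | smul c x _ hx => rw [smul_eq_mul, mul_assoc]; exact Ideal.mul_mem_left _ _ hx
    | zero => simp
    | add x z _ _ hx hz => rw [mul_add]; exact add_mem (hx r hr) (hz r hr)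
    | smul c x _ hx =>
      rw [smul_eq_mul, ← mul_assoc]
      exact hx _ (Ideal.mul_mem_right _ _ hr)

theorem isNilpotent_envIdeal {N : Ideal A} (hN : IsNilpotent N) :
    IsNilpotent (envIdeal k B N) := by
  obtain ⟨m, hm⟩ := hN
  refine ⟨m, le_bot_iff.1 ((envIdeal_pow_le N m).trans ?_)⟩
  rw [hm, envIdeal, Ideal.span_le]
  rintro _ ⟨n, hn, rfl⟩
  rw [Ideal.zero_eq_bot, SetLike.mem_coe, Ideal.mem_bot] at hn
  rw [hn, envR_zero]
  exact zero_mem _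

/-- Two-sidedness of `N` lets a right multiplication by `a'` be absorbed into `N`. Rewriting the
result by the left generators `n i` then puts each `envR (n i)` in the outermost position. -/
theorem exists_eq_sum_envR_mul_of_mem_envIdeal {m : ℕ} (n : Fin m → A) {N : Ideal A}
    [N.IsTwoSided] (hn : Ideal.span (Set.range n) = N) {r : B ⊗[k] Aᵐᵒᵖ}
    (hr : r ∈ envIdeal k B N) : ∃ c : Fin m → B ⊗[k] Aᵐᵒᵖ, r = ∑ i, envR k B (n i) * c i := by
  have key : ∀ (y : B ⊗[k] Aᵐᵒᵖ) (a : A), a ∈ N →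
      ∃ c : Fin m → B ⊗[k] Aᵐᵒᵖ, y * envR k B a = ∑ i, envR k B (n i) * c i := by
    intro y a ha
    induction y using TensorProduct.induction_on with
    | zero => exact ⟨0, by simp⟩
    | tmul b a' =>
      obtain ⟨a', rfl⟩ := MulOpposite.op_surjective a'
      have h := N.mul_mem_right a' ha
      rw [← hn, Ideal.span, Submodule.mem_span_range_iff_exists_fun] at h
      obtain ⟨c, hc⟩ := h
      refine ⟨fun i => envR k B (c i) * envL k A b, ?_⟩
      rw [← envL_mul_envR, mul_assoc, ← envR_mul, ← hc, envL_mul_envR, ← envR_mul_envL, envR_sum,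
        Finset.sum_mul]
      refine Finset.sum_congr rfl fun i _ => ?_
      rw [smul_eq_mul, envR_mul, mul_assoc]
    | add y z hy hz =>
      obtain ⟨c, hc⟩ := hy
      obtain ⟨d, hd⟩ := hz
      exact ⟨c + d, by rw [add_mul, hc, hd]; simp [mul_add, Finset.sum_add_distrib]⟩
  induction hr using Submodule.span_induction with
  | mem r hr =>
    obtain ⟨a, ha, rfl⟩ := hr
    simpa using key 1 a ha
  | zero => exact ⟨0, by simp⟩
  | add y z _ _ hy hz =>
    obtain ⟨c, hc⟩ := hy
    obtain ⟨d, hd⟩ := hz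
    exact ⟨c + d, by rw [hc, hd]; simp [mul_add, Finset.sum_add_distrib]⟩
  | smul y r _ hr =>
    obtain ⟨c, rfl⟩ := hr
    choose d hd using fun i => key y (n i) (hn ▸ Ideal.subset_span ⟨i, rfl⟩)
    refine ⟨fun j => ∑ i, d i j * c i, ?_⟩
    simp only [smul_eq_mul, Finset.mul_sum, ← mul_assoc, hd, Finset.sum_mul]
    rw [Finset.sum_comm]

variable {P : Type*} [AddCommGroup P] [Module (B ⊗[k] Aᵐᵒᵖ) P]

theorem exists_eq_sum_envR_smul_of_mem_smul {m : ℕ} (n : Fin m → A) {N : Ideal A}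
    [N.IsTwoSided] (hn : Ideal.span (Set.range n) = N) (K : Submodule (B ⊗[k] Aᵐᵒᵖ) P) {x : P}
    (hx : x ∈ envIdeal k B N • K) :
    ∃ p : Fin m → P, (∀ i, p i ∈ K) ∧ x = ∑ i, envR k B (n i) • p i := by
  induction hx using Submodule.smul_induction_on' with
  | smul r hr p hp =>
    obtain ⟨c, rfl⟩ := exists_eq_sum_envR_mul_of_mem_envIdeal n hn hr
    exact ⟨fun i => c i • p, fun i => K.smul_mem _ hp, by simp [Finset.sum_smul, mul_smul]⟩
  | add x _ y _ hx hy =>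
    obtain ⟨p, hp, rfl⟩ := hx
    obtain ⟨q, hq, rfl⟩ := hy
    exact ⟨p + q, fun i => K.add_mem (hp i) (hq i), by simp [Finset.sum_add_distrib]⟩

/-- If `K` is the kernel of a surjection `L ⟶ P`, and relations over `n` in `P` are consequences
of relations in `A`, then `K ∩ L N ⊆ K N`. -/
theorem ker_le_envIdeal_smul_ker {L : Type*} [AddCommGroup L] [Module (B ⊗[k] Aᵐᵒᵖ) L]
    (φ : L →ₗ[B ⊗[k] Aᵐᵒᵖ] P) (hφ : Function.Surjective φ) {m l : ℕ} (n : Fin m → A)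
    {N : Ideal A} [N.IsTwoSided] (hn : Ideal.span (Set.range n) = N) (a : Fin l → Fin m → A)
    (ha : ∀ j, ∑ i, a j i * n i = 0)
    (hflat : ∀ p : Fin m → P, ∑ i, envR k B (n i) • p i = 0 →
      ∃ q : Fin l → P, ∀ i, p i = ∑ j, envR k B (a j i) • q j)
    (hker : LinearMap.ker φ ≤ envIdeal k B N • ⊤) :
    LinearMap.ker φ ≤ envIdeal k B N • LinearMap.ker φ := by
  intro x hx
  obtain ⟨y, -, rfl⟩ := exists_eq_sum_envR_smul_of_mem_smul n hn ⊤ (hker hx)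
  obtain ⟨q, hq⟩ := hflat (fun i => φ (y i)) (by simpa using hx)
  -- The relation among the `φ (y i)` comes from relations in `A`. Lifting its witnesses to `L`
  -- gives a correction that contributes nothing to the sum but moves each `y i` into the kernel.
  choose z hz using fun j => hφ (q j)
  have hz0 : ∑ i, envR k B (n i) • ∑ j, envR k B (a j i) • z j = 0 := by
    simp only [Finset.smul_sum, ← mul_smul, ← envR_mul]
    rw [Finset.sum_comm]
    simp only [← Finset.sum_smul, ← envR_sum, ha, envR_zero]
    exact Finset.sum_eq_zero fun j _ => zero_smul (B ⊗[k] Aᵐᵒᵖ) (z j)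
  have : ∑ i, envR k B (n i) • y i =
      ∑ i, envR k B (n i) • (y i - ∑ j, envR k B (a j i) • z j) := by
    simp only [smul_sub, Finset.sum_sub_distrib, hz0, sub_zero]
  rw [this]
  refine Submodule.sum_mem _ fun i _ => Submodule.smul_mem_smul
    (envR_mem_envIdeal (hn ▸ Ideal.subset_span ⟨i, rfl⟩)) ?_
  rw [LinearMap.mem_ker, map_sub, map_sum, hq, sub_eq_zero]
  simp only [map_smul, hz]

end Enveloping

/-! ### Averaging over a separability idempotent modulo the radical -/

section Averaging

variable {k : Type u} [Field k] {A B : Type v} [Ring A] [Ring B] [Algebra k A] [Algebra k B]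

/-- A balanced biadditive map which vanishes on `N` in both variables is invariant along the lift
of a separability idempotent of `A / N`. -/
theorem sum_eq_sum_of_isSeparabilityPair {N : Ideal A} [N.IsTwoSided] {X : Type*} [AddCommGroup X]
    (T : A →+ A →+ X) (hT : ∀ (r : k) a a', T (r • a) a' = T a (r • a'))
    (hl : ∀ a ∈ N, ∀ a', T a a' = 0) (hr : ∀ a, ∀ a' ∈ N, T a a' = 0)
    {τ : Type} [Fintype τ] (x y : τ → A)
    (hxy : IsSeparabilityPair k (fun t => Ideal.Quotient.mk N (x t))
      fun t => Ideal.Quotient.mk N (y t)) (a : A) :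
    ∑ t, T (a * x t) (y t) = ∑ t, T (x t) (y t * a) := by
  have hl' : ∀ a b a', Ideal.Quotient.mk N a = Ideal.Quotient.mk N b → T a a' = T b a' :=
    fun a b a' h => by
      rw [← sub_eq_zero, ← AddMonoidHom.sub_apply, ← map_sub]
      exact hl _ (Ideal.Quotient.eq.1 h) _
  have hr' : ∀ a b b', Ideal.Quotient.mk N b = Ideal.Quotient.mk N b' → T a b = T a b' :=
    fun a b b' h => by
      rw [← sub_eq_zero, ← map_sub]
      exact hr _ _ (Ideal.Quotient.eq.1 h)
  -- Since `T` vanishes on `N` in both variables, any set-theoretic section makes it descend to an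
  -- additive balanced map on the quotient, where the separability identity holds.
  let q : A ⧸ N → A := Function.surjInv Ideal.Quotient.mk_surjective
  have hq : ∀ s, Ideal.Quotient.mk N (q s) = s := Function.surjInv_eq _
  let T' : A ⧸ N →+ A ⧸ N →+ X := AddMonoidHom.mk' (fun s => AddMonoidHom.mk'
      (fun s' => T (q s) (q s'))
      (fun a b => by rw [← map_add]; exact hr' _ _ _ (by simp [hq])))
    (fun a b => AddMonoidHom.ext fun s' => by
      change T (q (a + b)) (q s') = T (q a) (q s') + T (q b) (q s')
      rw [← AddMonoidHom.add_apply, ← map_add]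
      exact hl' _ _ _ (by simp [hq]))
  have hT' : ∀ a b, T' (Ideal.Quotient.mk N a) (Ideal.Quotient.mk N b) = T a b := fun a b =>
    (hl' _ a _ (hq _)).trans (hr' _ _ b (hq _))
  let Φ : (A ⧸ N) ⊗[k] (A ⧸ N) →+ X := TensorProduct.liftAddHom T' (fun r s s' => by
    obtain ⟨s, rfl⟩ := Ideal.Quotient.mk_surjective s
    obtain ⟨s', rfl⟩ := Ideal.Quotient.mk_surjective s'
    exact (hT' (r • s) s').trans ((hT r s s').trans (hT' s (r • s')).symm))
  have h := congrArg Φ (hxy.2 (Ideal.Quotient.mk N a))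
  simp only [map_sum, Φ, TensorProduct.liftAddHom_tmul, ← map_mul, hT'] at h
  exact h

variable {P : Type*} [AddCommGroup P] [Module (B ⊗[k] Aᵐᵒᵖ) P]
  {Q : Type*} [AddCommGroup Q] [Module (B ⊗[k] Aᵐᵒᵖ) Q]

/-- A left linear map, averaged over a separability idempotent modulo `N`, is a bimodule map. -/
theorem exists_linearMap_of_isSeparabilityPair {N : Ideal A} [N.IsTwoSided]
    (σ : P →+ Q) (hσ : ∀ (b : B) p, σ (envL k A b • p) = envL k A b • σ p)
    (hP : ∀ a ∈ N, ∀ p, σ (envR k B a • p) = 0) (hQ : ∀ a ∈ N, ∀ q : Q, envR k B a • q = 0)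
    {τ : Type} [Fintype τ] (x y : τ → A)
    (hxy : IsSeparabilityPair k (fun t => Ideal.Quotient.mk N (x t))
      fun t => Ideal.Quotient.mk N (y t)) :
    ∃ s : P →ₗ[B ⊗[k] Aᵐᵒᵖ] Q, ∀ p, s p = ∑ t, envR k B (y t) • σ (envR k B (x t) • p) := by
  let s : P →+ Q := AddMonoidHom.mk' (fun p => ∑ t, envR k B (y t) • σ (envR k B (x t) • p))
    (fun p p' => by simp [smul_add, Finset.sum_add_distrib])
  have hL : ∀ (b : B) p, s (envL k A b • p) = envL k A b • s p := fun b p => by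
    change ∑ t, _ = envL k A b • ∑ t, _
    rw [Finset.smul_sum]
    refine Finset.sum_congr rfl fun t _ => ?_
    rw [← mul_smul, envR_mul_envL, ← envL_mul_envR, mul_smul, hσ, ← mul_smul, ← mul_smul,
      envR_mul_envL, envL_mul_envR]
  have hR : ∀ (a : A) p, s (envR k B a • p) = envR k B a • s p := fun a p => by
    change ∑ t, _ = envR k B a • ∑ t, _
    rw [Finset.smul_sum]
    let T : A →+ A →+ Q := AddMonoidHom.mk' (fun a => AddMonoidHom.mk'
        (fun a' => envR k B a' • σ (envR k B a • p))
        (fun a' a'' => by rw [envR_add, add_smul]))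
      (fun a a' => AddMonoidHom.ext fun a'' => by
        change envR k B a'' • σ (envR k B (a + a') • p) =
          envR k B a'' • σ (envR k B a • p) + envR k B a'' • σ (envR k B a' • p)
        rw [envR_add, add_smul, map_add, smul_add])
    have := sum_eq_sum_of_isSeparabilityPair T (fun r a a' => by
      change envR k B a' • σ (envR k B (r • a) • p) = envR k B (r • a') • σ (envR k B a • p)
      rw [envR_smul, mul_smul, hσ, envR_smul, envL_mul_envR, ← mul_smul, envR_mul_envL])
      (fun a ha a' => by
        change envR k B a' • σ (envR k B a • p) = 0
        rw [hP a ha, smul_zero]) (fun a a' ha' => hQ a' ha' _) x y hxy a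
    refine Eq.trans ?_ (this.trans ?_)
    · refine Finset.sum_congr rfl fun t _ => ?_
      change _ = envR k B (y t) • σ (envR k B (a * x t) • p)
      rw [envR_mul, mul_smul]
    · refine Finset.sum_congr rfl fun t _ => ?_
      change envR k B (y t * a) • σ (envR k B (x t) • p) = _
      rw [envR_mul, mul_smul]
  refine ⟨{ s with map_smul' := fun c p => ?_ }, fun p => rfl⟩
  change s (c • p) = c • s p
  induction c using TensorProduct.induction_on with
  | zero =>
    exact (congrArg s (zero_smul (B ⊗[k] Aᵐᵒᵖ) p)).trans
      ((map_zero s).trans (zero_smul (B ⊗[k] Aᵐᵒᵖ) (s p)).symm)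
  | tmul b a =>
    obtain ⟨a, rfl⟩ := MulOpposite.op_surjective a
    rw [← envL_mul_envR, mul_smul, mul_smul, hL, hR]
  | add c c' h h' => rw [add_smul, add_smul, map_add, h, h']

theorem exists_projective_surjection (R M : Type v) [Ring R] [AddCommGroup M] [Module R M] :
    ∃ (F : Type v) (_ : AddCommGroup F) (_ : Module R F) (_ : Module.Projective R F)
      (π : F →ₗ[R] M), Function.Surjective π :=
  ⟨M →₀ R, inferInstance, inferInstance, inferInstance, Finsupp.linearCombination R id,
    Finsupp.linearCombination_id_surjective R M⟩

/-- A criterion for a bimodule to be projective. -/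
theorem projective_of_radical_conditions [IsAlgClosed k] [Module.Finite k A] {P : Type v}
    [AddCommGroup P] [Module (B ⊗[k] Aᵐᵒᵖ) P]
    {m : ℕ} (n : Fin m → A) (hn : Ideal.span (Set.range n) = Ring.jacobson A)
    (hsec : ∀ (F : Type v) [AddCommGroup F] [Module (B ⊗[k] Aᵐᵒᵖ) F]
      (π : F →ₗ[B ⊗[k] Aᵐᵒᵖ] P), Function.Surjective π → ∃ σ : P →+ F,
        (∀ (b : B) p, σ (envL k A b • p) = envL k A b • σ p) ∧ ∀ p, π (σ p) = p)
    (r : P →+ P) (hr : ∀ (b : B) p, r (envL k A b • p) = envL k A b • r p)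
    (hr0 : ∀ a ∈ Ring.jacobson A, ∀ p, r (envR k B a • p) = 0)
    (hr1 : ∀ p, r p - p ∈ envIdeal k B (Ring.jacobson A) • (⊤ : Submodule (B ⊗[k] Aᵐᵒᵖ) P))
    {l : ℕ} (a : Fin l → Fin m → A) (ha : ∀ j, ∑ i, a j i * n i = 0)
    (hflat : ∀ p : Fin m → P, ∑ i, envR k B (n i) • p i = 0 →
      ∃ q : Fin l → P, ∀ i, p i = ∑ j, envR k B (a j i) • q j) :
    Module.Projective (B ⊗[k] Aᵐᵒᵖ) P := by
  have : IsArtinianRing A := IsArtinianRing.of_finite k A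
  set J := envIdeal k B (Ring.jacobson A) with hJdef
  have hJ : IsNilpotent J := isNilpotent_envIdeal IsSemiprimaryRing.isNilpotent
  obtain ⟨τ, _, x', y', hxy'⟩ := exists_isSeparabilityPair k (A ⧸ Ring.jacobson A)
  choose x hx using fun t => Ideal.Quotient.mk_surjective (x' t)
  choose y hy using fun t => Ideal.Quotient.mk_surjective (y' t)
  have hxy : IsSeparabilityPair k (fun t => Ideal.Quotient.mk (Ring.jacobson A) (x t))
      fun t => Ideal.Quotient.mk (Ring.jacobson A) (y t) := by
    simpa only [hx, hy] using hxy'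
  obtain ⟨F, _, _, _, π, hπ⟩ := exists_projective_surjection (B ⊗[k] Aᵐᵒᵖ) P
  obtain ⟨σ₀, hσ₀, hσ₀π⟩ := hsec F π hπ
  let Q := F ⧸ J • (⊤ : Submodule (B ⊗[k] Aᵐᵒᵖ) F)
  -- Composition with `r` makes the left linear section vanish on `P N`, as averaging needs; `r` is
  -- the identity modulo `P N`, so nothing is lost after reduction.
  let σ : P →+ Q := ((Submodule.mkQ (J • (⊤ : Submodule (B ⊗[k] Aᵐᵒᵖ) F))).toAddMonoidHom.comp
    σ₀).comp r
  have hσ : ∀ p, σ p = Submodule.Quotient.mk (σ₀ (r p)) := fun p => rfl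
  obtain ⟨s, hs⟩ := exists_linearMap_of_isSeparabilityPair σ (fun b p => by
      rw [hσ, hσ, hr, hσ₀, Submodule.Quotient.mk_smul])
    (fun a ha p => by rw [hσ, hr0 a ha, map_zero, Submodule.Quotient.mk_zero])
    (fun a ha q => by
      obtain ⟨q, rfl⟩ := Submodule.Quotient.mk_surjective _ q
      rw [← Submodule.Quotient.mk_smul, Submodule.Quotient.mk_eq_zero]
      exact Submodule.smul_mem_smul (envR_mem_envIdeal ha) trivial) x y hxy
  let s' : (P ⧸ J • (⊤ : Submodule (B ⊗[k] Aᵐᵒᵖ) P)) →ₗ[B ⊗[k] Aᵐᵒᵖ] Q :=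
    Submodule.liftQ _ s (Submodule.smul_le.2 fun c hc p _ => by
      rw [LinearMap.mem_ker, map_smul]
      obtain ⟨q, hq⟩ := Submodule.Quotient.mk_surjective _ (s p)
      rw [← hq, ← Submodule.Quotient.mk_smul, Submodule.Quotient.mk_eq_zero]
      exact Submodule.smul_mem_smul hc trivial)
  have hs' : LinearMap.redMod J π ∘ₗ s' = LinearMap.id := by
    refine LinearMap.ext fun p => ?_
    obtain ⟨p, rfl⟩ := Submodule.Quotient.mk_surjective _ p
    change LinearMap.redMod J π (s p) = Submodule.Quotient.mk p
    have h1 : ∀ t, LinearMap.redMod J π (σ (envR k B (x t) • p)) =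
        Submodule.Quotient.mk (envR k B (x t) • p) := fun t => by
      rw [hσ]
      change Submodule.Quotient.mk (π _) = _
      rw [hσ₀π, Submodule.Quotient.eq]
      exact hr1 _
    rw [hs, map_sum]
    simp only [map_smul, h1, ← Submodule.Quotient.mk_smul, ← mul_smul, ← envR_mul]
    rw [← Submodule.mkQ_apply]
    simp only [← Submodule.mkQ_apply, ← map_sum]
    rw [← Finset.sum_smul, ← envR_sum, Submodule.mkQ_apply, Submodule.mkQ_apply,
      Submodule.Quotient.eq]
    -- After reduction the composite is right multiplication by `∑ x t * y t`, which is congruent to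
    -- 1 modulo the radical.
    have h2 : ∑ t, x t * y t - 1 ∈ Ring.jacobson A := by
      rw [← Ideal.Quotient.eq, map_sum, map_one]
      simpa only [map_mul] using hxy.1
    have h3 : envR k B (∑ t, x t * y t) • p - p = envR k B (∑ t, x t * y t - 1) • p := by
      rw [envR_sub, sub_smul, envR_one, one_smul]
    rw [h3]
    exact Submodule.smul_mem_smul (envR_mem_envIdeal h2) trivial
  obtain ⟨L, hL, hsurj, hker⟩ := exists_projective_cover_mod_nilpotent hJ π hπ s' hs'
  have hbot := Submodule.eq_bot_of_le_smul_of_isNilpotent hJ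
    (ker_le_envIdeal_smul_ker _ hsurj n hn a ha hflat hker)
  exact Module.Projective.of_equiv
    (LinearEquiv.ofBijective _ ⟨LinearMap.ker_eq_bot.1 hbot, hsurj⟩)

end Averaging

/-! ### Tensoring with a bimodule is right exact -/

/-- A functor that preserves the cokernels of all morphisms commutes with the cokernel functor. -/
noncomputable def cokerCompIso {C D : Type*} [Category* C] [Category* D] [Preadditive C]
    [Preadditive D] [HasCokernels C] [HasCokernels D] (T : C ⥤ D) [T.PreservesZeroMorphisms]
    (h : ∀ {X Y : C} (f : X ⟶ Y), IsIso (cokernelComparison f T)) :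
    T.mapArrow ⋙ coker D ≅ coker C ⋙ T :=
  NatIso.ofComponents (fun f => @asIso _ _ _ _ (cokernelComparison (X := f.left) (Y := f.right)
      f.hom T) (h _))
    fun {f g} φ => cokernel_map_comp_cokernelComparison (X := f.left) (Y := f.right) f.hom T
      (X' := g.left) (Y' := g.right) g.hom φ.left φ.right (Arrow.w φ).symm

namespace AlgBimodule

variable {k : Type u} [Field k] {B A : Type v} [Ring B] [Algebra k B] [Ring A] [Algebra k A]
  (P : AlgBimodule k B A)

/-- Pure tensors in `P ⊗_A X`. -/
def tmul {X : ModuleCat.{v} A} (p : P.carrier) (x : X) : P.tensorFunctor.obj X :=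
  Submodule.Quotient.mk (p ⊗ₜ[ℤ] x)

theorem tensorFunctor_map_tmul {X Y : ModuleCat.{v} A} (f : X ⟶ Y) (p : P.carrier) (x : X) :
    (P.tensorFunctor.map f).hom (P.tmul p x) = P.tmul p (f.hom x) := rfl

theorem tmul_smul {X : ModuleCat.{v} A} (p : P.carrier) (a : A) (x : X) :
    P.tmul p (a • x) = P.tmul (MulOpposite.op a • p) x :=
  Eq.symm ((Submodule.Quotient.eq _).2 (Submodule.subset_span ⟨p, a, x, rfl⟩))

theorem tmul_sum {X : ModuleCat.{v} A} (p : P.carrier) {τ : Type*} (s : Finset τ) (x : τ → X) :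
    P.tmul p (∑ t ∈ s, x t) = ∑ t ∈ s, P.tmul p (x t) := by
  unfold tmul
  rw [TensorProduct.tmul_sum]
  exact map_sum (Submodule.mkQ (P.balancing X)) _ _

theorem add_tmul {X : ModuleCat.{v} A} (p q : P.carrier) (x : X) :
    P.tmul (p + q) x = P.tmul p x + P.tmul q x := by
  unfold tmul
  rw [TensorProduct.add_tmul]
  rfl

theorem induction_on {X : ModuleCat.{v} A} {motive : P.tensorFunctor.obj X → Prop}
    (z : P.tensorFunctor.obj X) (tmul : ∀ p x, motive (P.tmul p x))
    (add : ∀ z w, motive z → motive w → motive (z + w)) : motive z := by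
  obtain ⟨t, rfl⟩ := Submodule.Quotient.mk_surjective _ z
  induction t using TensorProduct.induction_on with
  | zero =>
    have := tmul 0 0
    rwa [AlgBimodule.tmul, TensorProduct.zero_tmul] at this
  | tmul p x => exact tmul p x
  | add s t hs ht => exact add _ _ hs ht

instance : P.tensorFunctor.Additive where
  map_add {X Y f g} := by
    refine ModuleCat.hom_ext (LinearMap.ext fun z => ?_)
    induction z using P.induction_on with
    | tmul p x =>
      change P.tmul p (f.hom x + g.hom x) = P.tmul p (f.hom x) + P.tmul p (g.hom x)
      unfold AlgBimodule.tmul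
      rw [TensorProduct.tmul_add]
      rfl
    | add z w hz hw => rw [map_add, map_add, hz, hw]

theorem tensorFunctor_map_surjective {X Y : ModuleCat.{v} A} (f : X ⟶ Y)
    (hf : Function.Surjective f.hom) : Function.Surjective (P.tensorFunctor.map f).hom := by
  intro z
  induction z using P.induction_on with
  | tmul p y =>
    obtain ⟨x, rfl⟩ := hf y
    exact ⟨_, P.tensorFunctor_map_tmul f p x⟩
  | add z w hz hw =>
    obtain ⟨a, rfl⟩ := hz
    obtain ⟨b, rfl⟩ := hw
    exact ⟨a + b, map_add _ _ _⟩

/-- Right exactness over `ℤ` is corrected by the balancing relations: by surjectivity of `g` every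
relation for `Z` lifts to one for `Y`. -/
theorem tensorFunctor_map_exact {X Y Z : ModuleCat.{v} A} (f : X ⟶ Y) (g : Y ⟶ Z)
    (hfg : Function.Exact f.hom g.hom) (hg : Function.Surjective g.hom) (z : P.tensorFunctor.obj Y)
    (hz : (P.tensorFunctor.map g).hom z = 0) : ∃ w, (P.tensorFunctor.map f).hom w = z := by
  let mapT {X Y : ModuleCat.{v} A} (f : X ⟶ Y) : P.carrier ⊗[ℤ] X →ₗ[B] P.carrier ⊗[ℤ] Y :=
    TensorProduct.AlgebraTensorModule.map (LinearMap.id : P.carrier →ₗ[B] P.carrier)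
      f.hom.toAddMonoidHom.toIntLinearMap
  obtain ⟨t, rfl⟩ := Submodule.Quotient.mk_surjective _ z
  have h1 : mapT g t ∈ P.balancing Z := (Submodule.Quotient.mk_eq_zero _).1 hz
  have h2 : P.balancing Z ≤ (P.balancing Y).map (mapT g) := by
    rw [balancing, Submodule.span_le]
    rintro _ ⟨p, a, z, rfl⟩
    obtain ⟨y, rfl⟩ := hg z
    refine ⟨_, Submodule.subset_span ⟨p, a, y, rfl⟩, ?_⟩
    simp [mapT]
  obtain ⟨b, hb, hb'⟩ := h2 h1
  have hexact := lTensor_exact (R := ℤ) P.carrier (f := f.hom.toAddMonoidHom.toIntLinearMap)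
    (g := g.hom.toAddMonoidHom.toIntLinearMap) hfg hg
  have h3 : g.hom.toAddMonoidHom.toIntLinearMap.lTensor P.carrier (t - b) = 0 := by
    change mapT g (t - b) = 0
    rw [map_sub, hb', sub_self]
  obtain ⟨w, hw⟩ := (hexact _).1 h3
  refine ⟨Submodule.Quotient.mk w, (Submodule.Quotient.eq _).2 ?_⟩
  have h4 : mapT f w = t - b := hw
  change mapT f w - t ∈ _
  rw [h4, sub_sub_cancel_left]
  exact neg_mem hb

instance isIso_cokernelComparison {X Y : ModuleCat.{v} A} (f : X ⟶ Y) :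
    IsIso (cokernelComparison f P.tensorFunctor) := by
  have hπ : Function.Surjective (cokernel.π f).hom :=
    (ModuleCat.epi_iff_surjective _).1 inferInstance
  have hπ' : Function.Surjective (cokernel.π (P.tensorFunctor.map f)).hom :=
    (ModuleCat.epi_iff_surjective _).1 inferInstance
  have hcomp : ∀ z, (cokernelComparison f P.tensorFunctor).hom
      ((cokernel.π (P.tensorFunctor.map f)).hom z) =
        (P.tensorFunctor.map (cokernel.π f)).hom z := fun z =>
    congrArg (fun h => h.hom z) (π_comp_cokernelComparison f P.tensorFunctor)
  have hex : Function.Exact f.hom (cokernel.π f).hom :=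
    (ShortComplex.ShortExact.moduleCat_exact_iff_function_exact
      (ShortComplex.mk f (cokernel.π f) (cokernel.condition f))).1
      (ShortComplex.exact_cokernel f)
  rw [ConcreteCategory.isIso_iff_bijective]
  refine ⟨(injective_iff_map_eq_zero (cokernelComparison f P.tensorFunctor).hom).2 fun z hz => ?_,
    fun z => ?_⟩
  · obtain ⟨t, rfl⟩ := hπ' z
    rw [hcomp] at hz
    obtain ⟨w, rfl⟩ := P.tensorFunctor_map_exact _ _ hex hπ _ hz
    exact congrArg (fun h => h.hom w) (cokernel.condition (P.tensorFunctor.map f))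
  · obtain ⟨t, rfl⟩ := P.tensorFunctor_map_surjective _ hπ z
    exact ⟨_, hcomp t⟩

/-- The map out of `P ⊗_A X` that is induced by a balanced map. -/
def lift {X : ModuleCat.{v} A} {Z : Type*} [AddCommGroup Z] [Module B Z] (f : P.carrier → X →+ Z)
    (hadd : ∀ p q x, f (p + q) x = f p x + f q x) (hsmul : ∀ (b : B) p x, f (b • p) x = b • f p x)
    (hbal : ∀ p (a : A) x, f (MulOpposite.op a • p) x = f p (a • x)) :
    P.tensorFunctor.obj X →ₗ[B] Z :=
  Submodule.liftQ (P.balancing X) (TensorProduct.AlgebraTensorModule.lift (R := ℤ)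
    { toFun := fun p => (f p).toIntLinearMap
      map_add' := fun p q => LinearMap.ext fun x => hadd p q x
      map_smul' := fun b p => LinearMap.ext fun x => hsmul b p x })
    (Submodule.span_le.2 (by
      rintro _ ⟨p, a, x, rfl⟩
      rw [SetLike.mem_coe, LinearMap.mem_ker, map_sub, sub_eq_zero]
      exact hbal p a x))

/-- Tensoring with a bimodule commutes with cokernels. -/
noncomputable def cokerTensorIso :
    P.tensorFunctor.mapArrow ⋙ coker (ModuleCat.{v} B) ≅
      coker (ModuleCat.{v} A) ⋙ P.tensorFunctor :=
  cokerCompIso P.tensorFunctor P.isIso_cokernelComparison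

end AlgBimodule

/-! ### Additive functors between categories of projective modules -/

section EilenbergWatts

variable {k : Type u} [Field k] {A B : Type v} [Ring A] [Ring B]

/-- The morphism from the regular module that sends `1` to `y`. -/
abbrev FGProj.elemHom {Y : FGProj A} (y : Y.obj) : FGProj.self A ⟶ Y :=
  FGProj.homMk (LinearMap.toSpanSingleton A Y.obj y)

/-- Right multiplication by `a` on the regular module. -/
abbrev FGProj.mulHom (a : A) : FGProj.self A ⟶ FGProj.self A :=
  FGProj.elemHom (Y := FGProj.self A) a

theorem FGProj.mulHom_comp_elemHom {Y : FGProj A} (a : A) (y : Y.obj) :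
    FGProj.mulHom a ≫ FGProj.elemHom y = FGProj.elemHom (a • y) :=
  FGProj.hom_ext (LinearMap.ext fun x => mul_smul x a y)

theorem FGProj.elemHom_comp {Y Z : FGProj A} (y : Y.obj) (f : Y ⟶ Z) :
    FGProj.elemHom y ≫ f = FGProj.elemHom (FGProj.toLin f y) :=
  FGProj.hom_ext (LinearMap.ext fun x => map_smul (FGProj.toLin f) x y)

theorem FGProj.elemHom_add {Y : FGProj A} (y y' : Y.obj) :
    FGProj.elemHom (y + y') = FGProj.elemHom y + FGProj.elemHom y' :=
  FGProj.hom_ext (LinearMap.ext fun x => smul_add x y y')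

theorem FGProj.mulHom_one : FGProj.mulHom (1 : A) = 𝟙 _ :=
  FGProj.hom_ext (LinearMap.ext fun x => mul_one x)

variable (G : FGProj A ⥤ FGProj B)

theorem FGProj.toLin_map_comp {X Y Z : FGProj A} (f : X ⟶ Y) (g : Y ⟶ Z) (z : (G.obj X).obj) :
    FGProj.toLin (G.map (f ≫ g)) z = FGProj.toLin (G.map g) (FGProj.toLin (G.map f) z) := by
  rw [G.map_comp]
  rfl

theorem FGProj.toLin_map_id {X : FGProj A} (z : (G.obj X).obj) :
    FGProj.toLin (G.map (𝟙 X)) z = z := by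
  rw [G.map_id]
  rfl

theorem FGProj.toLin_map_mulHom_smul [Algebra k A] [Algebra k B] [G.Linear k] (r : k) (a : A) (z : (G.obj _).obj) :
    FGProj.toLin (G.map (FGProj.mulHom (r • a))) z =
      algebraMap k B r • FGProj.toLin (G.map (FGProj.mulHom a)) z := by
  have h : FGProj.mulHom (r • a) = r • FGProj.mulHom a :=
    FGProj.hom_ext (LinearMap.ext fun x => by
      change x * (r • a) = algebraMap k A r • (x * a)
      rw [mul_smul_comm, algebraMap_smul])
  rw [h, G.map_smul]
  rfl

variable [G.Additive]

theorem FGProj.toLin_map_sum {X Y : FGProj A} {τ : Type*} (s : Finset τ) (f : τ → (X ⟶ Y))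
    (z : (G.obj X).obj) :
    FGProj.toLin (G.map (∑ t ∈ s, f t)) z = ∑ t ∈ s, FGProj.toLin (G.map (f t)) z := by
  rw [G.map_sum, FGProj.toLin_sum, LinearMap.sum_apply]

theorem FGProj.toLin_map_add {X Y : FGProj A} (f g : X ⟶ Y)
    (z : (G.obj X).obj) :
    FGProj.toLin (G.map (f + g)) z = FGProj.toLin (G.map f) z + FGProj.toLin (G.map g) z := by
  rw [G.map_add]
  rfl

variable (k) [Algebra k A] [Algebra k B] [G.Linear k]

/-- The bimodule of an additive functor between categories of projective modules: its value at the
regular module. -/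
def FGProj.bimodule : AlgBimodule k B A :=
  letI : Module k (G.obj (FGProj.self A)).obj := Module.compHom _ (algebraMap k B)
  letI : Module Aᵐᵒᵖ (G.obj (FGProj.self A)).obj :=
    { smul := fun a p => FGProj.toLin (G.map (FGProj.mulHom a.unop)) p
      one_smul := fun p => by
        change FGProj.toLin (G.map (FGProj.mulHom 1)) p = p
        rw [FGProj.mulHom_one, FGProj.toLin_map_id]
      mul_smul := fun a b p => by
        change FGProj.toLin (G.map (FGProj.mulHom (b.unop * a.unop))) p =
          FGProj.toLin (G.map (FGProj.mulHom a.unop)) (FGProj.toLin (G.map (FGProj.mulHom b.unop)) p)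
        rw [← FGProj.toLin_map_comp, FGProj.mulHom_comp_elemHom]
      smul_zero := fun a => map_zero _
      smul_add := fun a p q => map_add _ _ _
      add_smul := fun a b p => by
        change FGProj.toLin (G.map (FGProj.elemHom (Y := FGProj.self A) (a.unop + b.unop))) p = _
        rw [FGProj.elemHom_add, FGProj.toLin_map_add]
        rfl
      zero_smul := fun p => by
        change FGProj.toLin (G.map (FGProj.mulHom 0)) p = 0
        have : FGProj.mulHom (0 : A) = 0 := FGProj.hom_ext (LinearMap.ext fun x => mul_zero x)
        rw [this, G.map_zero]
        rfl }
  { carrier := (G.obj (FGProj.self A)).obj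
    towerLeft := ⟨fun r b p => by
      change (r • b) • p = algebraMap k B r • b • p
      rw [Algebra.smul_def, mul_smul]⟩
    towerRight := ⟨fun r a p => FGProj.toLin_map_mulHom_smul G r a.unop p⟩
    comm := ⟨fun b a p => (map_smul (FGProj.toLin (G.map (FGProj.mulHom a.unop))) b p).symm⟩ }

/-- The canonical map `G(A) ⊗_A Y ⟶ G(Y)`. -/
def FGProj.tensorToObj (Y : FGProj A) :
    (FGProj.bimodule k G).tensorFunctor.obj Y.obj ⟶ (G.obj Y).obj :=
  ModuleCat.ofHom ((FGProj.bimodule k G).lift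
    (fun p => AddMonoidHom.mk' (fun y => FGProj.toLin (G.map (FGProj.elemHom y)) p)
      fun y y' => (congrArg (fun f => FGProj.toLin (G.map f) p) (FGProj.elemHom_add y y')).trans
        (FGProj.toLin_map_add G _ _ p))
    (fun p q y => map_add (FGProj.toLin (G.map (FGProj.elemHom y))) p q)
    (fun b p y => map_smul (FGProj.toLin (G.map (FGProj.elemHom y))) b p)
    (fun p a y => (FGProj.toLin_map_comp G _ _ p).symm.trans
      (congrArg (fun f => FGProj.toLin (G.map f) p) (FGProj.mulHom_comp_elemHom a y))))

theorem FGProj.tensorToObj_tmul (Y : FGProj A) (p : (FGProj.bimodule k G).carrier) (y : Y.obj) :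
    (FGProj.tensorToObj k G Y).hom ((FGProj.bimodule k G).tmul p y) =
      FGProj.toLin (G.map (FGProj.elemHom y)) p := rfl

theorem FGProj.exists_dual_basis (Y : FGProj A) : ∃ (n : ℕ) (y : Fin n → Y.obj)
    (f : Fin n → (Y ⟶ FGProj.self A)), ∑ i, f i ≫ FGProj.elemHom (y i) = 𝟙 Y := by
  obtain ⟨n, f, g, -, -, h⟩ := Module.Finite.exists_comp_eq_id_of_projective A Y.obj
  refine ⟨n, fun i => f (Pi.single i 1),
    fun i => FGProj.homMk (Y := FGProj.self A) (LinearMap.proj i ∘ₗ g), ?_⟩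
  apply FGProj.hom_ext
  rw [FGProj.toLin_sum]
  refine LinearMap.ext fun x => ?_
  rw [LinearMap.sum_apply]
  change ∑ i, g x i • f (Pi.single i 1) = x
  simp only [← map_smul, ← map_sum, ← Pi.single_smul, smul_eq_mul, mul_one,
    Finset.univ_sum_single]
  exact LinearMap.congr_fun h x

instance FGProj.isIso_tensorToObj (Y : FGProj A) : IsIso (FGProj.tensorToObj k G Y) := by
  obtain ⟨n, y, f, h⟩ := FGProj.exists_dual_basis Y
  -- The inverse is written with a dual basis of `Y`. It need not be known to be linear in advance;
  -- additivity is enough to check it on pure tensors.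
  let inv : (G.obj Y).obj → (FGProj.bimodule k G).tensorFunctor.obj Y.obj := fun z =>
    ∑ i, (FGProj.bimodule k G).tmul (FGProj.toLin (G.map (f i)) z) (y i)
  have hinv : ∀ z w, inv (z + w) = inv z + inv w := fun z w => by
    simp only [inv, map_add]
    rw [← Finset.sum_add_distrib]
    exact Finset.sum_congr rfl fun i _ => (FGProj.bimodule k G).add_tmul _ _ _
  rw [ConcreteCategory.isIso_iff_bijective]
  refine Function.bijective_iff_has_inverse.2 ⟨inv, fun z => ?_, fun z => ?_⟩
  · change inv ((FGProj.tensorToObj k G Y).hom z) = z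
    induction z using (FGProj.bimodule k G).induction_on with
    | tmul p x =>
      rw [FGProj.tensorToObj_tmul]
      have h1 : ∀ i, FGProj.toLin (G.map (f i)) (FGProj.toLin (G.map (FGProj.elemHom x)) p) =
          MulOpposite.op (show A from FGProj.toLin (f i) x) • p := fun i =>
        (FGProj.toLin_map_comp G _ _ p).symm.trans
          (congrArg (fun f => FGProj.toLin (G.map f) p) (FGProj.elemHom_comp x (f i)))
      have h2 : ∑ i, (show A from FGProj.toLin (f i) x) • y i = x := by
        have := congrArg (fun g => FGProj.toLin g x) h
        simp only [FGProj.toLin_sum, LinearMap.sum_apply] at this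
        exact this
      simp only [inv, h1]
      refine Eq.trans (Finset.sum_congr rfl fun i _ =>
        ((FGProj.bimodule k G).tmul_smul p (FGProj.toLin (f i) x) (y i)).symm) ?_
      rw [← AlgBimodule.tmul_sum, h2]
    | add z w hz hw => rw [map_add, hinv, hz, hw]
  · change (FGProj.tensorToObj k G Y).hom (inv z) = z
    rw [map_sum]
    calc _ = ∑ i, FGProj.toLin (G.map (f i ≫ FGProj.elemHom (y i))) z :=
          Finset.sum_congr rfl fun i _ => (FGProj.toLin_map_comp G _ _ z).symm
      _ = z := by rw [← FGProj.toLin_map_sum, h, FGProj.toLin_map_id]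

/-- An additive functor between categories of projective modules is given by a tensor product. -/
noncomputable def FGProj.tensorIso :
    ObjectProperty.ι _ ⋙ (FGProj.bimodule k G).tensorFunctor ≅ G ⋙ ObjectProperty.ι _ :=
  NatIso.ofComponents (fun Y => asIso (FGProj.tensorToObj k G Y)) fun {Y Z} f => by
    refine ModuleCat.hom_ext (LinearMap.ext fun z => ?_)
    change (FGProj.tensorToObj k G Z).hom
        (((FGProj.bimodule k G).tensorFunctor.map f.hom).hom z) =
      FGProj.toLin (G.map f) ((FGProj.tensorToObj k G Y).hom z)
    induction z using (FGProj.bimodule k G).induction_on with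
    | tmul p y =>
      exact (congrArg (fun f => FGProj.toLin (G.map f) p) (FGProj.elemHom_comp y f)).symm.trans
        (FGProj.toLin_map_comp G _ _ p)
    | add z w hz hw => rw [map_add, map_add, map_add, map_add, hz, hw]

end EilenbergWatts

/-! ### Free modules and weak kernels -/

section Free

variable {A B : Type v} [Ring A] [Ring B]

variable (A) in
/-- The free module of rank `m` as an object of `A`-proj. -/
abbrev FGProj.free (m : ℕ) : FGProj A := ⟨ModuleCat.of A (Fin m → A), inferInstance, inferInstance⟩

/-- The coordinate functions of a free module. -/
abbrev FGProj.freeProj (m : ℕ) (i : Fin m) : FGProj.free A m ⟶ FGProj.self A :=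
  FGProj.homMk (LinearMap.proj i)

/-- The basis of a free module. -/
abbrev FGProj.freeIncl (m : ℕ) (i : Fin m) : FGProj.self A ⟶ FGProj.free A m :=
  FGProj.homMk (LinearMap.single A (fun _ => A) i)

/-- The morphism from a free module that is given by a family of elements. -/
abbrev FGProj.freeDesc {m : ℕ} {Y : FGProj A} (y : Fin m → Y.obj) : FGProj.free A m ⟶ Y :=
  FGProj.homMk (X := FGProj.free A m) (Fintype.linearCombination A y)

theorem FGProj.freeDesc_eq_sum {m : ℕ} {Y : FGProj A} (y : Fin m → Y.obj) :
    FGProj.freeDesc y = ∑ i, FGProj.freeProj m i ≫ FGProj.elemHom (y i) := by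
  apply FGProj.hom_ext
  rw [FGProj.toLin_sum]
  refine LinearMap.ext fun x => ?_
  rw [LinearMap.sum_apply]
  exact Fintype.linearCombination_apply A y x

theorem FGProj.freeIncl_comp_freeProj_self {m : ℕ} (i : Fin m) :
    FGProj.freeIncl (A := A) m i ≫ FGProj.freeProj m i = 𝟙 _ :=
  FGProj.hom_ext (LinearMap.ext fun x => Pi.single_eq_same (M := fun _ => A) i x)

theorem FGProj.freeIncl_comp_freeProj_of_ne {m : ℕ} {i j : Fin m} (h : i ≠ j) :
    FGProj.freeIncl (A := A) m i ≫ FGProj.freeProj m j = 0 :=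
  FGProj.hom_ext (LinearMap.ext fun x => Pi.single_eq_of_ne (M := fun _ => A) h.symm x)

variable (G : FGProj A ⥤ FGProj B) [G.Additive]

theorem FGProj.toLin_map_freeDesc {m : ℕ} {Y : FGProj A} (y : Fin m → Y.obj)
    (z : (G.obj (FGProj.free A m)).obj) :
    FGProj.toLin (G.map (FGProj.freeDesc y)) z =
      ∑ i, FGProj.toLin (G.map (FGProj.elemHom (y i)))
        (FGProj.toLin (G.map (FGProj.freeProj m i)) z) := by
  rw [FGProj.freeDesc_eq_sum, FGProj.toLin_map_sum]
  exact Finset.sum_congr rfl fun i _ => FGProj.toLin_map_comp G _ _ z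

theorem FGProj.toLin_map_freeProj_sum {m : ℕ} (p : Fin m → (G.obj (FGProj.self A)).obj)
    (j : Fin m) :
    FGProj.toLin (G.map (FGProj.freeProj m j))
      (∑ i, FGProj.toLin (G.map (FGProj.freeIncl m i)) (p i)) = p j := by
  rw [map_sum, Finset.sum_eq_single j]
  · rw [← FGProj.toLin_map_comp, FGProj.freeIncl_comp_freeProj_self, FGProj.toLin_map_id]
  · intro i _ hi
    rw [← FGProj.toLin_map_comp, FGProj.freeIncl_comp_freeProj_of_ne hi, G.map_zero]
    rfl
  · simp

/-- Relations between elements of `A` are detected by a weak kernel. -/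
theorem FGProj.exists_weakKernel [IsNoetherianRing A] {m : ℕ} {Y : FGProj A} (f : FGProj.free A m ⟶ Y) :
    ∃ (l : ℕ) (a : Fin l → Fin m → A),
      FGProj.freeDesc (Y := FGProj.free A m) a ≫ f = 0 ∧
        ∀ (W : FGProj A) (w : W ⟶ FGProj.free A m), w ≫ f = 0 →
          ∃ h : W ⟶ FGProj.free A l, h ≫ FGProj.freeDesc (Y := FGProj.free A m) a = w := by
  let K : Submodule A (Fin m → A) := LinearMap.ker (FGProj.toLin f)
  obtain ⟨l, a, ha⟩ := Submodule.fg_iff_exists_fin_generating_family.1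
    ((isNoetherian_def (R := A) (M := Fin m → A)).1 inferInstance K)
  have hrange : LinearMap.range (Fintype.linearCombination A a) = K := by
    rw [Fintype.range_linearCombination, ha]
  refine ⟨l, a, FGProj.hom_ext (LinearMap.ext fun x => ?_), fun W w hw => ?_⟩
  · have : Fintype.linearCombination A a x ∈ K := hrange ▸ LinearMap.mem_range_self _ x
    exact this
  · have hmem : ∀ x, FGProj.toLin w x ∈ LinearMap.range (Fintype.linearCombination A a) :=
      fun x => hrange ▸ congrArg (fun h => FGProj.toLin h x) hw
    obtain ⟨h, hh⟩ := Module.projective_lifting_property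
      (Fintype.linearCombination A a).rangeRestrict
      (LinearMap.codRestrict _ (FGProj.toLin w) hmem) (LinearMap.surjective_rangeRestrict _)
    exact ⟨FGProj.homMk h, FGProj.hom_ext (LinearMap.ext fun x =>
      congrArg Subtype.val (LinearMap.congr_fun hh x))⟩

end Free

/-! ### Projectivity of the bimodule of a functor -/

section Criterion

variable {k : Type u} [Field k] {A B : Type v} [Ring A] [Ring B] [Algebra k A] [Algebra k B]

/-- Restriction along `B ⟶ B ⊗ Aᵒᵖ` turns `π` into a surjection onto a projective left `B`-module,
which splits. -/
theorem exists_envL_linear_section {P F : Type v} [AddCommGroup P] [Module (B ⊗[k] Aᵐᵒᵖ) P]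
    [Module B P] [Module.Projective B P] (hP : ∀ (b : B) (p : P), envL k A b • p = b • p)
    [AddCommGroup F] [Module (B ⊗[k] Aᵐᵒᵖ) F] (π : F →ₗ[B ⊗[k] Aᵐᵒᵖ] P)
    (hπ : Function.Surjective π) :
    ∃ σ : P →+ F, (∀ (b : B) p, σ (envL k A b • p) = envL k A b • σ p) ∧ ∀ p, π (σ p) = p := by
  let _ : Module B F := Module.compHom F
    (Algebra.TensorProduct.includeLeftRingHom (R := k) (A := B) (B := Aᵐᵒᵖ))
  let π' : F →ₗ[B] P :=
    { toFun := π
      map_add' := map_add π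
      map_smul' := fun b x => (map_smul π (envL k A b) x).trans (hP b _) }
  obtain ⟨σ, hσ⟩ := Module.projective_lifting_property π' LinearMap.id hπ
  exact ⟨σ.toAddMonoidHom, fun b p => (congrArg σ (hP b p)).trans (map_smul σ b p),
    LinearMap.congr_fun hσ⟩

variable (G : FGProj A ⥤ FGProj B) [G.Additive] [G.Linear k]

variable (k) in
/-- The bimodule of a functor is projective if the functor maps all morphisms to regular ones and
preserves weak kernels. -/
theorem FGProj.bimodule_isFGProjective [IsAlgClosed k] [Module.Finite k A]
    (hreg : ∀ {X Y : FGProj A} (f : X ⟶ Y), IsRegularHom (G.map f))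
    (hexact : ∀ {X' X Y : FGProj A} (g : X' ⟶ X) (f : X ⟶ Y), g ≫ f = 0 →
      (∀ (W : FGProj A) (w : W ⟶ X), w ≫ f = 0 → ∃ h : W ⟶ X', h ≫ g = w) →
      ∀ z : (G.obj X).obj, FGProj.toLin (G.map f) z = 0 →
        ∃ z', FGProj.toLin (G.map g) z' = z) :
    (FGProj.bimodule k G).IsFGProjective := by
  have : IsArtinianRing A := IsArtinianRing.of_finite k A
  let _ : Module (B ⊗[k] Aᵐᵒᵖ) (FGProj.bimodule k G).carrier := TensorProduct.Algebra.module
  have hL : ∀ (b : B) (p : (FGProj.bimodule k G).carrier), envL k A b • p = b • p := fun b p => by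
    rw [envL, TensorProduct.Algebra.smul_def, one_smul]
  have hR : ∀ (a : A) (p : (FGProj.bimodule k G).carrier),
      envR k B a • p = FGProj.toLin (G.map (FGProj.mulHom a)) p := fun a p => by
    rw [envR, TensorProduct.Algebra.smul_def, one_smul]
    rfl
  have hBfin : Module.Finite B (FGProj.bimodule k G).carrier :=
    inferInstanceAs (Module.Finite B (G.obj (FGProj.self A)).obj)
  have hBproj : Module.Projective B (FGProj.bimodule k G).carrier :=
    inferInstanceAs (Module.Projective B (G.obj (FGProj.self A)).obj)
  refine ⟨?_, ?_⟩
  · obtain ⟨s, hs⟩ := hBfin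
    refine ⟨s, eq_top_iff.2 fun p _ => ?_⟩
    have hp : p ∈ Submodule.span B (s : Set (FGProj.bimodule k G).carrier) := hs ▸ trivial
    induction hp using Submodule.span_induction with
    | mem p hp => exact Submodule.subset_span hp
    | zero => exact zero_mem _
    | add p q _ _ hp hq => exact add_mem (hp trivial) (hq trivial)
    | smul b p _ hp => rw [← hL]; exact Submodule.smul_mem _ _ (hp trivial)
  · obtain ⟨m, n, hn⟩ := Submodule.fg_iff_exists_fin_generating_family.1
      ((isNoetherian_def (R := A) (M := A)).1 inferInstance (Ring.jacobson A))
    let f : FGProj.free A m ⟶ FGProj.self A := FGProj.freeDesc (Y := FGProj.self A) n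
    obtain ⟨l, a, haf, ha⟩ := FGProj.exists_weakKernel f
    obtain ⟨g, hg⟩ := hreg f
    -- `G.map f` has image `P N`, and `g` is a quasi-inverse of it. So `1 - G(f) g` kills `P N` and
    -- differs from the identity by values in `P N`.
    let r : (FGProj.bimodule k G).carrier →ₗ[B] (FGProj.bimodule k G).carrier :=
      LinearMap.id - FGProj.toLin (G.map f) ∘ₗ FGProj.toLin g
    have hf : ∀ z, FGProj.toLin (G.map f) z = ∑ i, envR k B (n i) •
        (show (FGProj.bimodule k G).carrier from FGProj.toLin (G.map (FGProj.freeProj m i)) z) :=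
      fun z => (FGProj.toLin_map_freeDesc G (Y := FGProj.self A) n z).trans
        (Finset.sum_congr rfl fun i _ => (hR _ _).symm)
    refine projective_of_radical_conditions n hn
      (fun F _ _ π hπ => exists_envL_linear_section hL π hπ) r.toAddMonoidHom (fun b p => ?_)
      (fun c hc p => ?_) (fun p => ?_) a (fun j => ?_) fun p hp => ?_
    · rw [hL, hL]
      exact map_smul r b p
    · rw [hR]
      rw [← hn, Submodule.mem_span_range_iff_exists_fun] at hc
      obtain ⟨c, rfl⟩ := hc
      have h1 : FGProj.mulHom (∑ i, c i • n i) =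
          FGProj.elemHom (Y := FGProj.free A m) c ≫ f := by
        rw [FGProj.elemHom_comp]
        rfl
      have h2 : ∀ z, r (FGProj.toLin (G.map f) z) = 0 := fun z => sub_eq_zero.2
        (congrArg (fun h => FGProj.toLin h z) hg).symm
      rw [h1]
      exact (congrArg r (FGProj.toLin_map_comp G _ f p)).trans (h2 _)
    · have h1 : r p - p = - FGProj.toLin (G.map f) (FGProj.toLin g p) := sub_sub_cancel_left _ _
      refine (congrArg (· ∈ _) (h1.trans (congrArg _ (hf _)))).mpr (neg_mem ?_)
      exact Submodule.sum_mem _ fun i _ => Submodule.smul_mem_smul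
        (envR_mem_envIdeal (hn ▸ Submodule.subset_span ⟨i, rfl⟩)) trivial
    · have := congrArg (fun h => FGProj.toLin h (Pi.single j 1)) haf
      have h1 : Fintype.linearCombination A n (Fintype.linearCombination A a (Pi.single j 1)) = 0 :=
        this
      rwa [Fintype.linearCombination_apply_single, one_smul, Fintype.linearCombination_apply] at h1
    -- A relation over `n` in `P` is an element `z` of the kernel of `G.map f`. Exactness at the
    -- weak kernel writes `z` as a value of the image under `G` of the matrix `a`, and the
    -- coordinates of the preimage are the witnesses.
    · let z : (G.obj (FGProj.free A m)).obj :=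
        ∑ i, FGProj.toLin (G.map (FGProj.freeIncl m i)) (p i)
      have hz : ∀ j, FGProj.toLin (G.map (FGProj.freeProj m j)) z = p j :=
        FGProj.toLin_map_freeProj_sum G p
      obtain ⟨z', hz'⟩ := hexact _ f haf ha z (by
        rw [hf]
        exact (Finset.sum_congr rfl fun i _ => congrArg _ (hz i)).trans hp)
      refine ⟨fun j => FGProj.toLin (G.map (FGProj.freeProj l j)) z', fun i => ?_⟩
      have h1 : FGProj.freeDesc (Y := FGProj.free A m) a ≫ FGProj.freeProj m i =
          FGProj.freeDesc (Y := FGProj.self A) fun j => a j i := by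
        refine FGProj.hom_ext (LinearMap.ext fun x => ?_)
        change Fintype.linearCombination A a x i = Fintype.linearCombination A (fun j => a j i) x
        simp [Fintype.linearCombination_apply]
      refine (hz i).symm.trans ?_
      rw [← hz', ← FGProj.toLin_map_comp, h1, FGProj.toLin_map_freeDesc]
      exact Finset.sum_congr rfl fun j _ => (hR _ _).symm

end Criterion

/-! ### Left exact functors with regular values are projective functors -/

section ProjectiveFunctor

theorem CategoryTheory.Equivalence.exists_inverse_map_lift {C D : Type*} [Category* C]
    [Category* D] [Preadditive C] [Preadditive D] (e : C ≌ D) [e.functor.Additive] {X' X Y : D}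
    (g : X' ⟶ X) (f : X ⟶ Y) (h : ∀ (W : D) (w : W ⟶ X), w ≫ f = 0 → ∃ h : W ⟶ X', h ≫ g = w)
    (W : C) (w : W ⟶ e.inverse.obj X) (hw : w ≫ e.inverse.map f = 0) :
    ∃ h : W ⟶ e.inverse.obj X', h ≫ e.inverse.map g = w := by
  obtain ⟨l, hl⟩ := h (e.functor.obj W) (e.functor.map w ≫ e.counit.app X) (by
    have := congrArg e.functor.map hw
    rw [e.functor.map_comp, e.functor.map_zero] at this
    have h1 : e.counit.app X ≫ f = e.functor.map (e.inverse.map f) ≫ e.counit.app Y :=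
      (e.counit.naturality f).symm
    rw [Category.assoc, h1, ← Category.assoc, this, zero_comp])
  refine ⟨e.unit.app W ≫ e.inverse.map l, ?_⟩
  rw [Category.assoc, ← e.inverse.map_comp, hl, e.inverse.map_comp, ← Category.assoc]
  have := e.unit.naturality w
  rw [Functor.comp_map] at this
  rw [← this]
  simp

theorem CategoryTheory.Equivalence.exists_functor_map_lift {C D : Type*} [Category* C]
    [Category* D] [Preadditive C] [Preadditive D] (e : C ≌ D) [e.functor.Additive] {X' X Y : C}
    (g : X' ⟶ X) (f : X ⟶ Y) (h : ∀ (W : C) (w : W ⟶ X), w ≫ f = 0 → ∃ h : W ⟶ X', h ≫ g = w)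
    (W : D) (w : W ⟶ e.functor.obj X) (hw : w ≫ e.functor.map f = 0) :
    ∃ h : W ⟶ e.functor.obj X', h ≫ e.functor.map g = w :=
  have : e.symm.functor.Additive := inferInstanceAs e.inverse.Additive
  e.symm.exists_inverse_map_lift g f h W w hw

variable {k : Type u} [Field k] {C D : Type u₂} [Category.{v₂} C] [Category.{v₂} D]
  [Preadditive C] [Preadditive D]

/-- Taking cokernels of diagrams after applying `F` agrees with tensoring the cokernels with the
bimodule of the corresponding functor between categories of projective modules. -/
theorem nonempty_abMap_comp_abToModule_iso (F : C ⥤ D) [F.Additive] {A B : Type v₂} [Ring A]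
    [Ring B] [Algebra k A] [Algebra k B] (eC : C ≌ FGProj A) (eD : D ≌ FGProj B)
    [eC.functor.Additive] [eD.functor.Additive] (G : FGProj A ⥤ FGProj B) [G.Additive] [G.Linear k]
    (hG : eC.functor ⋙ G ≅ F ⋙ eD.functor) :
    Nonempty (abMap F ⋙ abToModule eD ≅
      abToModule eC ⋙ (FGProj.bimodule k G).tensorFunctor) := by
  let T := (FGProj.bimodule k G).tensorFunctor
  let β : (F ⋙ eD.functor) ⋙ ObjectProperty.ι _ ≅
      (eC.functor ⋙ ObjectProperty.ι _) ⋙ T :=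
    Functor.isoWhiskerRight hG.symm _ ≪≫
      Functor.isoWhiskerLeft eC.functor (FGProj.tensorIso k G).symm
  let γ : ((F ⋙ eD.functor) ⋙ ObjectProperty.ι _).mapArrow ⋙ coker (ModuleCat.{v₂} B) ≅
      (eC.functor ⋙ ObjectProperty.ι _).mapArrow ⋙ coker (ModuleCat.{v₂} A) ⋙ T :=
    Functor.isoWhiskerRight ((Functor.mapArrowFunctor _ _).mapIso β) _ ≪≫
      Functor.isoWhiskerLeft (eC.functor ⋙ ObjectProperty.ι _).mapArrow
        (FGProj.bimodule k G).cokerTensorIso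
  exact ⟨CategoryTheory.Quotient.natIsoLift _ (NatIso.ofComponents (fun X => γ.app X)
    fun f => γ.hom.naturality f)⟩

theorem isProjectiveFunctor_abMap [IsAlgClosed k] [Linear k C] [Linear k D] (F : C ⥤ D) [F.Additive] [F.Linear k]
    [HasZeroObject C] [HasZeroObject D]
    (hreg : ∀ {X Y : C} (f : X ⟶ Y), IsRegularHom (F.map f))
    [PreservesFiniteLimits (abMap F)] : IsProjectiveFunctor k (abMap F) := by
  intro A B _ _ _ _ _ _ eC eD _ _ _ _
  have : eC.inverse.Linear k := Equivalence.inverseLinear k eC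
  let G : FGProj A ⥤ FGProj B := eC.inverse ⋙ F ⋙ eD.functor
  refine ⟨FGProj.bimodule k G, FGProj.bimodule_isFGProjective k G
    (fun f => (hreg (eC.inverse.map f)).map eD.functor) fun {X' X Y} g f hgf hker z hz => ?_,
    nonempty_abMap_comp_abToModule_iso F eC eD G
      (Functor.isoWhiskerRight eC.unitIso.symm (F ⋙ eD.functor))⟩
  have hC := eC.exists_inverse_map_lift g f hker
  have hD := abMap_exact_of_preservesFiniteLimits F (eC.inverse.map g) (eC.inverse.map f)
    (by rw [← Functor.map_comp, hgf, Functor.map_zero]) hC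
  -- Maps from the regular module are elements, so lifting through the weak kernel becomes exactness
  -- on elements; the preimage is the value at 1.
  obtain ⟨h, hh⟩ := eD.exists_functor_map_lift _ _ hD (FGProj.self B)
    (FGProj.elemHom (Y := G.obj X) z) (by
      refine (FGProj.elemHom_comp (Y := G.obj X) z (G.map f)).trans ?_
      rw [hz]
      exact FGProj.hom_ext (LinearMap.ext fun x => smul_zero x))
  refine ⟨FGProj.toLin h (1 : B), ?_⟩
  exact (congrArg (fun h => FGProj.toLin h (1 : B)) hh).trans (one_smul B z)

end ProjectiveFunctor

theorem mainTheorem3 {k : Type u} [Field k] [IsAlgClosed k]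
    {𝒟 : Type u₁} [Bicategory.{w₁, v₁} 𝒟]
    [∀ a b : 𝒟, Preadditive (a ⟶ b)] [∀ a b : 𝒟, Linear k (a ⟶ b)]
    (h𝒟 : IsFinitaryTwoCategory k 𝒟)
    (M : FinitaryTwoRep.{u, w₁, v₁, u₁, v₂, u₂} k 𝒟)
    (htransitive : M.IsTransitive) (hsimple : M.IsSimple)
    (I : Set (IndecOneMor 𝒟)) (hI : M.IsApex I)
    (F : IndecOneMor 𝒟) (hF : F ∈ I) :
    (∀ X : DiagAb (M.obj F.src), Projective ((M.abAct F.hom).obj X)) ∧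
      (PreservesFiniteLimits (M.abAct F.hom) → IsProjectiveFunctor k (M.abAct F.hom)) := by
  have := h𝒟.finite_objects
  have : ∀ a b : 𝒟, IsIdempotentComplete (a ⟶ b) := fun a b =>
    (h𝒟.finitary_hom a b).isIdempotentComplete
  have : ∀ (a b : 𝒟) (X Y : a ⟶ b), Module.Finite k (X ⟶ Y) := fun a b =>
    (h𝒟.finitary_hom a b).finite_hom
  have : ∀ a b : 𝒟, Finite (IndecClass (a ⟶ b)) := fun a b =>
    (h𝒟.finitary_hom a b).finite_indecClass
  have := Fintype.ofFinite 𝒟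
  have := fun i => Fintype.ofFinite (IndecClass (M.obj i))
  have := fun a b : 𝒟 => Fintype.ofFinite (IndecClass (a ⟶ b))
  have hreg : ∀ {X Y : M.obj F.src} (f : X ⟶ Y), IsRegularHom ((M.act F.hom).map f) := fun f =>
    hI.isRegularHom_act htransitive hsimple hF f
  exact ⟨fun X => DiagAb.projective_of_isRegularHom _ (hreg X.as.hom),
    fun _ => isProjectiveFunctor_abMap _ hreg⟩
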